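/- Let $k$ be a field and let $A$ and $B$ be finite-dimensional $k$-algebras without non-zero semisimple direct summands (that is, if $A\cong C\times D$ as algebras with $C$ semisimple, then $C=0$, and likewise for $B$), such that the semisimple quotients $A/\operatorname{rad}A$ and $B/\operatorname{rad}B$ are separable $k$-algebras. All bimodules are $k$-central. For a finite-dimensional algebra $A$, let $\mathrm{K}(\operatorname{proj}A)$ be the homotopy category of unbounded cochain complexes of finitely generated projective right $A$-modules, and let $\mathcal{L}_A$ be its full subcategory $$\mathcal{L}_A=\{F\in\mathrm{K}(\operatorname{proj}A)\mid \mathrm{H}^{i}(F)=0 \text{ for all } i<0,\ \mathrm{H}_{i}(F^{*})=0\text{ for all } i\geqslant 0\},$$ where $F^{*}=\operatorname{Hom}_A(F,A)$ is the chain complex with $\operatorname{Hom}_A(F^i,A)$ in degree $i$. Let $M$ be a finite-dimensional $A$-$B$-bimodule such that componentwise application of $-\otimes_A M$ maps complexes in $\mathcal{L}_A$ to complexes in $\mathcal{L}_B$ and induces an equivalence of categories $\mathcal{L}_A\to\mathcal{L}_B$. Let $N=\operatorname{Hom}_B(M,B)$ (homomorphisms of right $B$-modules), a $B$-$A$-bimodule.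 Then $M$ and $N$ induce a stable equivalence of Morita type between $A$ and $B$: the modules ${}_AM$, $M_B$, ${}_BN$ and $N_A$ are projective, and there are a finitely generated projective $A$-$A$-bimodule $P$ and a finitely generated projective $B$-$B$-bimodule $Q$ such that $$M\otimes_B N\cong A\oplus P\qquad\text{and}\qquad N\otimes_A M\cong B\oplus Q$$ as bimodules. -/

import Mathlib

open CategoryTheory TensorProduct MulOpposite

/-! ## Tensor products over a noncommutative ring

Right `R`-modules are modules over `Rᵐᵒᵖ`; an `R`-`S`-bimodule is a left `R`-module which is also a
right `S`-module such that the two actions commute. -/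

/-- The additive subgroup of `X ⊗[ℤ] M` generated by all `x r ⊗ m - x ⊗ r m`. -/
def balancedRel (R X M : Type*) [Ring R] [AddCommGroup X] [Module Rᵐᵒᵖ X]
    [AddCommGroup M] [Module R M] : AddSubgroup (X ⊗[ℤ] M) :=
  AddSubgroup.closure {t | ∃ (x : X) (r : R) (m : M), t = (op r • x) ⊗ₜ[ℤ] m - x ⊗ₜ[ℤ] (r • m)}

/-- The tensor product `X ⊗_R M` of a right `R`-module `X` and a left `R`-module `M`. -/
def BalancedTensor (R X M : Type*) [Ring R] [AddCommGroup X] [Module Rᵐᵒᵖ X]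
    [AddCommGroup M] [Module R M] : Type _ :=
  (X ⊗[ℤ] M) ⧸ balancedRel R X M

namespace BalancedTensor

section

variable {R X Y Z M M' M'' : Type*} [Ring R] [AddCommGroup X] [Module Rᵐᵒᵖ X]
  [AddCommGroup Y] [Module Rᵐᵒᵖ Y] [AddCommGroup Z] [Module Rᵐᵒᵖ Z]
  [AddCommGroup M] [Module R M] [AddCommGroup M'] [Module R M'] [AddCommGroup M''] [Module R M'']

instance : AddCommGroup (BalancedTensor R X M) :=
  inferInstanceAs (AddCommGroup ((X ⊗[ℤ] M) ⧸ balancedRel R X M))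

/-- The elementary tensor `x ⊗ m` in `X ⊗_R M`. -/
def tmul (R : Type*) {X M : Type*} [Ring R] [AddCommGroup X] [Module Rᵐᵒᵖ X]
    [AddCommGroup M] [Module R M] (x : X) (m : M) : BalancedTensor R X M :=
  QuotientAddGroup.mk' (balancedRel R X M) (x ⊗ₜ[ℤ] m)

theorem smul_tmul (r : R) (x : X) (m : M) : tmul R (op r • x) m = tmul R x (r • m) := by
  refine (QuotientAddGroup.eq_iff_sub_mem).2 (AddSubgroup.subset_closure ⟨x, r, m, rfl⟩)

theorem hom_ext {G : Type*} [AddCommGroup G] {f g : BalancedTensor R X M →+ G}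
    (h : ∀ x m, f (tmul R x m) = g (tmul R x m)) : f = g := by
  ext t
  obtain ⟨t, rfl⟩ := QuotientAddGroup.mk_surjective t
  induction t using TensorProduct.induction_on with
  | zero => exact (map_zero f).trans (map_zero g).symm
  | tmul x m => exact h x m
  | add a b ha hb =>
    exact (map_add f _ _).trans ((congrArg₂ (· + ·) ha hb).trans (map_add g _ _).symm)

/-- The map `f ⊗ g : X ⊗_R M → Y ⊗_R M'`. -/
def map (f : X →ₗ[Rᵐᵒᵖ] Y) (g : M →ₗ[R] M') : BalancedTensor R X M →+ BalancedTensor R Y M' :=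
  QuotientAddGroup.map (balancedRel R X M) (balancedRel R Y M')
    (TensorProduct.map f.toAddMonoidHom.toIntLinearMap
      g.toAddMonoidHom.toIntLinearMap).toAddMonoidHom (by
      rw [balancedRel, AddSubgroup.closure_le]
      rintro _ ⟨x, r, m, rfl⟩
      refine AddSubgroup.subset_closure ⟨f x, r, g m, ?_⟩
      simp)

@[simp]
theorem map_tmul (f : X →ₗ[Rᵐᵒᵖ] Y) (g : M →ₗ[R] M') (x : X) (m : M) :
    map f g (tmul R x m) = tmul R (f x) (g m) := rfl

theorem add_tmul (x y : X) (m : M) : tmul R (x + y) m = tmul R x m + tmul R y m :=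
  (congrArg (QuotientAddGroup.mk' (balancedRel R X M)) (TensorProduct.add_tmul x y m)).trans (map_add _ _ _)

theorem tmul_add (x : X) (m n : M) : tmul R x (m + n) = tmul R x m + tmul R x n :=
  (congrArg (QuotientAddGroup.mk' (balancedRel R X M)) (TensorProduct.tmul_add x m n)).trans (map_add _ _ _)

theorem zero_tmul (m : M) : tmul R (0 : X) m = 0 :=
  (congrArg (QuotientAddGroup.mk' (balancedRel R X M)) (TensorProduct.zero_tmul X m)).trans (map_zero _)

theorem tmul_zero (x : X) : tmul R x (0 : M) = 0 :=
  (congrArg (QuotientAddGroup.mk' (balancedRel R X M)) (TensorProduct.tmul_zero M x)).trans (map_zero _)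

theorem map_id : map (LinearMap.id : X →ₗ[Rᵐᵒᵖ] X) (LinearMap.id : M →ₗ[R] M)
    = AddMonoidHom.id _ :=
  hom_ext fun _ _ => rfl

theorem map_comp (f : X →ₗ[Rᵐᵒᵖ] Y) (f' : Y →ₗ[Rᵐᵒᵖ] Z) (g : M →ₗ[R] M') (g' : M' →ₗ[R] M'') :
    map (f' ∘ₗ f) (g' ∘ₗ g) = (map f' g').comp (map f g) :=
  hom_ext fun _ _ => rfl

end

section

variable {R S X M : Type*} [Ring R] [Ring S] [AddCommGroup X] [Module Rᵐᵒᵖ X]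
  [AddCommGroup M] [Module R M]

/-- If `X` is an `S`-`R`-bimodule, then `X ⊗_R M` is a left `S`-module: `s (x ⊗ m) = s x ⊗ m`. -/
instance leftModule [Module S X] [SMulCommClass S Rᵐᵒᵖ X] : Module S (BalancedTensor R X M) where
  smul s := map (Module.toModuleEnd Rᵐᵒᵖ (S := S) X s) LinearMap.id
  one_smul := DFunLike.congr_fun (f := map (Module.toModuleEnd Rᵐᵒᵖ (S := S) X 1) LinearMap.id)
    (g := AddMonoidHom.id _) (hom_ext fun x m => by simp)
  mul_smul s s' := DFunLike.congr_fun
    (f := map (Module.toModuleEnd Rᵐᵒᵖ (S := S) X (s * s')) LinearMap.id)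
    (g := (map (Module.toModuleEnd Rᵐᵒᵖ (S := S) X s) LinearMap.id).comp
      (map (Module.toModuleEnd Rᵐᵒᵖ (S := S) X s') LinearMap.id))
    (hom_ext fun x m => by simp [mul_smul])
  smul_zero s := map_zero (map (Module.toModuleEnd Rᵐᵒᵖ (S := S) X s) LinearMap.id)
  smul_add s := map_add (map (Module.toModuleEnd Rᵐᵒᵖ (S := S) X s) LinearMap.id)
  add_smul s s' := DFunLike.congr_fun
    (f := map (Module.toModuleEnd Rᵐᵒᵖ (S := S) X (s + s')) LinearMap.id)
    (g := map (Module.toModuleEnd Rᵐᵒᵖ (S := S) X s) LinearMap.id +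
      map (Module.toModuleEnd Rᵐᵒᵖ (S := S) X s') LinearMap.id)
    (hom_ext fun x m => by simp [add_smul, add_tmul])
  zero_smul := DFunLike.congr_fun (f := map (Module.toModuleEnd Rᵐᵒᵖ (S := S) X 0) LinearMap.id)
    (g := 0) (hom_ext fun x m => by simp [zero_tmul])

theorem left_smul_tmul [Module S X] [SMulCommClass S Rᵐᵒᵖ X] (s : S) (x : X) (m : M) :
    s • tmul R x m = tmul R (s • x) m := rfl

/-- If `M` is an `R`-`S`-bimodule, then `X ⊗_R M` is a right `S`-module: `(x ⊗ m) s = x ⊗ m s`. -/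
instance rightModule [Module Sᵐᵒᵖ M] [SMulCommClass R Sᵐᵒᵖ M] :
    Module Sᵐᵒᵖ (BalancedTensor R X M) :=
  haveI : SMulCommClass Sᵐᵒᵖ R M := SMulCommClass.symm R Sᵐᵒᵖ M
  { smul s := map LinearMap.id (Module.toModuleEnd R (S := Sᵐᵒᵖ) M s)
    one_smul := DFunLike.congr_fun (f := map LinearMap.id (Module.toModuleEnd R (S := Sᵐᵒᵖ) M 1))
      (g := AddMonoidHom.id _) (hom_ext fun x m => by simp)
    mul_smul s s' := DFunLike.congr_fun
      (f := map LinearMap.id (Module.toModuleEnd R (S := Sᵐᵒᵖ) M (s * s')))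
      (g := (map LinearMap.id (Module.toModuleEnd R (S := Sᵐᵒᵖ) M s)).comp
        (map LinearMap.id (Module.toModuleEnd R (S := Sᵐᵒᵖ) M s')))
      (hom_ext fun x m => by simp [mul_smul])
    smul_zero s := map_zero (map LinearMap.id (Module.toModuleEnd R (S := Sᵐᵒᵖ) M s))
    smul_add s := map_add (map LinearMap.id (Module.toModuleEnd R (S := Sᵐᵒᵖ) M s))
    add_smul s s' := DFunLike.congr_fun
      (f := map LinearMap.id (Module.toModuleEnd R (S := Sᵐᵒᵖ) M (s + s')))
      (g := map LinearMap.id (Module.toModuleEnd R (S := Sᵐᵒᵖ) M s) +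
        map LinearMap.id (Module.toModuleEnd R (S := Sᵐᵒᵖ) M s'))
      (hom_ext fun x m => by simp [add_smul, tmul_add])
    zero_smul := DFunLike.congr_fun
      (f := map LinearMap.id (Module.toModuleEnd R (S := Sᵐᵒᵖ) M 0))
      (g := 0) (hom_ext fun x m => by simp [tmul_zero]) }

theorem right_smul_tmul [Module Sᵐᵒᵖ M] [SMulCommClass R Sᵐᵒᵖ M] (s : Sᵐᵒᵖ) (x : X) (m : M) :
    s • tmul R x m = tmul R x (s • m) := rfl

end

/-- For an `R`-`S`-bimodule `M` and a map `f : X → Y` of right `R`-modules, the map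
`f ⊗ M : X ⊗_R M → Y ⊗_R M` of right `S`-modules. -/
def mapRight {R : Type*} (S : Type*) {X Y : Type*} (M : Type*) [Ring R] [Ring S]
    [AddCommGroup X] [Module Rᵐᵒᵖ X] [AddCommGroup Y] [Module Rᵐᵒᵖ Y]
    [AddCommGroup M] [Module R M] [Module Sᵐᵒᵖ M] [SMulCommClass R Sᵐᵒᵖ M] (f : X →ₗ[Rᵐᵒᵖ] Y) :
    BalancedTensor R X M →ₗ[Sᵐᵒᵖ] BalancedTensor R Y M where
  toFun := map f LinearMap.id
  map_add' := map_add _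
  map_smul' s := by
    have : SMulCommClass Sᵐᵒᵖ R M := SMulCommClass.symm R Sᵐᵒᵖ M
    exact DFunLike.congr_fun
      (f := (map f LinearMap.id).comp (map LinearMap.id (Module.toModuleEnd R (S := Sᵐᵒᵖ) M s)))
      (g := (map LinearMap.id (Module.toModuleEnd R (S := Sᵐᵒᵖ) M s)).comp (map f LinearMap.id))
      (hom_ext fun _ _ => rfl)

end BalancedTensor

universe u

section

variable (A B M : Type u) [Ring A] [Ring B] [AddCommGroup M] [Module A M] [Module Bᵐᵒᵖ M]
  [SMulCommClass A Bᵐᵒᵖ M]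

/-- The functor `- ⊗_A M` from right `A`-modules to right `B`-modules. -/
def tensorBimodule : ModuleCat.{u} Aᵐᵒᵖ ⥤ ModuleCat.{u} Bᵐᵒᵖ where
  obj X := ModuleCat.of Bᵐᵒᵖ (BalancedTensor A X M)
  map f := ModuleCat.ofHom (BalancedTensor.mapRight B M f.hom)
  map_id X := ModuleCat.hom_ext (LinearMap.ext fun t =>
    DFunLike.congr_fun (BalancedTensor.map_id (R := A) (X := X) (M := M)) t)
  map_comp f g := ModuleCat.hom_ext (LinearMap.ext fun t =>
    DFunLike.congr_fun
      (BalancedTensor.map_comp f.hom g.hom (LinearMap.id : M →ₗ[A] M) LinearMap.id) t)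

instance tensorBimodule_additive : (tensorBimodule A B M).Additive where
  map_add {_ _ f g} := ModuleCat.hom_ext (LinearMap.ext fun t =>
    (DFunLike.congr_fun (BalancedTensor.hom_ext fun _ _ => BalancedTensor.add_tmul _ _ _ :
      BalancedTensor.map (f.hom + g.hom) (LinearMap.id : M →ₗ[A] M) =
        BalancedTensor.map f.hom LinearMap.id + BalancedTensor.map g.hom LinearMap.id) t))

end

/-! ## Kato's category -/

/-- The homotopy category `K(Mod A)` of unbounded cochain complexes of right `A`-modules. -/
abbrev RightHomotopyCategory (A : Type u) [Ring A] :=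
  HomotopyCategory (ModuleCat.{u} Aᵐᵒᵖ) (ComplexShape.up ℤ)

/-- The differential `Hom_A(d, A) : Hom_A(F^j, A) → Hom_A(F^i, A)` of the `A`-dual of a complex of
right `A`-modules. -/
def dualDifferential (A : Type u) [Ring A] (F : CochainComplex (ModuleCat.{u} Aᵐᵒᵖ) ℤ) (i j : ℤ) :
    (F.X j →ₗ[Aᵐᵒᵖ] A) →+ (F.X i →ₗ[Aᵐᵒᵖ] A) where
  toFun φ := φ ∘ₗ (F.d i j).hom
  map_zero' := LinearMap.zero_comp _
  map_add' _ _ := LinearMap.add_comp _ _ _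

/-- The complexes `F` of finitely generated projective right `A`-modules with `H^i(F) = 0` for
`i < 0` and `H_i(F^*) = 0` for `i ≥ 0`. -/
def katoProperty (A : Type u) [Ring A] : ObjectProperty (RightHomotopyCategory A) := fun F =>
  (∀ i, Module.Finite Aᵐᵒᵖ (F.as.X i) ∧ Module.Projective Aᵐᵒᵖ (F.as.X i)) ∧
  (∀ i < 0, F.as.ExactAt i) ∧
  ∀ i ≥ 0, Function.Exact (dualDifferential A F.as i (i + 1)) (dualDifferential A F.as (i - 1) i)

/-- Kato's category `𝓛_A`: a full subcategory of the homotopy category. -/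
abbrev KatoCategory (A : Type u) [Ring A] := (katoProperty A).FullSubcategory

/-- Applying `- ⊗_A M` componentwise maps complexes in `𝓛_A` to complexes in `𝓛_B`, and the
resulting functor `𝓛_A ⥤ 𝓛_B` is an equivalence of categories. -/
def TensorInducesKatoEquivalence (A B M : Type u) [Ring A] [Ring B] [AddCommGroup M] [Module A M]
    [Module Bᵐᵒᵖ M] [SMulCommClass A Bᵐᵒᵖ M] : Prop :=
  ∃ h : ∀ F : KatoCategory A, katoProperty B
      (((katoProperty A).ι ⋙
        (tensorBimodule A B M).mapHomotopyCategory (ComplexShape.up ℤ)).obj F),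
    ((katoProperty B).lift ((katoProperty A).ι ⋙
        (tensorBimodule A B M).mapHomotopyCategory (ComplexShape.up ℤ)) h).IsEquivalence

/-! ## The dual bimodule -/

/-- `Hom_B(M, B)` for an `A`-`B`-bimodule `M`: the homomorphisms of right `B`-modules. -/
def DualBimodule (B M : Type*) [Ring B] [AddCommGroup M] [Module Bᵐᵒᵖ M] : Type _ :=
  M →ₗ[Bᵐᵒᵖ] B

namespace DualBimodule

variable {A B M : Type*} [Ring A] [Ring B] [AddCommGroup M] [Module Bᵐᵒᵖ M]

instance : AddCommGroup (DualBimodule B M) := inferInstanceAs (AddCommGroup (M →ₗ[Bᵐᵒᵖ] B))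

instance : FunLike (DualBimodule B M) M B := inferInstanceAs (FunLike (M →ₗ[Bᵐᵒᵖ] B) M B)

/-- The left action of `B`, given by `(b f)(m) = b (f m)`. -/
instance : Module B (DualBimodule B M) := inferInstanceAs (Module B (M →ₗ[Bᵐᵒᵖ] B))

/-- The right action of `A`, given by `(f a)(m) = f (a m)`. -/
instance [Module A M] [SMulCommClass A Bᵐᵒᵖ M] : Module Aᵐᵒᵖ (DualBimodule B M) where
  smul a f := (LinearMap.comp f (Module.toModuleEnd Bᵐᵒᵖ (S := A) M a.unop) : M →ₗ[Bᵐᵒᵖ] B)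
  one_smul f := LinearMap.ext fun m => congrArg f (one_smul A m)
  mul_smul a a' f := LinearMap.ext fun m => congrArg f (mul_smul a'.unop a.unop m)
  smul_zero _ := rfl
  smul_add _ _ _ := rfl
  add_smul a a' f := LinearMap.ext fun m =>
    (congrArg f (add_smul a.unop a'.unop m)).trans (LinearMap.map_add f _ _)
  zero_smul f := LinearMap.ext fun m => (congrArg f (zero_smul A m)).trans (LinearMap.map_zero f)

theorem left_smul_apply (b : B) (f : DualBimodule B M) (m : M) : (b • f) m = b * f m := rfl

theorem right_smul_apply [Module A M] [SMulCommClass A Bᵐᵒᵖ M] (a : A) (f : DualBimodule B M)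
    (m : M) : (op a • f) m = f (a • m) := rfl

instance [Module A M] [SMulCommClass A Bᵐᵒᵖ M] : SMulCommClass B Aᵐᵒᵖ (DualBimodule B M) where
  smul_comm _ _ _ := rfl

end DualBimodule

/-! ## Stable equivalences of Morita type -/

/-- The `A`-`A`-bimodule `T` is isomorphic to `A ⊕ P` for a finitely generated projective
`A`-`A`-bimodule `P`, that is, a finitely generated projective module over the enveloping algebra
`A ⊗[k] Aᵐᵒᵖ`. -/
def IsRegularPlusProjective (k A T : Type u) [Field k] [Ring A] [Algebra k A] [AddCommGroup T]
    [Module A T] [Module Aᵐᵒᵖ T] : Prop :=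
  ∃ (P : Type u) (_ : AddCommGroup P) (_ : Module (A ⊗[k] Aᵐᵒᵖ) P),
    Module.Finite (A ⊗[k] Aᵐᵒᵖ) P ∧ Module.Projective (A ⊗[k] Aᵐᵒᵖ) P ∧
    ∃ e : T ≃+ A × P, ∀ (a a' : A) (t : T),
      e (a • op a' • t) = (a * (e t).1 * a', (a ⊗ₜ[k] op a') • (e t).2)

/-- An `A`-`B`-bimodule `M` and a `B`-`A`-bimodule `N` induce a stable equivalence of Morita type:
both are projective on each side, `M ⊗_B N ≅ A ⊕ P` and `N ⊗_A M ≅ B ⊕ Q` as bimodules, with `P`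
and `Q` projective bimodules. -/
structure IsStableEquivalenceOfMoritaType (k A B M N : Type u) [Field k] [Ring A] [Algebra k A]
    [Ring B] [Algebra k B] [AddCommGroup M] [Module A M] [Module Bᵐᵒᵖ M] [SMulCommClass A Bᵐᵒᵖ M]
    [AddCommGroup N] [Module B N] [Module Aᵐᵒᵖ N] [SMulCommClass B Aᵐᵒᵖ N] : Prop where
  projective_left_M : Module.Projective A M
  projective_right_M : Module.Projective Bᵐᵒᵖ M
  projective_left_N : Module.Projective B N
  projective_right_N : Module.Projective Aᵐᵒᵖ N
  tensor_M_N : IsRegularPlusProjective k A (BalancedTensor B M N)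
  tensor_N_M : IsRegularPlusProjective k B (BalancedTensor A N M)

/-! ## Conditions on the algebras -/

/-- A (not necessarily commutative) `k`-algebra `S` is separable: it has a separability idempotent,
an element `e` of `S ⊗[k] S` with `μ(e) = 1` and `s e = e s` for the outer bimodule structure. -/
def IsSeparableAlgebra (k S : Type*) [Field k] [Ring S] [Algebra k S] : Prop :=
  ∃ e : S ⊗[k] S, LinearMap.mul' k S e = 1 ∧
    ∀ s : S, (s ⊗ₜ[k] (1 : S)) * e = e * ((1 : S) ⊗ₜ[k] s)

/-- `A` has no nonzero semisimple direct summand: if `A ≅ C × D` with `C` semisimple, then `C = 0`.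
(Every decomposition of a `k`-algebra as a product of rings is one of `k`-algebras.) -/
def NoSemisimpleSummand (A : Type u) [Ring A] : Prop :=
  ∀ (C D : Type u) [Ring C] [Ring D] [IsSemisimpleRing C], (A ≃+* C × D) → Subsingleton C

/-! ## Tensor products over a noncommutative ring: universal property and exactness -/

/-! Taking the cokernel of F⁻¹ → F⁰ identifies 𝓛_A with the category of finitely generated right
A-modules modulo maps that factor through free modules. In negative degrees exactness of F lets
chain maps and homotopies be lifted; in nonnegative degrees exactness of F* lets them be extended
(`exists_chainMap`, `exists_nullHomotopy`, `Homotopy.factorsThroughFree`). Every matrix over A is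
the differential in degree −1 of such a complex (`exists_isKato`). As tensoring is right exact, the
hypothesis makes − ⊗_A M a stable equivalence (`stable_full`, `stable_faithful`, `stable_essSurj`).
It also says that the tensored complexes satisfy both exactness conditions again. For arbitrary
relation matrices these are equational criteria for M on the left and N on the right, so both are
projective.

The functor Hom_B(M, −) is right adjoint to − ⊗_A M and both respect maps factoring through free
modules, so unit and counit are stable isomorphisms (`unit_stable`, `counit_stable`). Making them
split on the nose needs generators, and this is where semisimple summands are excluded. If I is a
right ideal of A with IM = 0 or IM = M, then (A/I) ⊗_A M is M or 0, hence projective; so A/I is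
projective and I is generated by an idempotent. A proper trace ideal of M would then have a nonzero
von Neumann regular block of A as its left annihilator (`NoRegularBlock.one_mem`). Variants of the
argument show that N generates the right A-modules and that the evaluation N ⊗_A M → B is onto.

Now A → M ⊗_B N ≅ End_B(M) is split injective on the left, and N ⊗_A M → B is onto. The cokernel C
of the first and the kernel K of the second are projective on the left. Modulo the radical r they
become the cokernel of the unit at A/r and the kernel of the counit at B/r, which are projective on
the right. Separability of the semisimple quotient and nilpotence of r then make C and K projective
bimodules: presentations split modulo r by averaging, and the splitting lifts
(`IsEnveloping.projective`).

Projectivity of C splits the first sequence. In the second the projective term is the kernel, so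
bimodule maps K → B ⊗ Bᵐᵒᵖ have to be extended to N ⊗_A M. With W = Hom_k(B, k) they amount to right
linear maps W ⊗_B K → B, and these extend because the counit at W splits
(`BalancedTensor.exists_extension`). -/

namespace BalancedTensor

section

variable {R X Y Z M M' G : Type*} [Ring R] [AddCommGroup X] [Module Rᵐᵒᵖ X]
  [AddCommGroup Y] [Module Rᵐᵒᵖ Y] [AddCommGroup Z] [Module Rᵐᵒᵖ Z]
  [AddCommGroup M] [Module R M] [AddCommGroup M'] [Module R M'] [AddCommGroup G]

/-- The universal property of `X ⊗_R M`. -/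
def lift (f : X →+ M →+ G) (hf : ∀ (x : X) (r : R) (m : M), f (op r • x) m = f x (r • m)) :
    BalancedTensor R X M →+ G :=
  QuotientAddGroup.lift (balancedRel R X M)
    (TensorProduct.liftAddHom f fun n x m => by simp) (by
      rw [balancedRel, AddSubgroup.closure_le]
      rintro _ ⟨x, r, m, rfl⟩
      simp [hf])

@[simp]
theorem lift_tmul (f : X →+ M →+ G) (hf) (x : X) (m : M) :
    lift (R := R) f hf (tmul R x m) = f x m := rfl

@[elab_as_elim]
theorem induction_on {p : BalancedTensor R X M → Prop} (t : BalancedTensor R X M)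
    (zero : p 0) (tmul : ∀ x m, p (tmul R x m)) (add : ∀ a b, p a → p b → p (a + b)) : p t := by
  obtain ⟨t, rfl⟩ := QuotientAddGroup.mk_surjective t
  induction t using TensorProduct.induction_on with
  | zero => exact zero
  | tmul x m => exact tmul x m
  | add a b ha hb => exact add _ _ ha hb

/-- The elementary tensor as a biadditive map. -/
def mk (R X M : Type*) [Ring R] [AddCommGroup X] [Module Rᵐᵒᵖ X] [AddCommGroup M] [Module R M] :
    X →+ M →+ BalancedTensor R X M :=
  AddMonoidHom.mk' (fun x => AddMonoidHom.mk' (fun m => tmul R x m) (tmul_add x))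
    fun x y => AddMonoidHom.ext fun m => add_tmul x y m

@[simp]
theorem mk_apply (x : X) (m : M) : mk R X M x m = tmul R x m := rfl

theorem tmul_sum {ι : Type*} (s : Finset ι) (x : X) (m : ι → M) :
    tmul R x (∑ i ∈ s, m i) = ∑ i ∈ s, tmul R x (m i) := map_sum (mk R X M x) m s

theorem sum_tmul {ι : Type*} (s : Finset ι) (x : ι → X) (m : M) :
    tmul R (∑ i ∈ s, x i) m = ∑ i ∈ s, tmul R (x i) m := map_sum ((mk R X M).flip m) x s

theorem map_surjective {f : X →ₗ[Rᵐᵒᵖ] Y} (hf : Function.Surjective f) :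
    Function.Surjective (map f (LinearMap.id : M →ₗ[R] M)) := by
  intro t
  induction t using induction_on with
  | zero => exact ⟨0, map_zero _⟩
  | tmul y m => obtain ⟨x, rfl⟩ := hf y; exact ⟨tmul R x m, rfl⟩
  | add a b ha hb =>
    obtain ⟨a, rfl⟩ := ha
    obtain ⟨b, rfl⟩ := hb
    exact ⟨a + b, map_add _ _ _⟩

/-- Tensor products are right exact. -/
theorem map_exact {f : X →ₗ[Rᵐᵒᵖ] Y} {g : Y →ₗ[Rᵐᵒᵖ] Z} (h : Function.Exact f g)
    (hg : Function.Surjective g) :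
    Function.Exact (map f (LinearMap.id : M →ₗ[R] M)) (map g (LinearMap.id : M →ₗ[R] M)) := by
  intro t
  constructor
  · intro ht
    let I := (map f (LinearMap.id : M →ₗ[R] M)).range
    -- Modulo the image of f ⊗ M the class of y ⊗ m depends only on g y. Hence choosing preimages
    -- under g gives a balanced map on Z × M, and with it a left inverse on the cokernel.
    have key : ∀ y y' : Y, ∀ m : M, g y = g y' →
        (QuotientAddGroup.mk' I) (tmul R y m) = (QuotientAddGroup.mk' I) (tmul R y' m) := by
      intro y y' m hy
      obtain ⟨x, hx⟩ := (h (y - y')).1 (by rw [map_sub, hy, sub_self])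
      rw [← sub_eq_zero, ← map_sub]
      refine (QuotientAddGroup.eq_zero_iff _).2 ⟨tmul R x m, ?_⟩
      rw [map_tmul, hx]
      exact map_sub ((mk R Y M).flip m) y y'
    let φ : Z →+ M →+ (BalancedTensor R Y M ⧸ I) := AddMonoidHom.mk' (fun z =>
      (QuotientAddGroup.mk' I).comp (mk R Y M (Function.surjInv hg z))) (by
        intro z z'
        ext m
        have := key (Function.surjInv hg (z + z')) (Function.surjInv hg z + Function.surjInv hg z')
          m (by simp [Function.surjInv_eq])
        simpa [add_tmul] using this)
    let ψ : BalancedTensor R Z M →+ (BalancedTensor R Y M ⧸ I) := lift φ (by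
      intro z r m
      have := key (Function.surjInv hg (op r • z)) (op r • Function.surjInv hg z)
          m (by simp [Function.surjInv_eq])
      simpa [smul_tmul, φ] using this)
    have hψ : ψ.comp (map g LinearMap.id) = QuotientAddGroup.mk' I :=
      hom_ext fun y m => key _ _ m (Function.surjInv_eq hg _)
    have h0 : QuotientAddGroup.mk' I t = 0 := by
      rw [← hψ, AddMonoidHom.comp_apply, ht, map_zero]
    exact (QuotientAddGroup.eq_zero_iff _).1 h0
  · rintro ⟨s, rfl⟩
    have : (map g (LinearMap.id : M →ₗ[R] M)).comp (map f LinearMap.id) = 0 :=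
      hom_ext fun x m => by simp [h.apply_apply_eq_zero, zero_tmul]
    exact DFunLike.congr_fun this s

end

section

variable {R S T X Y M M' N G : Type*} [Ring R] [Ring S] [Ring T]
  [AddCommGroup X] [Module Rᵐᵒᵖ X] [AddCommGroup Y] [Module Rᵐᵒᵖ Y]
  [AddCommGroup M] [Module R M] [AddCommGroup M'] [Module R M'] [AddCommGroup G]

instance [Module S X] [SMulCommClass S Rᵐᵒᵖ X] [Module Tᵐᵒᵖ M] [SMulCommClass R Tᵐᵒᵖ M] :
    SMulCommClass S Tᵐᵒᵖ (BalancedTensor R X M) where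
  smul_comm s t x := by
    induction x using induction_on with
    | zero => simp
    | tmul x m => rfl
    | add a b ha hb => simp only [smul_add, ha, hb]

/-- A balanced biadditive map that is linear in the second variable. -/
def liftRight [Module Sᵐᵒᵖ M] [SMulCommClass R Sᵐᵒᵖ M] [Module Sᵐᵒᵖ G] (f : X →+ M →+ G)
    (hf : ∀ (x : X) (r : R) (m : M), f (op r • x) m = f x (r • m))
    (hS : ∀ (x : X) (s : Sᵐᵒᵖ) (m : M), f x (s • m) = s • f x m) :
    BalancedTensor R X M →ₗ[Sᵐᵒᵖ] G where
  toFun := lift f hf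
  map_add' := map_add _
  map_smul' s t := by
    induction t using induction_on with
    | zero => simp
    | tmul x m => exact hS x s m
    | add a b ha hb => simp only [smul_add, ha, hb, map_add, RingHom.id_apply]

@[simp]
theorem liftRight_tmul [Module Sᵐᵒᵖ M] [SMulCommClass R Sᵐᵒᵖ M] [Module Sᵐᵒᵖ G]
    (f : X →+ M →+ G) (hf hS) (x : X) (m : M) :
    liftRight (R := R) (S := S) f hf hS (tmul R x m) = f x m := rfl

/-- A balanced biadditive map that is linear in the first variable. -/
def liftLeft [Module S X] [SMulCommClass S Rᵐᵒᵖ X] [Module S G] (f : X →+ M →+ G)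
    (hf : ∀ (x : X) (r : R) (m : M), f (op r • x) m = f x (r • m))
    (hS : ∀ (s : S) (x : X) (m : M), f (s • x) m = s • f x m) :
    BalancedTensor R X M →ₗ[S] G where
  toFun := lift f hf
  map_add' := map_add _
  map_smul' s t := by
    induction t using induction_on with
    | zero => simp
    | tmul x m => exact hS s x m
    | add a b ha hb => simp only [smul_add, ha, hb, map_add, RingHom.id_apply]

@[simp]
theorem liftLeft_tmul [Module S X] [SMulCommClass S Rᵐᵒᵖ X] [Module S G]
    (f : X →+ M →+ G) (hf hS) (x : X) (m : M) :
    liftLeft (R := R) (S := S) f hf hS (tmul R x m) = f x m := rfl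

@[simp]
theorem mapRight_tmul [Module Sᵐᵒᵖ M] [SMulCommClass R Sᵐᵒᵖ M] (f : X →ₗ[Rᵐᵒᵖ] Y) (x : X) (m : M) :
    mapRight S M f (tmul R x m) = tmul R (f x) m := rfl

theorem mapRight_id [Module Sᵐᵒᵖ M] [SMulCommClass R Sᵐᵒᵖ M] :
    mapRight S M (LinearMap.id : X →ₗ[Rᵐᵒᵖ] X) = LinearMap.id :=
  LinearMap.ext fun t => DFunLike.congr_fun (map_id (R := R) (X := X) (M := M)) t

theorem mapRight_comp [Module Sᵐᵒᵖ M] [SMulCommClass R Sᵐᵒᵖ M] {Z : Type*} [AddCommGroup Z]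
    [Module Rᵐᵒᵖ Z] (g : Y →ₗ[Rᵐᵒᵖ] Z) (f : X →ₗ[Rᵐᵒᵖ] Y) :
    mapRight S M (g ∘ₗ f) = mapRight S M g ∘ₗ mapRight S M f :=
  LinearMap.ext fun t =>
    DFunLike.congr_fun (map_comp f g (LinearMap.id : M →ₗ[R] M) LinearMap.id) t

theorem mapRight_sub [Module Sᵐᵒᵖ M] [SMulCommClass R Sᵐᵒᵖ M] (f g : X →ₗ[Rᵐᵒᵖ] Y) :
    mapRight S M (f - g) = mapRight S M f - mapRight S M g :=
  LinearMap.ext fun t =>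
    DFunLike.congr_fun (hom_ext fun x m => map_sub ((mk R Y M).flip m) (f x) (g x) :
      map (f - g) (LinearMap.id : M →ₗ[R] M) = map f LinearMap.id - map g LinearMap.id) t

/-- Linear maps out of a tensor product agree when they agree on elementary tensors. -/
theorem linearMap_ext {Q : Type*} [Ring Q] [Module Q (BalancedTensor R X M)] [Module Q G]
    {f g : BalancedTensor R X M →ₗ[Q] G} (h : ∀ x m, f (tmul R x m) = g (tmul R x m)) : f = g :=
  LinearMap.ext fun t => DFunLike.congr_fun (hom_ext h : f.toAddMonoidHom = g.toAddMonoidHom) t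

section

variable (X M N : Type*) [AddCommGroup X] [Module Rᵐᵒᵖ X] [AddCommGroup M] [Module R M]
  [Module Sᵐᵒᵖ M] [SMulCommClass R Sᵐᵒᵖ M] [AddCommGroup N] [Module S N]

/-- The biadditive map `(x ⊗ m, n) ↦ x ⊗ (m ⊗ n)`. -/
def assocInvAux : BalancedTensor R X M →+ N →+ BalancedTensor R X (BalancedTensor S M N) :=
  lift (AddMonoidHom.mk' (fun x => AddMonoidHom.mk' (fun m =>
      (mk R X (BalancedTensor S M N) x).comp (mk S M N m))
      fun m m' => AddMonoidHom.ext fun n =>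
        (congrArg (tmul R x) (add_tmul m m' n)).trans (tmul_add _ _ _))
      fun x y => AddMonoidHom.ext fun m => AddMonoidHom.ext fun n => add_tmul x y (tmul S m n))
    fun x r m => AddMonoidHom.ext fun n => smul_tmul r x (tmul S m n)

@[simp]
theorem assocInvAux_tmul (x : X) (m : M) (n : N) :
    assocInvAux (R := R) X M N (tmul R x m) n = tmul R x (tmul S m n) := rfl

variable [Module Tᵐᵒᵖ N] [SMulCommClass S Tᵐᵒᵖ N]

/-- `(X ⊗_R M) ⊗_S N → X ⊗_R (M ⊗_S N)`. -/
def assocInv : BalancedTensor S (BalancedTensor R X M) N →ₗ[Tᵐᵒᵖ]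
    BalancedTensor R X (BalancedTensor S M N) :=
  liftRight (assocInvAux X M N)
    (fun t s n => by
      induction t using induction_on with
      | zero => simp
      | tmul x m =>
        rw [right_smul_tmul, assocInvAux_tmul, assocInvAux_tmul, smul_tmul]
      | add a b ha hb => simp only [map_add, smul_add, AddMonoidHom.add_apply, ha, hb])
    (fun t s n => by
      induction t using induction_on with
      | zero => simp
      | tmul x m =>
        rw [assocInvAux_tmul, assocInvAux_tmul, right_smul_tmul, right_smul_tmul]
      | add a b ha hb => simp only [map_add, smul_add, AddMonoidHom.add_apply, ha, hb])

end

end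

end BalancedTensor

/-! ## Dual bases -/

instance projective_pi (R M ι : Type*) [Ring R] [AddCommGroup M] [Module R M] [Fintype ι]
    [Module.Projective R M] : Module.Projective R (ι → M) := by
  classical
  exact Module.Projective.of_equiv (DirectSum.linearEquivFunOnFintype R ι fun _ => M)

theorem exists_dual_basis (R M : Type*) [Ring R] [AddCommGroup M] [Module R M] [Module.Finite R M]
    [Module.Projective R M] :
    ∃ (n : ℕ) (m : Fin n → M) (φ : Fin n → M →ₗ[R] R), ∀ v, ∑ j, φ j v • m j = v := by
  obtain ⟨n, f, g, -, -, h⟩ := Module.Finite.exists_comp_eq_id_of_projective R M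
  refine ⟨n, fun j => f (Pi.single j 1), fun j => LinearMap.proj j ∘ₗ g, fun v => ?_⟩
  conv_rhs => rw [← LinearMap.id_apply (R := R) v, ← h, LinearMap.comp_apply,
    LinearMap.pi_apply_eq_sum_univ f (g v)]
  refine Finset.sum_congr rfl fun j _ => ?_
  change _ • f _ = _ • f _
  congr 2
  ext i
  simp [Pi.single_apply, eq_comm]

/-- Right linear maps to `Rᵐᵒᵖ` are right linear maps to `R`. -/
def opUnopLinearEquiv (R : Type*) [Ring R] : Rᵐᵒᵖ ≃ₗ[Rᵐᵒᵖ] R :=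
  (opLinearEquiv Rᵐᵒᵖ (M := R)).symm.trans (LinearEquiv.refl _ _)

theorem exists_right_dual_basis (R X : Type*) [Ring R] [AddCommGroup X] [Module Rᵐᵒᵖ X]
    [Module.Finite Rᵐᵒᵖ X] [Module.Projective Rᵐᵒᵖ X] :
    ∃ (n : ℕ) (x : Fin n → X) (ξ : Fin n → X →ₗ[Rᵐᵒᵖ] R), ∀ v, ∑ j, op (ξ j v) • x j = v := by
  obtain ⟨n, x, ξ, h⟩ := exists_dual_basis Rᵐᵒᵖ X
  exact ⟨n, x, fun j => (opUnopLinearEquiv R).toLinearMap ∘ₗ ξ j, h⟩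

/-! ### Projectivity and finiteness of tensor products -/

namespace BalancedTensor

variable {R S X M : Type*} [Ring R] [Ring S] [AddCommGroup X] [Module Rᵐᵒᵖ X]
  [AddCommGroup M] [Module R M]

/-- A dual basis of X gives v ⊗ m = ∑ xⱼ ⊗ ξⱼ(v) m, which exhibits X ⊗_R M as a direct summand of
Mⁿ. -/
theorem projective_right [Module Sᵐᵒᵖ M] [SMulCommClass R Sᵐᵒᵖ M] [Module.Finite Rᵐᵒᵖ X]
    [Module.Projective Rᵐᵒᵖ X] [Module.Projective Sᵐᵒᵖ M] :
    Module.Projective Sᵐᵒᵖ (BalancedTensor R X M) := by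
  obtain ⟨n, x, ξ, h⟩ := exists_right_dual_basis R X
  let i : BalancedTensor R X M →ₗ[Sᵐᵒᵖ] (Fin n → M) :=
    liftRight (AddMonoidHom.mk' (fun v => AddMonoidHom.mk' (fun m j => ξ j v • m)
        fun m m' => by ext; simp) fun v w => by ext; simp [add_smul])
      (fun v r m => by ext; simp [mul_smul]) (fun v s m => by ext; simp [smul_comm])
  let p : (Fin n → M) →ₗ[Sᵐᵒᵖ] BalancedTensor R X M :=
    ∑ j, { toFun := fun m => tmul R (x j) (m j)
           map_add' := fun m m' => tmul_add _ _ _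
           map_smul' := fun s m => rfl }
  refine Module.Projective.of_split i p (linearMap_ext fun v m => ?_)
  simp only [p, i, LinearMap.comp_apply, liftRight_tmul, LinearMap.sum_apply, LinearMap.id_apply]
  conv_rhs => rw [← h v, sum_tmul]
  exact Finset.sum_congr rfl fun j _ => (smul_tmul _ _ _).symm

theorem projective_left [Module S X] [SMulCommClass S Rᵐᵒᵖ X] [Module.Finite R M]
    [Module.Projective R M] [Module.Projective S X] :
    Module.Projective S (BalancedTensor R X M) := by
  obtain ⟨n, m, φ, h⟩ := exists_dual_basis R M
  let i : BalancedTensor R X M →ₗ[S] (Fin n → X) :=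
    liftLeft (AddMonoidHom.mk' (fun x => AddMonoidHom.mk' (fun v j => op (φ j v) • x)
        fun m m' => by ext; simp [add_smul]) fun v w => by ext; simp)
      (fun v r m => by ext; simp [mul_smul]) (fun v s m => by ext; simp [smul_comm])
  let p : (Fin n → X) →ₗ[S] BalancedTensor R X M :=
    ∑ j, { toFun := fun x => tmul R (x j) (m j)
           map_add' := fun m m' => add_tmul _ _ _
           map_smul' := fun s m => rfl }
  refine Module.Projective.of_split i p (linearMap_ext fun x v => ?_)
  simp only [p, i, LinearMap.comp_apply, liftLeft_tmul, LinearMap.sum_apply, LinearMap.id_apply]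
  conv_rhs => rw [← h v, tmul_sum]
  exact Finset.sum_congr rfl fun j _ => smul_tmul _ _ _

theorem finite_right [Module Sᵐᵒᵖ M] [SMulCommClass R Sᵐᵒᵖ M] [Module.Finite Rᵐᵒᵖ X]
    [Module.Finite Sᵐᵒᵖ M] : Module.Finite Sᵐᵒᵖ (BalancedTensor R X M) := by
  obtain ⟨n, x, hx⟩ := Module.Finite.exists_fin (R := Rᵐᵒᵖ) (M := X)
  let p : (Fin n → M) →ₗ[Sᵐᵒᵖ] BalancedTensor R X M :=
    ∑ j, { toFun := fun m => tmul R (x j) (m j)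
           map_add' := fun m m' => tmul_add _ _ _
           map_smul' := fun s m => rfl }
  refine Module.Finite.of_surjective p fun t => ?_
  induction t using induction_on with
  | zero => exact ⟨0, map_zero _⟩
  | tmul v m =>
    have hv : v ∈ Submodule.span Rᵐᵒᵖ (Set.range x) := hx ▸ Submodule.mem_top
    obtain ⟨c, rfl⟩ := (Submodule.mem_span_range_iff_exists_fun _).1 hv
    refine ⟨fun j => (c j).unop • m, ?_⟩
    simp only [p, LinearMap.sum_apply, sum_tmul]
    exact Finset.sum_congr rfl fun j _ => (smul_tmul (c j).unop _ _).symm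
  | add a b ha hb =>
    obtain ⟨a, rfl⟩ := ha
    obtain ⟨b, rfl⟩ := hb
    exact ⟨a + b, map_add _ _ _⟩

end BalancedTensor

/-! ## Maps factoring through finitely generated free modules -/

/-- The map `f` factors through a finitely generated free module. -/
def FactorsThroughFree {S X Y : Type*} [Ring S] [AddCommGroup X] [Module S X] [AddCommGroup Y]
    [Module S Y] (f : X →ₗ[S] Y) : Prop :=
  ∃ (n : ℕ) (i : X →ₗ[S] (Fin n → S)) (p : (Fin n → S) →ₗ[S] Y), p ∘ₗ i = f

namespace FactorsThroughFree

variable {S X Y Z Q : Type*} [Ring S] [AddCommGroup X] [Module S X] [AddCommGroup Y] [Module S Y]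
  [AddCommGroup Z] [Module S Z] [AddCommGroup Q] [Module S Q]

theorem comp_left {f : X →ₗ[S] Y} (hf : FactorsThroughFree f) (g : Y →ₗ[S] Z) :
    FactorsThroughFree (g ∘ₗ f) := by
  obtain ⟨n, i, p, rfl⟩ := hf
  exact ⟨n, i, g ∘ₗ p, rfl⟩

theorem comp_right {g : Y →ₗ[S] Z} (hg : FactorsThroughFree g) (f : X →ₗ[S] Y) :
    FactorsThroughFree (g ∘ₗ f) := by
  obtain ⟨n, i, p, rfl⟩ := hg
  exact ⟨n, i ∘ₗ f, p, rfl⟩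

theorem of_projective_of_finite [Module.Projective S Q] [Module.Finite S Q] (i : X →ₗ[S] Q)
    (p : Q →ₗ[S] Y) : FactorsThroughFree (p ∘ₗ i) := by
  obtain ⟨n, f, g, -, -, h⟩ := Module.Finite.exists_comp_eq_id_of_projective S Q
  refine ⟨n, g ∘ₗ i, p ∘ₗ f, ?_⟩
  rw [LinearMap.comp_assoc, ← LinearMap.comp_assoc i g f, h, LinearMap.id_comp]

/-- Here Q need not be finitely generated: p lifts along a finite free cover of Y instead. -/
theorem of_projective [Module.Projective S Q] [Module.Finite S Y] (i : X →ₗ[S] Q)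
    (p : Q →ₗ[S] Y) : FactorsThroughFree (p ∘ₗ i) := by
  obtain ⟨n, f, hf⟩ := Module.Finite.exists_fin' S Y
  obtain ⟨g, rfl⟩ := Module.projective_lifting_property f p hf
  exact ⟨n, g ∘ₗ i, f, rfl⟩

theorem add {f g : X →ₗ[S] Y} (hf : FactorsThroughFree f) (hg : FactorsThroughFree g) :
    FactorsThroughFree (f + g) := by
  obtain ⟨n, i, p, rfl⟩ := hf
  obtain ⟨m, j, q, rfl⟩ := hg
  have := of_projective_of_finite (i.prod j) (p.coprod q)
  rwa [LinearMap.coprod_comp_prod] at this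

theorem neg {f : X →ₗ[S] Y} (hf : FactorsThroughFree f) : FactorsThroughFree (-f) := by
  obtain ⟨n, i, p, rfl⟩ := hf
  exact ⟨n, i, -p, LinearMap.neg_comp _ _⟩

theorem sub {f g : X →ₗ[S] Y} (hf : FactorsThroughFree f) (hg : FactorsThroughFree g) :
    FactorsThroughFree (f - g) := sub_eq_add_neg f g ▸ hf.add hg.neg

theorem projective (h : FactorsThroughFree (LinearMap.id : X →ₗ[S] X)) :
    Module.Projective S X := by
  obtain ⟨n, i, p, h⟩ := h
  exact Module.Projective.of_split i p h

theorem id_of_projective [Module.Projective S X] [Module.Finite S X] :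
    FactorsThroughFree (LinearMap.id : X →ₗ[S] X) :=
  of_projective (LinearMap.id : X →ₗ[S] X) LinearMap.id

end FactorsThroughFree

/-- A map killing the kernel of a surjection factors through it. -/
theorem LinearMap.exists_desc {S X Y Z W : Type*} [Ring S] [AddCommGroup X] [Module S X]
    [AddCommGroup Y] [Module S Y] [AddCommGroup Z] [Module S Z] [AddCommGroup W] [Module S W]
    {f : X →ₗ[S] Y} {p : Y →ₗ[S] Z} (h : Function.Exact f p) (hp : Function.Surjective p)
    (g : Y →ₗ[S] W) (hg : g ∘ₗ f = 0) : ∃ g' : Z →ₗ[S] W, g' ∘ₗ p = g := by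
  refine ⟨(LinearMap.ker p).liftQ g ?_ ∘ₗ (p.quotKerEquivOfSurjective hp).symm.toLinearMap, ?_⟩
  · intro y hy
    obtain ⟨x, rfl⟩ := (h y).1 hy
    exact LinearMap.congr_fun hg x
  · ext y
    have : (p.quotKerEquivOfSurjective hp).symm (p y) = (LinearMap.ker p).mkQ y := by
      rw [LinearEquiv.symm_apply_eq]; rfl
    simp [this]

/-! ## Complexes in Kato's category -/

section Kato

variable {R : Type u} [Ring R]

/-- A complex defines an object of Kato's category. -/
def IsKato (R : Type u) [Ring R] (F : CochainComplex (ModuleCat.{u} Rᵐᵒᵖ) ℤ) : Prop :=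
  katoProperty R ((HomotopyCategory.quotient _ _).obj F)

namespace IsKato

variable {F G : CochainComplex (ModuleCat.{u} Rᵐᵒᵖ) ℤ}

theorem finite (h : IsKato R F) (i : ℤ) : Module.Finite Rᵐᵒᵖ (F.X i) := (h.1 i).1

theorem projective (h : IsKato R F) (i : ℤ) : Module.Projective Rᵐᵒᵖ (F.X i) := (h.1 i).2

theorem exact (h : IsKato R F) {i j k : ℤ} (hj : j < 0) (hij : i + 1 = j) (hjk : j + 1 = k) :
    Function.Exact (F.d i j).hom (F.d j k).hom := by
  have := h.2.1 j hj
  rw [HomologicalComplex.exactAt_iff' _ i j k (by subst hij; simp) (by subst hjk; simp)] at this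
  exact (ShortComplex.ShortExact.moduleCat_exact_iff_function_exact _).1 this

theorem dual_exact (h : IsKato R F) {i j k : ℤ} (hj : 0 ≤ j) (hij : i + 1 = j) (hjk : j + 1 = k) :
    Function.Exact (dualDifferential R F j k) (dualDifferential R F i j) := by
  have := h.2.2 j hj
  obtain rfl : i = j - 1 := by lia
  subst hjk
  exact this

/-- Maps from a projective module into a cycle module of negative degree lift. -/
theorem exists_lift (h : IsKato R G) {i j k : ℤ} (hj : j < 0) (hij : i + 1 = j) (hjk : j + 1 = k)
    {P : ModuleCat.{u} Rᵐᵒᵖ} [Module.Projective Rᵐᵒᵖ P] (u : P ⟶ G.X j) (hu : u ≫ G.d j k = 0) :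
    ∃ v : P ⟶ G.X i, v ≫ G.d i j = u := by
  have hex := h.exact hj hij hjk
  let f : G.X i →ₗ[Rᵐᵒᵖ] LinearMap.ker (G.d j k).hom :=
    (G.d i j).hom.codRestrict _ fun x => hex.apply_apply_eq_zero x
  have hf : Function.Surjective f := fun y => by
    obtain ⟨x, hx⟩ := (hex y.1).1 y.2
    exact ⟨x, Subtype.ext hx⟩
  let u' : P →ₗ[Rᵐᵒᵖ] LinearMap.ker (G.d j k).hom :=
    u.hom.codRestrict _ fun x => LinearMap.congr_fun (congrArg ModuleCat.Hom.hom hu) x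
  obtain ⟨v, hv⟩ := Module.projective_lifting_property f u' hf
  refine ⟨ModuleCat.ofHom v, ?_⟩
  ext x
  exact congrArg Subtype.val (LinearMap.congr_fun hv x)

/-- Maps to finitely generated projective modules extend along the differentials of nonnegative
degree. -/
theorem exists_extend (h : IsKato R F) {i j k : ℤ} (hj : 0 ≤ j) (hij : i + 1 = j)
    (hjk : j + 1 = k) {P : ModuleCat.{u} Rᵐᵒᵖ} [Module.Projective Rᵐᵒᵖ P] [Module.Finite Rᵐᵒᵖ P]
    (u : F.X j ⟶ P) (hu : F.d i j ≫ u = 0) : ∃ v : F.X k ⟶ P, F.d j k ≫ v = u := by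
  -- A dual basis of P reduces the extension problem to linear forms, where it is exactness of the
  -- dual complex.
  obtain ⟨n, x, ξ, hx⟩ := exists_right_dual_basis R P
  have key : ∀ l, ∃ v : F.X k →ₗ[Rᵐᵒᵖ] R, v ∘ₗ (F.d j k).hom = ξ l ∘ₗ u.hom := fun l =>
    (h.dual_exact hj hij hjk (ξ l ∘ₗ u.hom)).1 (LinearMap.ext fun y => by
      have := congrArg (fun φ => ξ l (φ.hom y)) hu
      simpa [dualDifferential] using this)
  choose v hv using key
  refine ⟨ModuleCat.ofHom (∑ l, { toFun := fun y => op (v l y) • x l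
                                  map_add' := fun y z => by simp [add_smul]
                                  map_smul' := fun r y => by simp [mul_smul] }), ?_⟩
  ext y
  have : ∀ l, v l ((F.d j k).hom y) = ξ l (u.hom y) := fun l => LinearMap.congr_fun (hv l) y
  simp [this, hx]

end IsKato

/-- Two-sided recursion over the integers. -/
theorem exists_int_sequence {S : Type*} (P : ℤ → S → Prop) (Rel : ℤ → S → S → Prop)
    (a b : S) (ha : P (-1) a) (hb : P 0 b) (hab : Rel (-1) a b)
    (up : ∀ i, 0 ≤ i → ∀ s, P i s → ∃ s', P (i + 1) s' ∧ Rel i s s')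
    (down : ∀ i, i + 1 < 0 → ∀ s, P (i + 1) s → ∃ s', P i s' ∧ Rel i s' s) :
    ∃ s : ℤ → S, s (-1) = a ∧ s 0 = b ∧ ∀ i, Rel i (s i) (s (i + 1)) := by
  choose f hf hf' using fun n : ℕ => up n (by lia)
  choose g hg hg' using fun n : ℕ => down (Int.negSucc (n + 1)) (by lia)
  let U : ∀ n : ℕ, {s : S // P n s} := fun n =>
    Nat.rec ⟨b, hb⟩ (fun n s => ⟨f n s.1 s.2, hf n s.1 s.2⟩) n
  let V : ∀ n : ℕ, {s : S // P (Int.negSucc n) s} := fun n =>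
    Nat.rec ⟨a, ha⟩ (fun n s => ⟨g n s.1 s.2, hg n s.1 s.2⟩) n
  refine ⟨fun i => match i with
    | Int.ofNat n => (U n).1
    | Int.negSucc n => (V n).1, rfl, rfl, fun i => ?_⟩
  match i with
  | Int.ofNat n => exact hf' n (U n).1 (U n).2
  | Int.negSucc 0 => exact hab
  | Int.negSucc (n + 1) => exact hg' n (V n).1 (V n).2

/-! ### Chain maps and homotopies governed by the cokernel in degree zero -/

section Lifting

variable {F G : CochainComplex (ModuleCat.{u} Rᵐᵒᵖ) ℤ} {X Y : Type u} [AddCommGroup X]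
  [Module Rᵐᵒᵖ X] [AddCommGroup Y] [Module Rᵐᵒᵖ Y]
  {p : F.X 0 →ₗ[Rᵐᵒᵖ] X} {q : G.X 0 →ₗ[Rᵐᵒᵖ] Y}

/-- Every map between the cokernels in degree zero is induced by a chain map. -/
theorem exists_chainMap (hF : IsKato R F) (hG : IsKato R G)
    (hp : Function.Exact (F.d (-1) 0).hom p)
    (hq : Function.Exact (G.d (-1) 0).hom q) (hq' : Function.Surjective q) (φ : X →ₗ[Rᵐᵒᵖ] Y) :
    ∃ f : F ⟶ G, q ∘ₗ (f.f 0).hom = φ ∘ₗ p := by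
  have hFp := hF.projective
  have hGp := hG.projective
  have hGf := hG.finite
  obtain ⟨f0, hf0⟩ := Module.projective_lifting_property q (φ ∘ₗ p) hq'
  obtain ⟨f1, hf1⟩ : ∃ f1 : F.X (-1) ⟶ G.X (-1),
      f1 ≫ G.d (-1) 0 = F.d (-1) 0 ≫ ModuleCat.ofHom f0 := by
    let g : G.X (-1) →ₗ[Rᵐᵒᵖ] LinearMap.ker q :=
      (G.d (-1) 0).hom.codRestrict _ fun x => hq.apply_apply_eq_zero x
    have hg : Function.Surjective g := fun y => by
      obtain ⟨x, hx⟩ := (hq y.1).1 y.2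
      exact ⟨x, Subtype.ext hx⟩
    let w : F.X (-1) →ₗ[Rᵐᵒᵖ] LinearMap.ker q :=
      (f0 ∘ₗ (F.d (-1) 0).hom).codRestrict _ fun x => by
        have := LinearMap.congr_fun hf0 ((F.d (-1) 0).hom x)
        simp only [LinearMap.comp_apply] at this
        simp [this, hp.apply_apply_eq_zero]
    obtain ⟨v, hv⟩ := Module.projective_lifting_property g w hg
    refine ⟨ModuleCat.ofHom v, ?_⟩
    ext x
    exact congrArg Subtype.val (LinearMap.congr_fun hv x)
  -- A state of the recursion is a whole family of maps of which only the component in the current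
  -- degree matters; this keeps the type of states independent of the degree.
  have hs : ∀ (i : ℤ) (v : F.X i ⟶ G.X i), ∃ s : ∀ a, F.X a ⟶ G.X a, s i = v := fun i v =>
    ⟨Function.update 0 i v, Function.update_self ..⟩
  obtain ⟨a, ha⟩ := hs _ f1
  obtain ⟨b, hb⟩ := hs _ (ModuleCat.ofHom f0)
  -- The invariant d ≫ sᵢ ≫ d = 0 serves both directions: upwards it lets sᵢ ≫ d extend along the
  -- next differential of F, downwards it makes d ≫ sᵢ land in cycles of G, so that it lifts.
  obtain ⟨s, -, hs0, hsR⟩ := exists_int_sequence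
    (fun i (s : ∀ a, F.X a ⟶ G.X a) => F.d (i - 1) i ≫ s i ≫ G.d i (i + 1) = 0)
    (fun i s s' => s i ≫ G.d i (i + 1) = F.d i (i + 1) ≫ s' (i + 1)) a b
    (by
      change F.d (-1 - 1) (-1) ≫ a (-1) ≫ G.d (-1) 0 = 0
      rw [ha, hf1, F.d_comp_d_assoc, Limits.zero_comp])
    (by
      change F.d (-1) 0 ≫ b 0 ≫ G.d 0 1 = 0
      rw [hb, ← Category.assoc, ← hf1, Category.assoc, G.d_comp_d, Limits.comp_zero])
    (by
      change a (-1) ≫ G.d (-1) 0 = F.d (-1) 0 ≫ b 0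
      rw [ha, hb, hf1])
    (fun i hi s h => by
      obtain ⟨v, hv⟩ := hF.exists_extend hi (sub_add_cancel i 1) rfl (s i ≫ G.d i (i + 1)) h
      obtain ⟨s', hs'⟩ := hs _ v
      refine ⟨s', ?_, by rw [hs', hv]⟩
      rw [hs', show i + 1 - 1 = i by lia, ← Category.assoc, hv, Category.assoc, G.d_comp_d,
        Limits.comp_zero])
    (fun i hi s h => by
      rw [show i + 1 - 1 = i by lia] at h
      obtain ⟨v, hv⟩ := hG.exists_lift hi rfl rfl (F.d i (i + 1) ≫ s (i + 1)) (by simpa using h)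
      obtain ⟨s', hs'⟩ := hs _ v
      refine ⟨s', ?_, by rw [hs', hv]⟩
      rw [hs', hv, F.d_comp_d_assoc, Limits.zero_comp])
  refine ⟨{ f := fun i => s i i, comm' := fun i j hij => ?_ }, ?_⟩
  · obtain rfl : i + 1 = j := hij
    exact hsR i
  · change q ∘ₗ (s 0 0).hom = φ ∘ₗ p
    rw [hs0, hb]
    exact hf0

/-- A chain map inducing on cokernels a map that factors through a free module is
null-homotopic. -/
theorem exists_nullHomotopy (hF : IsKato R F) (hG : IsKato R G)
    (hp : Function.Exact (F.d (-1) 0).hom p)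
    (hq : Function.Exact (G.d (-1) 0).hom q) (hq' : Function.Surjective q) (φ : X →ₗ[Rᵐᵒᵖ] Y)
    (hφ : FactorsThroughFree φ) (f : F ⟶ G) (hf : q ∘ₗ (f.f 0).hom = φ ∘ₗ p) :
    Nonempty (Homotopy f 0) := by
  have hFp := hF.projective
  have hGp := hG.projective
  have hGf := hG.finite
  obtain ⟨n, α, β, rfl⟩ := hφ
  -- Lifting β to G⁰ turns φ into a map F⁰ → G⁰ that vanishes on boundaries, hence extends to F¹.
  -- That extension is the homotopy component h1; what is left of f⁰ has image in ker q and supplies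
  -- h0.
  obtain ⟨β', rfl⟩ := Module.projective_lifting_property q β hq'
  obtain ⟨h1, hh1⟩ : ∃ h1 : F.X 1 ⟶ G.X 0, F.d 0 1 ≫ h1 = ModuleCat.ofHom (β' ∘ₗ α ∘ₗ p) :=
    hF.exists_extend (i := -1) le_rfl rfl rfl _ (by
      ext x
      simp [hp.apply_apply_eq_zero])
  obtain ⟨h0, hh0⟩ : ∃ h0 : F.X 0 ⟶ G.X (-1), h0 ≫ G.d (-1) 0 = f.f 0 - F.d 0 1 ≫ h1 := by
    let g : G.X (-1) →ₗ[Rᵐᵒᵖ] LinearMap.ker q :=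
      (G.d (-1) 0).hom.codRestrict _ fun x => hq.apply_apply_eq_zero x
    have hg : Function.Surjective g := fun y => by
      obtain ⟨x, hx⟩ := (hq y.1).1 y.2
      exact ⟨x, Subtype.ext hx⟩
    let w : F.X 0 →ₗ[Rᵐᵒᵖ] LinearMap.ker q :=
      (f.f 0 - F.d 0 1 ≫ h1).hom.codRestrict _ fun x => by
        have := LinearMap.congr_fun hf x
        simp only [LinearMap.comp_apply] at this
        rw [hh1]
        simp [this]
    obtain ⟨v, hv⟩ := Module.projective_lifting_property g w hg
    refine ⟨ModuleCat.ofHom v, ?_⟩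
    ext x
    exact congrArg Subtype.val (LinearMap.congr_fun hv x)
  have hs : ∀ (i j : ℤ) (v : F.X i ⟶ G.X j), ∃ s : ∀ a b, F.X a ⟶ G.X b, s i j = v :=
    fun i j v => ⟨Function.update 0 i (Function.update 0 j v), by simp⟩
  obtain ⟨a, ha⟩ := hs 0 (-1) h0
  obtain ⟨b, hb⟩ := hs 1 0 h1
  -- Index i carries the homotopy component Fⁱ⁺¹ → Gⁱ, so the seeds h0 and h1 occupy the indices −1
  -- and 0.
  obtain ⟨s, -, -, hsR⟩ := exists_int_sequence
    (fun i (s : ∀ a b, F.X a ⟶ G.X b) =>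
      F.d i (i + 1) ≫ (f.f (i + 1) - s (i + 1) i ≫ G.d i (i + 1)) = 0)
    (fun i s s' => f.f (i + 1) - s (i + 1) i ≫ G.d i (i + 1) =
      F.d (i + 1) (i + 1 + 1) ≫ s' (i + 1 + 1) (i + 1)) a b
    (by
      change F.d (-1) 0 ≫ (f.f 0 - a 0 (-1) ≫ G.d (-1) 0) = 0
      rw [ha, hh0, sub_sub_cancel, F.d_comp_d_assoc, Limits.zero_comp])
    (by
      change F.d 0 1 ≫ (f.f 1 - b 1 0 ≫ G.d 0 1) = 0
      rw [hb, Preadditive.comp_sub, ← f.comm, ← Category.assoc, ← Preadditive.sub_comp, ← hh0,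
        Category.assoc, G.d_comp_d, Limits.comp_zero])
    (by
      change f.f 0 - a 0 (-1) ≫ G.d (-1) 0 = F.d 0 1 ≫ b 1 0
      rw [ha, hb, hh0, sub_sub_cancel])
    (fun i hi s h => by
      obtain ⟨v, hv⟩ := hF.exists_extend (by lia) rfl rfl _ h
      obtain ⟨s', hs'⟩ := hs _ _ v
      refine ⟨s', ?_, by rw [hs', hv]⟩
      rw [hs', Preadditive.comp_sub, ← f.comm, ← Category.assoc, ← Preadditive.sub_comp, hv,
        sub_sub_cancel, Category.assoc, G.d_comp_d, Limits.comp_zero])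
    (fun i hi s h => by
      obtain ⟨v, hv⟩ := hG.exists_lift hi rfl rfl
        (f.f (i + 1) - F.d (i + 1) (i + 1 + 1) ≫ s (i + 1 + 1) (i + 1)) (by
          rw [Preadditive.sub_comp, f.comm, Category.assoc, ← Preadditive.comp_sub]
          exact h)
      obtain ⟨s', hs'⟩ := hs _ _ v
      refine ⟨s', ?_, by rw [hs', hv, sub_sub_cancel]⟩
      rw [hs', hv, sub_sub_cancel, F.d_comp_d_assoc, Limits.zero_comp])
  refine ⟨{ hom := fun i j => if j + 1 = i then s j i j else 0
            zero := fun i j hij => if_neg hij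
            comm := fun i => ?_ }⟩
  obtain ⟨i, rfl⟩ : ∃ j, i = j + 1 := ⟨i - 1, by lia⟩
  rw [dNext_eq _ (show (ComplexShape.up ℤ).Rel (i + 1) (i + 1 + 1) from rfl),
    prevD_eq _ (show (ComplexShape.up ℤ).Rel i (i + 1) from rfl)]
  have := hsR i
  rw [sub_eq_iff_eq_add] at this
  simpa using this

/-- Homotopic chain maps induce the same map on cokernels up to maps factoring through free
modules. -/
theorem Homotopy.factorsThroughFree (hF : IsKato R F)
    (hp : Function.Exact (F.d (-1) 0).hom p) (hp' : Function.Surjective p)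
    (hq : Function.Exact (G.d (-1) 0).hom q) {f g : F ⟶ G} (h : Homotopy f g)
    {φ ψ : X →ₗ[Rᵐᵒᵖ] Y} (hf : q ∘ₗ (f.f 0).hom = φ ∘ₗ p) (hg : q ∘ₗ (g.f 0).hom = ψ ∘ₗ p) :
    FactorsThroughFree (φ - ψ) := by
  have hFp := hF.projective
  have hFf := hF.finite
  -- Of the two terms of f⁰ − g⁰, the one ending in the differential of G dies under q, and the
  -- other passes through the finitely generated projective module F¹. The map δ is induced by d⁰ on
  -- the cokernel.
  obtain ⟨δ, hδ⟩ := LinearMap.exists_desc hp hp' (F.d 0 1).hom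
    (congrArg ModuleCat.Hom.hom (F.d_comp_d (-1) 0 1))
  have := FactorsThroughFree.of_projective_of_finite δ (q ∘ₗ (h.hom 1 0).hom)
  convert this
  rw [← LinearMap.cancel_right hp', LinearMap.sub_comp, ← hf, ← hg, LinearMap.comp_assoc, hδ]
  ext x
  have hc := congrArg (fun φ => q (φ.hom x)) (h.comm 0)
  rw [dNext_eq _ (show (ComplexShape.up ℤ).Rel 0 1 from rfl),
    prevD_eq _ (show (ComplexShape.up ℤ).Rel (-1) 0 from rfl)] at hc
  simp only [ModuleCat.hom_add, ModuleCat.hom_comp, LinearMap.add_apply, map_add,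
    LinearMap.comp_apply, hq.apply_apply_eq_zero, add_zero] at hc
  simp [hc]

end Lifting

end Kato

/-! ## Existence of complexes in Kato's category -/

instance finite_op_self (R : Type*) [Ring R] : Module.Finite Rᵐᵒᵖ R :=
  Module.Finite.equiv (opUnopLinearEquiv R)

instance projective_op_self (R : Type*) [Ring R] : Module.Projective Rᵐᵒᵖ R :=
  Module.Projective.of_equiv (opUnopLinearEquiv R)

section

variable {R : Type u} [Ring R]

/-- The linear forms killing the image of f are a left submodule of the dual of Rᵇ, which embeds in
Rᵇ. By noetherianity finitely many of them generate it, and these are the coordinates of g. -/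
theorem exists_extension_of_noetherian [IsNoetherianRing R] {a b : ℕ}
    (f : (Fin a → R) →ₗ[Rᵐᵒᵖ] (Fin b → R)) :
    ∃ (c : ℕ) (g : (Fin b → R) →ₗ[Rᵐᵒᵖ] (Fin c → R)), g ∘ₗ f = 0 ∧
      ∀ u : (Fin b → R) →ₗ[Rᵐᵒᵖ] R, u ∘ₗ f = 0 → ∃ v : (Fin c → R) →ₗ[Rᵐᵒᵖ] R, v ∘ₗ g = u := by
  let ev : ((Fin b → R) →ₗ[Rᵐᵒᵖ] R) →ₗ[R] (Fin b → R) :=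
    { toFun := fun u j => u (Pi.single j 1)
      map_add' := fun u v => rfl
      map_smul' := fun r u => rfl }
  have hev : Function.Injective ev := fun u v h => by
    refine LinearMap.pi_ext' fun j => LinearMap.ext fun r => ?_
    have h1 : (Pi.single j r : Fin b → R) = op r • Pi.single j 1 := by
      rw [← Pi.single_smul, op_smul_eq_mul, one_mul]
    have h2 : u (Pi.single j 1) = v (Pi.single j 1) := congrFun h j
    simp [h1, h2]
  have : IsNoetherian R ((Fin b → R) →ₗ[Rᵐᵒᵖ] R) := isNoetherian_of_injective ev hev
  let I : Submodule R ((Fin b → R) →ₗ[Rᵐᵒᵖ] R) :=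
    { carrier := {u | u ∘ₗ f = 0}
      add_mem' := fun {u v} hu hv => by
        simp only [Set.mem_ofPred_eq] at *
        rw [LinearMap.add_comp, hu, hv, add_zero]
      zero_mem' := LinearMap.zero_comp f
      smul_mem' := fun r u hu => by
        simp only [Set.mem_ofPred_eq] at *
        rw [LinearMap.smul_comp, hu, smul_zero] }
  obtain ⟨c, w, hw⟩ := Submodule.fg_iff_exists_fin_generating_family.1
    (IsNoetherian.noetherian I)
  have hwI : ∀ j, w j ∘ₗ f = 0 := fun j => by
    have : w j ∈ I := hw ▸ Submodule.subset_span ⟨j, rfl⟩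
    exact this
  refine ⟨c, LinearMap.pi w, ?_, fun u hu => ?_⟩
  · ext x j
    exact LinearMap.congr_fun (hwI j) _
  · have hu' : u ∈ Submodule.span R (Set.range w) := hw ▸ hu
    obtain ⟨r, rfl⟩ := (Submodule.mem_span_range_iff_exists_fun _).1 hu'
    refine ⟨∑ j, r j • LinearMap.proj j, ?_⟩
    ext x
    simp

theorem exists_cover_of_noetherian [IsNoetherianRing Rᵐᵒᵖ] {a b : ℕ}
    (f : (Fin a → R) →ₗ[Rᵐᵒᵖ] (Fin b → R)) :
    ∃ (c : ℕ) (g : (Fin c → R) →ₗ[Rᵐᵒᵖ] (Fin a → R)), Function.Exact g f := by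
  have : IsNoetherian Rᵐᵒᵖ R := isNoetherian_of_linearEquiv (opUnopLinearEquiv R)
  obtain ⟨c, w, hw⟩ := Submodule.fg_iff_exists_fin_generating_family.1
    (IsNoetherian.noetherian (LinearMap.ker f))
  refine ⟨c, ∑ j, LinearMap.toSpanSingleton Rᵐᵒᵖ _ (w j) ∘ₗ
    (opUnopLinearEquiv R).symm.toLinearMap ∘ₗ LinearMap.proj j, fun x => ?_⟩
  rw [← LinearMap.mem_ker, ← hw, Submodule.mem_span_range_iff_exists_fun]
  constructor
  · rintro ⟨r, rfl⟩
    exact ⟨fun j => opUnopLinearEquiv R (r j), by simp⟩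
  · rintro ⟨r, rfl⟩
    exact ⟨fun j => (opUnopLinearEquiv R).symm (r j), by simp⟩

/-- Every map between finitely generated free modules is the differential of degree `-1` of a
complex in Kato's category. -/
theorem exists_isKato [IsNoetherianRing R] [IsNoetherianRing Rᵐᵒᵖ] {a b : ℕ}
    (α : (Fin a → R) →ₗ[Rᵐᵒᵖ] (Fin b → R)) :
    ∃ F : CochainComplex (ModuleCat.{u} Rᵐᵒᵖ) ℤ, IsKato R F ∧
      ∃ (e : F.X (-1) ≃ₗ[Rᵐᵒᵖ] (Fin a → R)) (e' : F.X 0 ≃ₗ[Rᵐᵒᵖ] (Fin b → R)),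
        ∀ x, e' ((F.d (-1) 0).hom x) = α (e x) := by
  -- A state (m, n, D) stands for the single map D m n. Carrying a family over all sizes avoids a
  -- state type that depends on the ranks.
  let S := ℕ × ℕ × (∀ m n : ℕ, (Fin m → R) →ₗ[Rᵐᵒᵖ] (Fin n → R))
  have hS : ∀ (m n : ℕ) (f : (Fin m → R) →ₗ[Rᵐᵒᵖ] (Fin n → R)), ∃ F : ∀ m n : ℕ,
      (Fin m → R) →ₗ[Rᵐᵒᵖ] (Fin n → R), F m n = f := fun m n f =>
    ⟨Function.update 0 m (Function.update 0 n f), by simp⟩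
  obtain ⟨f, rfl⟩ := hS _ _ α
  obtain ⟨c, g, hgf, hg⟩ := exists_extension_of_noetherian (f a b)
  obtain ⟨g, rfl⟩ := hS _ _ g
  -- The relation between the indices i and i + 1 records the condition at Fⁱ⁺¹, where the two
  -- differentials meet. Dual exactness in degree 0 is thus a relation between the two seeds, and g
  -- was chosen to satisfy it.
  obtain ⟨s, hs, hs0, hR⟩ := exists_int_sequence (S := S) (fun _ _ => True)
    (fun i s s' => s.2.1 = s'.1 ∧ s'.2.2 s.2.1 s'.2.1 ∘ₗ s.2.2 s.1 s.2.1 = 0 ∧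
      (i + 1 < 0 → Function.Exact (s.2.2 s.1 s.2.1) (s'.2.2 s.2.1 s'.2.1)) ∧
      (0 ≤ i + 1 → ∀ u : (Fin s.2.1 → R) →ₗ[Rᵐᵒᵖ] R, u ∘ₗ s.2.2 s.1 s.2.1 = 0 →
        ∃ v : (Fin s'.2.1 → R) →ₗ[Rᵐᵒᵖ] R, v ∘ₗ s'.2.2 s.2.1 s'.2.1 = u))
    (a, b, f) (b, c, g) trivial trivial ⟨rfl, hgf, fun h => by lia, fun _ => hg⟩
    (fun i hi s _ => by
      obtain ⟨c, g, hgf, hg⟩ := exists_extension_of_noetherian (s.2.2 s.1 s.2.1)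
      obtain ⟨g, rfl⟩ := hS _ _ g
      exact ⟨(s.2.1, c, g), trivial, rfl, hgf, fun h => by lia, fun _ => hg⟩)
    (fun i hi s _ => by
      obtain ⟨c, g, hg⟩ := exists_cover_of_noetherian (s.2.2 s.1 s.2.1)
      obtain ⟨g, rfl⟩ := hS _ _ g
      exact ⟨(c, s.1, g), trivial, rfl, LinearMap.ext fun x => hg.apply_apply_eq_zero x,
        fun _ => hg, fun h => by lia⟩)
  let n : ℤ → ℕ := fun i => (s i).1
  let D : ∀ i, (Fin (n i) → R) →ₗ[Rᵐᵒᵖ] (Fin (n (i + 1)) → R) := fun i => (s i).2.2 _ _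
  have hD : ∀ i, D (i + 1) ∘ₗ D i = 0 ∧
      (i + 1 < 0 → Function.Exact (D i) (D (i + 1))) ∧
      (0 ≤ i + 1 → ∀ u : (Fin (n (i + 1)) → R) →ₗ[Rᵐᵒᵖ] R, u ∘ₗ D i = 0 →
        ∃ v : (Fin (n (i + 1 + 1)) → R) →ₗ[Rᵐᵒᵖ] R, v ∘ₗ D (i + 1) = u) := by
    intro i
    obtain ⟨h, h'⟩ := hR i
    have h2 := (hR (i + 1)).1
    rw [h, h2] at h'
    exact h'
  let F : CochainComplex (ModuleCat.{u} Rᵐᵒᵖ) ℤ :=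
    CochainComplex.of (fun i => ModuleCat.of Rᵐᵒᵖ (Fin (n i) → R))
      (fun i => ModuleCat.ofHom (D i)) (fun i => ModuleCat.hom_ext (hD i).1)
  have hFd : ∀ i, F.d i (i + 1) = ModuleCat.ofHom (D i) := fun i =>
    CochainComplex.of_d (fun i => ModuleCat.of Rᵐᵒᵖ (Fin (n i) → R))
      (fun i => ModuleCat.ofHom (D i)) i
  refine ⟨F, ⟨fun i => ⟨?_, ?_⟩, fun i hi => ?_, fun i hi => ?_⟩, ?_⟩
  · change Module.Finite Rᵐᵒᵖ (Fin (n i) → R)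
    infer_instance
  · change Module.Projective Rᵐᵒᵖ (Fin (n i) → R)
    infer_instance
  · obtain ⟨j, rfl⟩ : ∃ j, i = j + 1 := ⟨i - 1, by lia⟩
    change F.ExactAt (j + 1)
    rw [HomologicalComplex.exactAt_iff' _ j (j + 1) (j + 1 + 1) (by simp) (by simp),
      ShortComplex.ShortExact.moduleCat_exact_iff_function_exact]
    change Function.Exact (F.d j (j + 1)).hom (F.d (j + 1) (j + 1 + 1)).hom
    rw [hFd, hFd]
    exact (hD j).2.1 hi
  · obtain ⟨j, rfl⟩ : ∃ j, i = j + 1 := ⟨i - 1, by lia⟩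
    change Function.Exact (dualDifferential R F (j + 1) (j + 1 + 1))
      (dualDifferential R F (j + 1 - 1) (j + 1))
    rw [show j + 1 - 1 = j by lia]
    intro w
    change w ∘ₗ (F.d j (j + 1)).hom = 0 ↔ ∃ v, v ∘ₗ (F.d (j + 1) (j + 1 + 1)).hom = w
    rw [hFd, hFd]
    refine ⟨(hD j).2.2 hi w, ?_⟩
    rintro ⟨v, rfl⟩
    change v ∘ₗ (D (j + 1) ∘ₗ D j) = 0
    rw [(hD j).1, LinearMap.comp_zero]
  · have ha : n (-1) = a := by simp [n, hs]
    have hb : n 0 = b := by simp [n, hs0]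
    refine ⟨LinearEquiv.funCongrLeft Rᵐᵒᵖ R (finCongr ha.symm),
      LinearEquiv.funCongrLeft Rᵐᵒᵖ R (finCongr hb.symm), fun x => ?_⟩
    have hd : (F.d (-1) 0).hom = (s (-1)).2.2 (n (-1)) (n 0) := congrArg _ (hFd (-1))
    rw [hd, hs]
    have key : ∀ (m k : ℕ) (hm : a = m) (hk : b = k) (y : Fin m → R),
        LinearEquiv.funCongrLeft Rᵐᵒᵖ R (finCongr hk) (f m k y) =
          f a b (LinearEquiv.funCongrLeft Rᵐᵒᵖ R (finCongr hm) y) := by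
      rintro _ _ rfl rfl y
      rfl
    exact key _ _ ha.symm hb.symm x

end

/-! ## An equational criterion for projectivity -/

/-- Let the rows of α generate the kernel of a free cover π : Rⁿ → M. The factorization x = βy, with
y lifted to Rⁿ, is an endomorphism g of Rⁿ with πg = π. The condition αβ = 0 makes g vanish on ker
π, so it descends to a section of π. -/
theorem projective_of_equational (R M : Type*) [Ring R] [IsNoetherianRing R] [AddCommGroup M]
    [Module R M] [Module.Finite R M]
    (h : ∀ (n m : ℕ) (x : Fin n → M) (α : Fin m → Fin n → R), (∀ k, ∑ i, α k i • x i = 0) →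
      ∃ (l : ℕ) (β : Fin n → Fin l → R) (y : Fin l → M), (∀ i, x i = ∑ j, β i j • y j) ∧
        ∀ k j, ∑ i, α k i * β i j = 0) : Module.Projective R M := by
  obtain ⟨n, π, hπ⟩ := Module.Finite.exists_fin' R M
  obtain ⟨m, α, hα⟩ := Submodule.fg_iff_exists_fin_generating_family.1
    (IsNoetherian.noetherian (LinearMap.ker π))
  let x : Fin n → M := fun i => π (Pi.single i 1)
  have hx : ∀ a : Fin n → R, π a = ∑ i, a i • x i := fun a => by
    conv_lhs => rw [pi_eq_sum_univ' a, map_sum]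
    refine Finset.sum_congr rfl fun i _ => ?_
    rw [map_smul]
  have hker : ∀ k, π (α k) = 0 := fun k => by
    have : α k ∈ LinearMap.ker π := hα ▸ Submodule.subset_span ⟨k, rfl⟩
    exact this
  obtain ⟨l, β, y, hxy, hαβ⟩ := h n m x α fun k => by rw [← hx, hker]
  choose c hc using fun j => hπ (y j)
  let g : (Fin n → R) →ₗ[R] (Fin n → R) :=
    ∑ i, LinearMap.toSpanSingleton R _ (∑ j, β i j • c j) ∘ₗ LinearMap.proj i
  have hg : ∀ a, g a = ∑ i, a i • ∑ j, β i j • c j := fun a => by simp [g]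
  have hgα : ∀ k, g (α k) = 0 := fun k => by
    rw [hg]
    simp only [Finset.smul_sum, smul_smul]
    rw [Finset.sum_comm]
    simp only [← Finset.sum_smul, hαβ, zero_smul, Finset.sum_const_zero]
  have hle : LinearMap.ker π ≤ LinearMap.ker g := by
    rw [← hα, Submodule.span_le]
    rintro _ ⟨k, rfl⟩
    exact hgα k
  have hgker : g ∘ₗ (LinearMap.ker π).subtype = 0 := LinearMap.ext fun a => hle a.2
  obtain ⟨s, hs⟩ := LinearMap.exists_desc (f := (LinearMap.ker π).subtype) (p := π)
    (by intro a; simp) hπ g hgker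
  refine Module.Projective.of_split s π ?_
  rw [← LinearMap.cancel_right hπ, LinearMap.comp_assoc, hs]
  refine LinearMap.ext fun a => ?_
  simp only [LinearMap.comp_apply, hg, map_sum, map_smul, hc, LinearMap.id_apply, ← hxy]
  exact (hx a).symm

/-- Left multiplication by a matrix, as a map of free right modules. -/
def mulVecRight {R : Type*} [Ring R] {m n : ℕ} (α : Fin m → Fin n → R) :
    (Fin n → R) →ₗ[Rᵐᵒᵖ] (Fin m → R) where
  toFun v k := ∑ i, α k i * v i
  map_add' v w := by ext; simp [mul_add, Finset.sum_add_distrib]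
  map_smul' r v := by ext; simp [Finset.sum_mul, mul_assoc]

theorem mulVecRight_apply {R : Type*} [Ring R] {m n : ℕ} (α : Fin m → Fin n → R) (v : Fin n → R)
    (k : Fin m) : mulVecRight α v k = ∑ i, α k i * v i := rfl

theorem BalancedTensor.exists_sum {R X M : Type*} [Ring R] [AddCommGroup X] [Module Rᵐᵒᵖ X]
    [AddCommGroup M] [Module R M] (t : BalancedTensor R X M) :
    ∃ (n : ℕ) (x : Fin n → X) (m : Fin n → M), t = ∑ j, tmul R (x j) (m j) := by
  induction t using induction_on with
  | zero => exact ⟨0, Fin.elim0, Fin.elim0, by simp⟩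
  | tmul x m => exact ⟨1, fun _ => x, fun _ => m, by simp⟩
  | add a b ha hb =>
    obtain ⟨n, x, m, rfl⟩ := ha
    obtain ⟨n', x', m', rfl⟩ := hb
    exact ⟨n + n', Fin.append x x', Fin.append m m', by simp [Fin.sum_univ_add]⟩

/-- For a linear form `ξ` on `X`, the map `X ⊗_R M → M`, `x ⊗ m ↦ ξ(x) m`. -/
def BalancedTensor.contract {R S X M : Type*} [Ring R] [Ring S] [AddCommGroup X] [Module Rᵐᵒᵖ X]
    [AddCommGroup M] [Module R M] [Module Sᵐᵒᵖ M] [SMulCommClass R Sᵐᵒᵖ M]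
    (ξ : X →ₗ[Rᵐᵒᵖ] R) : BalancedTensor R X M →ₗ[Sᵐᵒᵖ] M :=
  liftRight (AddMonoidHom.mk' (fun x => AddMonoidHom.mk' (fun m => ξ x • m) fun m m' => by simp)
      fun x y => by ext; simp [add_smul])
    (fun x r m => by simp [mul_smul]) (fun x s m => by simp [smul_comm])

@[simp]
theorem BalancedTensor.contract_tmul {R S X M : Type*} [Ring R] [Ring S] [AddCommGroup X]
    [Module Rᵐᵒᵖ X] [AddCommGroup M] [Module R M] [Module Sᵐᵒᵖ M] [SMulCommClass R Sᵐᵒᵖ M]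
    (ξ : X →ₗ[Rᵐᵒᵖ] R) (x : X) (m : M) : contract (S := S) ξ (tmul R x m) = ξ x • m := rfl

/-- For `x : X`, the map `M → X ⊗_R M`, `m ↦ x ⊗ m`. -/
def BalancedTensor.inc {R : Type*} (S : Type*) {X : Type*} (M : Type*) [Ring R] [Ring S]
    [AddCommGroup X] [Module Rᵐᵒᵖ X]
    [AddCommGroup M] [Module R M] [Module Sᵐᵒᵖ M] [SMulCommClass R Sᵐᵒᵖ M]
    (x : X) : M →ₗ[Sᵐᵒᵖ] BalancedTensor R X M where
  toFun m := tmul R x m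
  map_add' := tmul_add x
  map_smul' _ _ := rfl

@[simp]
theorem BalancedTensor.inc_apply {R S X M : Type*} [Ring R] [Ring S] [AddCommGroup X]
    [Module Rᵐᵒᵖ X] [AddCommGroup M] [Module R M] [Module Sᵐᵒᵖ M] [SMulCommClass R Sᵐᵒᵖ M]
    (x : X) (m : M) : inc S M x m = tmul R x m := rfl

/-! ## The functor on Kato's categories, on the level of complexes -/

section

variable {A B M : Type u} [Ring A] [Ring B] [AddCommGroup M] [Module A M] [Module Bᵐᵒᵖ M]
  [SMulCommClass A Bᵐᵒᵖ M]

variable (A B M) in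
/-- Componentwise application of `- ⊗_A M` to complexes. -/
abbrev tensorComplex : CochainComplex (ModuleCat.{u} Aᵐᵒᵖ) ℤ ⥤
    CochainComplex (ModuleCat.{u} Bᵐᵒᵖ) ℤ :=
  (tensorBimodule A B M).mapHomologicalComplex (ComplexShape.up ℤ)

namespace TensorInducesKatoEquivalence

theorem isKato (hM : TensorInducesKatoEquivalence A B M)
    {F : CochainComplex (ModuleCat.{u} Aᵐᵒᵖ) ℤ} (hF : IsKato A F) :
    IsKato B ((tensorComplex A B M).obj F) :=
  hM.1 ⟨(HomotopyCategory.quotient _ _).obj F, hF⟩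

theorem full (hM : TensorInducesKatoEquivalence A B M)
    {F G : CochainComplex (ModuleCat.{u} Aᵐᵒᵖ) ℤ} (hF : IsKato A F) (hG : IsKato A G)
    (f : (tensorComplex A B M).obj F ⟶ (tensorComplex A B M).obj G) :
    ∃ g : F ⟶ G, Nonempty (Homotopy ((tensorComplex A B M).map g) f) := by
  obtain ⟨h, hE⟩ := hM
  let F' : KatoCategory A := ⟨(HomotopyCategory.quotient _ _).obj F, hF⟩
  let G' : KatoCategory A := ⟨(HomotopyCategory.quotient _ _).obj G, hG⟩
  obtain ⟨g, hg⟩ := Functor.map_surjective ((katoProperty B).lift ((katoProperty A).ι ⋙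
    (tensorBimodule A B M).mapHomotopyCategory (ComplexShape.up ℤ)) h) (X := F') (Y := G')
    (ObjectProperty.homMk ((HomotopyCategory.quotient _ _).map f))
  obtain ⟨g', hg'⟩ := (HomotopyCategory.quotient _ _).map_surjective g.hom
  refine ⟨g', ⟨HomotopyCategory.homotopyOfEq _ _ ?_⟩⟩
  have := congrArg InducedCategory.Hom.hom hg
  change ((tensorBimodule A B M).mapHomotopyCategory (ComplexShape.up ℤ)).map g.hom = _ at this
  rw [← hg'] at this
  exact this

theorem faithful (hM : TensorInducesKatoEquivalence A B M)
    {F G : CochainComplex (ModuleCat.{u} Aᵐᵒᵖ) ℤ} (hF : IsKato A F) (hG : IsKato A G)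
    (g : F ⟶ G) (hg : Nonempty (Homotopy ((tensorComplex A B M).map g) 0)) :
    Nonempty (Homotopy g 0) := by
  obtain ⟨h, hE⟩ := hM
  let F' : KatoCategory A := ⟨(HomotopyCategory.quotient _ _).obj F, hF⟩
  let G' : KatoCategory A := ⟨(HomotopyCategory.quotient _ _).obj G, hG⟩
  have := Functor.map_injective ((katoProperty B).lift ((katoProperty A).ι ⋙
    (tensorBimodule A B M).mapHomotopyCategory (ComplexShape.up ℤ)) h) (X := F') (Y := G')
    (a₁ := ObjectProperty.homMk ((HomotopyCategory.quotient _ _).map g))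
    (a₂ := ObjectProperty.homMk ((HomotopyCategory.quotient _ _).map 0)) (by
      refine ObjectProperty.hom_ext _ ?_
      change (HomotopyCategory.quotient _ _).map ((tensorComplex A B M).map g) =
        (HomotopyCategory.quotient _ _).map ((tensorComplex A B M).map 0)
      rw [Functor.map_zero]
      exact HomotopyCategory.eq_of_homotopy _ _ hg.some)
  exact ⟨HomotopyCategory.homotopyOfEq _ _ (congrArg (fun f : F' ⟶ G' => f.hom) this)⟩

theorem essSurj (hM : TensorInducesKatoEquivalence A B M)
    {G : CochainComplex (ModuleCat.{u} Bᵐᵒᵖ) ℤ} (hG : IsKato B G) :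
    ∃ F : CochainComplex (ModuleCat.{u} Aᵐᵒᵖ) ℤ, IsKato A F ∧
      Nonempty (HomotopyEquiv ((tensorComplex A B M).obj F) G) := by
  obtain ⟨h, hE⟩ := hM
  let G' : KatoCategory B := ⟨(HomotopyCategory.quotient _ _).obj G, hG⟩
  let E := (katoProperty B).lift ((katoProperty A).ι ⋙
    (tensorBimodule A B M).mapHomotopyCategory (ComplexShape.up ℤ)) h
  let e := E.objObjPreimageIso G'
  exact ⟨(E.objPreimage G').obj.as, (E.objPreimage G').property,
    ⟨HomotopyCategory.homotopyEquivOfIso ((katoProperty B).ι.mapIso e)⟩⟩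

end TensorInducesKatoEquivalence

end

/-! ## Passage to modules -/

theorem BalancedTensor.mapRight_exact {R S X Y Z M : Type*} [Ring R] [Ring S] [AddCommGroup X]
    [Module Rᵐᵒᵖ X] [AddCommGroup Y] [Module Rᵐᵒᵖ Y] [AddCommGroup Z] [Module Rᵐᵒᵖ Z]
    [AddCommGroup M] [Module R M] [Module Sᵐᵒᵖ M] [SMulCommClass R Sᵐᵒᵖ M]
    {f : X →ₗ[Rᵐᵒᵖ] Y} {g : Y →ₗ[Rᵐᵒᵖ] Z} (h : Function.Exact f g) (hg : Function.Surjective g) :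
    Function.Exact (mapRight S M f) (mapRight S M g) := map_exact h hg

theorem BalancedTensor.mapRight_surjective {R S X Y M : Type*} [Ring R] [Ring S] [AddCommGroup X]
    [Module Rᵐᵒᵖ X] [AddCommGroup Y] [Module Rᵐᵒᵖ Y]
    [AddCommGroup M] [Module R M] [Module Sᵐᵒᵖ M] [SMulCommClass R Sᵐᵒᵖ M]
    {f : X →ₗ[Rᵐᵒᵖ] Y} (hf : Function.Surjective f) :
    Function.Surjective (mapRight S M f) := map_surjective hf

section

variable {A B M : Type u} [Ring A] [Ring B] [AddCommGroup M] [Module A M] [Module Bᵐᵒᵖ M]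
  [SMulCommClass A Bᵐᵒᵖ M]

open BalancedTensor

/-- Every finitely generated module is the cokernel in degree zero of a complex in Kato's
category. -/
theorem exists_isKato_cokernel (A : Type u) [Ring A] [IsNoetherianRing A] [IsNoetherianRing Aᵐᵒᵖ]
    (X : Type u)
    [AddCommGroup X] [Module Aᵐᵒᵖ X] [Module.Finite Aᵐᵒᵖ X] :
    ∃ F : CochainComplex (ModuleCat.{u} Aᵐᵒᵖ) ℤ, IsKato A F ∧
      ∃ p : F.X 0 →ₗ[Aᵐᵒᵖ] X, Function.Exact (F.d (-1) 0).hom p ∧ Function.Surjective p := by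
  obtain ⟨n, π, hπ⟩ := Module.Finite.exists_fin' Aᵐᵒᵖ X
  let u : (Fin n → A) ≃ₗ[Aᵐᵒᵖ] (Fin n → Aᵐᵒᵖ) :=
    LinearEquiv.piCongrRight fun _ => (opUnopLinearEquiv A).symm
  have : IsNoetherian Aᵐᵒᵖ A := isNoetherian_of_linearEquiv (opUnopLinearEquiv A)
  let π' : (Fin n → A) →ₗ[Aᵐᵒᵖ] X := π ∘ₗ u.toLinearMap
  have hπ' : Function.Surjective π' := hπ.comp u.surjective
  obtain ⟨m, w, hw⟩ := Submodule.fg_iff_exists_fin_generating_family.1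
    (IsNoetherian.noetherian (LinearMap.ker π'))
  let α : (Fin m → A) →ₗ[Aᵐᵒᵖ] (Fin n → A) := ∑ j, LinearMap.toSpanSingleton Aᵐᵒᵖ _ (w j) ∘ₗ
    (opUnopLinearEquiv A).symm.toLinearMap ∘ₗ LinearMap.proj j
  have hα : Function.Exact α π' := fun x => by
    rw [← LinearMap.mem_ker, ← hw, Submodule.mem_span_range_iff_exists_fun]
    constructor
    · rintro ⟨r, rfl⟩
      exact ⟨fun j => opUnopLinearEquiv A (r j), by simp [α]⟩
    · rintro ⟨r, rfl⟩
      exact ⟨fun j => (opUnopLinearEquiv A).symm (r j), by simp [α]⟩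
  obtain ⟨F, hF, e, e', he⟩ := exists_isKato α
  refine ⟨F, hF, π' ∘ₗ e'.toLinearMap, fun x => ?_, hπ'.comp e'.surjective⟩
  refine (hα (e' x)).trans ⟨?_, ?_⟩
  · rintro ⟨y, hy⟩
    exact ⟨e.symm y, e'.injective (by rw [he, e.apply_symm_apply, hy])⟩
  · rintro ⟨y, rfl⟩
    exact ⟨e y, (he y).symm⟩

section

variable {F G : CochainComplex (ModuleCat.{u} Aᵐᵒᵖ) ℤ} {X Y : Type u} [AddCommGroup X]
  [Module Aᵐᵒᵖ X] [AddCommGroup Y] [Module Aᵐᵒᵖ Y]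
  {p : F.X 0 →ₗ[Aᵐᵒᵖ] X} {q : G.X 0 →ₗ[Aᵐᵒᵖ] Y}

theorem comp_chainMap_comp_d (hq : Function.Exact (G.d (-1) 0).hom q) (f : F ⟶ G) :
    (q ∘ₗ (f.f 0).hom) ∘ₗ (F.d (-1) 0).hom = 0 := by
  ext x
  have := congrArg (fun φ => q (φ.hom x)) (f.comm (-1) 0)
  simp only [ModuleCat.hom_comp, LinearMap.comp_apply] at this
  exact this.symm.trans (hq.apply_apply_eq_zero _)

variable (B M) in
/-- The tensor product with `M` of a cokernel map in degree zero. -/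
def tensorCokernel (p : F.X 0 →ₗ[Aᵐᵒᵖ] X) :
    ((tensorComplex A B M).obj F).X 0 →ₗ[Bᵐᵒᵖ] BalancedTensor A X M :=
  mapRight B M p

theorem tensorCokernel_exact (hp : Function.Exact (F.d (-1) 0).hom p)
    (hp' : Function.Surjective p) :
    Function.Exact (((tensorComplex A B M).obj F).d (-1) 0).hom (tensorCokernel B M p) :=
  mapRight_exact (S := B) (M := M) hp hp'

theorem tensorCokernel_surjective (hp' : Function.Surjective p) :
    Function.Surjective (tensorCokernel B M p) :=
  mapRight_surjective (S := B) (M := M) hp'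

theorem tensorCokernel_comp (g : F ⟶ G) {f : X →ₗ[Aᵐᵒᵖ] Y} (h : q ∘ₗ (g.f 0).hom = f ∘ₗ p) :
    tensorCokernel B M q ∘ₗ (((tensorComplex A B M).map g).f 0).hom =
      mapRight B M f ∘ₗ tensorCokernel B M p :=
  (mapRight_comp q (g.f 0).hom).symm.trans ((congrArg _ h).trans (mapRight_comp f p))

end

/-! ### The induced functor between stable module categories -/

namespace TensorInducesKatoEquivalence

variable [IsNoetherianRing A] [IsNoetherianRing Aᵐᵒᵖ]

/-- Lift φ to a chain map of the tensored complexes and replace it, up to homotopy, by one that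
comes from A. Right exactness identifies the cokernels of the tensored complexes with the tensored
cokernels. -/
theorem stable_full (hM : TensorInducesKatoEquivalence A B M) {X X' : Type u} [AddCommGroup X]
    [Module Aᵐᵒᵖ X] [Module.Finite Aᵐᵒᵖ X] [AddCommGroup X'] [Module Aᵐᵒᵖ X']
    [Module.Finite Aᵐᵒᵖ X'] (φ : BalancedTensor A X M →ₗ[Bᵐᵒᵖ] BalancedTensor A X' M) :
    ∃ f : X →ₗ[Aᵐᵒᵖ] X', FactorsThroughFree (mapRight B M f - φ) := by
  obtain ⟨F, hF, p, hp, hp'⟩ := exists_isKato_cokernel A X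
  obtain ⟨G, hG, q, hq, hq'⟩ := exists_isKato_cokernel A X'
  obtain ⟨g, hg⟩ := exists_chainMap (hM.isKato hF) (hM.isKato hG)
    (tensorCokernel_exact (B := B) (M := M) hp hp') (tensorCokernel_exact hq hq')
    (tensorCokernel_surjective hq') φ
  obtain ⟨g', ⟨hh⟩⟩ := hM.full hF hG g
  obtain ⟨f, hf⟩ := LinearMap.exists_desc hp hp' (q ∘ₗ (g'.f 0).hom)
    (comp_chainMap_comp_d hq g')
  exact ⟨f, Homotopy.factorsThroughFree (hM.isKato hF) (tensorCokernel_exact hp hp')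
    (tensorCokernel_surjective hp') (tensorCokernel_exact hq hq') hh
    (tensorCokernel_comp g' hf.symm) hg⟩

/-- If f ⊗ M factors through a free module, a chain map lifting f becomes null-homotopic after
tensoring. It was then null-homotopic already, so its cokernel map f factors through a free module.
-/
theorem stable_faithful (hM : TensorInducesKatoEquivalence A B M) {X X' : Type u} [AddCommGroup X]
    [Module Aᵐᵒᵖ X] [Module.Finite Aᵐᵒᵖ X] [AddCommGroup X'] [Module Aᵐᵒᵖ X']
    [Module.Finite Aᵐᵒᵖ X'] (f : X →ₗ[Aᵐᵒᵖ] X') (hf : FactorsThroughFree (mapRight B M f)) :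
    FactorsThroughFree f := by
  obtain ⟨F, hF, p, hp, hp'⟩ := exists_isKato_cokernel A X
  obtain ⟨G, hG, q, hq, hq'⟩ := exists_isKato_cokernel A X'
  obtain ⟨g, hg⟩ := exists_chainMap hF hG hp hq hq' f
  obtain ⟨hh⟩ := hM.faithful hF hG g (exists_nullHomotopy (hM.isKato hF) (hM.isKato hG)
    (tensorCokernel_exact hp hp') (tensorCokernel_exact hq hq')
    (tensorCokernel_surjective hq') _ hf _ (tensorCokernel_comp g hg))
  have := Homotopy.factorsThroughFree hF hp hp' hq hh hg (ψ := 0) (by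
    ext x; simp)
  rwa [sub_zero] at this

/-- A homotopy equivalence of complexes induces mutually inverse stable maps of cokernels. -/
theorem stable_essSurj [IsNoetherianRing B] [IsNoetherianRing Bᵐᵒᵖ]
    (hM : TensorInducesKatoEquivalence A B M) (Y : Type u) [AddCommGroup Y]
    [Module Bᵐᵒᵖ Y] [Module.Finite Bᵐᵒᵖ Y] :
    ∃ (X : Type u) (_ : AddCommGroup X) (_ : Module Aᵐᵒᵖ X) (_ : Module.Finite Aᵐᵒᵖ X)
      (v : BalancedTensor A X M →ₗ[Bᵐᵒᵖ] Y) (w : Y →ₗ[Bᵐᵒᵖ] BalancedTensor A X M),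
      FactorsThroughFree (v ∘ₗ w - LinearMap.id) ∧
      FactorsThroughFree (w ∘ₗ v - LinearMap.id) := by
  obtain ⟨G, hG, q, hq, hq'⟩ := exists_isKato_cokernel B Y
  obtain ⟨F, hF, ⟨E⟩⟩ := hM.essSurj hG
  let X := F.X 0 ⧸ LinearMap.range (F.d (-1) 0).hom
  let p : F.X 0 →ₗ[Aᵐᵒᵖ] X := (LinearMap.range (F.d (-1) 0).hom).mkQ
  have hp : Function.Exact (F.d (-1) 0).hom p := LinearMap.exact_map_mkQ_range _
  have hp' : Function.Surjective p := Submodule.mkQ_surjective _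
  have hXf : Module.Finite Aᵐᵒᵖ X := by
    have := hF.finite 0
    exact Module.Finite.of_surjective p hp'
  have hpM := tensorCokernel_exact (B := B) (M := M) hp hp'
  have hpM' := tensorCokernel_surjective (B := B) (M := M) hp'
  obtain ⟨v, hv⟩ := LinearMap.exists_desc hpM hpM'
    (q ∘ₗ (E.hom.f 0).hom) (comp_chainMap_comp_d hq E.hom)
  obtain ⟨w, hw⟩ := LinearMap.exists_desc hq hq'
    (tensorCokernel B M p ∘ₗ (E.inv.f 0).hom) (comp_chainMap_comp_d hpM E.inv)
  refine ⟨X, inferInstance, inferInstance, hXf, v, w, ?_, ?_⟩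
  · refine Homotopy.factorsThroughFree hG hq hq' hq E.homotopyInvHomId ?_ rfl
    rw [LinearMap.comp_assoc, hw, ← LinearMap.comp_assoc, hv]
    rfl
  · refine Homotopy.factorsThroughFree (hM.isKato hF) hpM hpM' hpM E.homotopyHomInvId ?_ rfl
    rw [LinearMap.comp_assoc, hv, ← LinearMap.comp_assoc, hw]
    rfl

/-! ## Projectivity of the bimodules -/

/-- Some complex in 𝓛_A has A as its term of degree 0, so M ≅ A ⊗_A M is a retract of a term of a
complex in 𝓛_B. -/
theorem projective_right (hM : TensorInducesKatoEquivalence A B M) :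
    Module.Projective Bᵐᵒᵖ M := by
  obtain ⟨F, hF, -, e, -⟩ := exists_isKato (0 : (Fin 0 → A) →ₗ[Aᵐᵒᵖ] (Fin 1 → A))
  have : Module.Projective Bᵐᵒᵖ (BalancedTensor A (F.X 0) M) := (hM.isKato hF).projective 0
  refine Module.Projective.of_split (inc B M (e.symm 1))
    (contract (S := B) (LinearMap.proj 0 ∘ₗ e.toLinearMap)) ?_
  ext m
  simp

/-- Take the relations α as the differential d⁻¹ of a complex in 𝓛_A. They say that ∑ eᵢ ⊗ xᵢ is a
cycle in degree −1 of the tensored complex. By exactness it is a boundary; the coordinates of the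
boundary form β, and αβ = 0 because d² = 0. -/
theorem projective_left [Module.Finite A M] (hM : TensorInducesKatoEquivalence A B M) :
    Module.Projective A M := by
  refine projective_of_equational A M fun n m x α hα => ?_
  obtain ⟨F, hF, e, e', he⟩ := exists_isKato (mulVecRight α)
  have hex : Function.Exact (mapRight B M (F.d (-2) (-1)).hom)
    (mapRight B M (F.d (-1) 0).hom) := (hM.isKato hF).exact (by norm_num) rfl rfl
  have hd : ∀ i, (F.d (-1) 0).hom (e.symm (Pi.single i 1)) =
      ∑ k, op (α k i) • e'.symm (Pi.single k 1) := fun i => by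
    apply e'.injective
    rw [he, e.apply_symm_apply, map_sum]
    ext k
    simp [mulVecRight_apply, Pi.single_apply]
  obtain ⟨s, hs⟩ := (hex (∑ i, tmul A (e.symm (Pi.single i 1)) (x i))).1 (by
    simp only [map_sum, mapRight_tmul, hd, BalancedTensor.sum_tmul, BalancedTensor.smul_tmul]
    rw [Finset.sum_comm]
    simp only [← BalancedTensor.tmul_sum, hα, BalancedTensor.tmul_zero, Finset.sum_const_zero])
  obtain ⟨l, q, y, rfl⟩ := exists_sum s
  refine ⟨l, fun i j => e ((F.d (-2) (-1)).hom (q j)) i, y, fun i => ?_, fun k j => ?_⟩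
  · have := congrArg (contract (S := B) (LinearMap.proj i ∘ₗ e.toLinearMap)) hs
    simp only [map_sum, mapRight_tmul, contract_tmul, LinearMap.comp_apply,
      LinearMap.proj_apply, LinearEquiv.coe_coe, e.apply_symm_apply] at this
    simp [this, Pi.single_apply]
  · have h0 : (F.d (-1) 0).hom ((F.d (-2) (-1)).hom (q j)) = 0 :=
      LinearMap.congr_fun (congrArg ModuleCat.Hom.hom (F.d_comp_d (-2) (-1) 0)) (q j)
    have := congrFun (he ((F.d (-2) (-1)).hom (q j))) k
    rw [h0, map_zero] at this
    exact this.symm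

/-- The tuple x in Nⁿ is a linear form on Mⁿ ≅ F⁰ ⊗_A M, and the relations say that it vanishes on
boundaries. Dual exactness in degree 0 extends it to F¹ ⊗_A M, and a dual basis of F¹ rewrites the
extension as elements of N. -/
theorem projective_dual [Module.Finite Aᵐᵒᵖ (DualBimodule B M)]
    (hM : TensorInducesKatoEquivalence A B M) :
    Module.Projective Aᵐᵒᵖ (DualBimodule B M) := by
  refine projective_of_equational Aᵐᵒᵖ (DualBimodule B M) fun n m x α hα => ?_
  obtain ⟨F, hF, e, e', he⟩ := exists_isKato
    (mulVecRight fun (i : Fin n) (k : Fin m) => unop (α k i))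
  have hex := (hM.isKato hF).dual_exact le_rfl (i := -1) (k := 1) rfl rfl
  have hd : ∀ k, (F.d (-1) 0).hom (e.symm (Pi.single k 1)) =
      ∑ i, α k i • e'.symm (Pi.single i 1) := fun k => by
    apply e'.injective
    rw [he, e.apply_symm_apply, map_sum]
    ext i
    simp [mulVecRight_apply, Pi.single_apply]
  have hN : ∀ k (m : M), ∑ i, x i (unop (α k i) • m) = 0 := fun k m => by
    have h1 : (∑ i, (α k i • x i : DualBimodule B M)) m = (0 : DualBimodule B M) m :=
      congrArg (fun f : DualBimodule B M => f m) (hα k)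
    have h2 : (∑ i, (α k i • x i : DualBimodule B M)) m =
        ∑ i, (α k i • x i : DualBimodule B M) m :=
      LinearMap.sum_apply Finset.univ (fun i => (α k i • x i : DualBimodule B M)) m
    rw [h2] at h1
    exact h1
  let φ : BalancedTensor A (F.X 0) M →ₗ[Bᵐᵒᵖ] B :=
    ∑ i, (show M →ₗ[Bᵐᵒᵖ] B from x i) ∘ₗ
      contract (S := B) (LinearMap.proj i ∘ₗ e'.toLinearMap)
  have hφ : ∀ v m, φ (tmul A v m) = ∑ i, x i (e' v i • m) := fun v m => by
    simp only [φ, LinearMap.sum_apply]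
    rfl
  obtain ⟨ψ, hψ⟩ : ∃ ψ : BalancedTensor A (F.X 1) M →ₗ[Bᵐᵒᵖ] B,
      ∀ v m, ψ (tmul A ((F.d 0 1).hom v) m) = φ (tmul A v m) := by
    obtain ⟨ψ, hψ⟩ := (hex φ).1 (by
      refine linearMap_ext fun w m => ?_
      change φ (tmul A ((F.d (-1) 0).hom w) m) = 0
      rw [hφ, he]
      simp only [mulVecRight_apply, Finset.sum_smul, mul_smul]
      have : ∀ i, x i (∑ k, unop (α k i) • e w k • m) = ∑ k, x i (unop (α k i) • e w k • m) :=
        fun i => map_sum (show M →ₗ[Bᵐᵒᵖ] B from x i) _ _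
      simp only [this]
      rw [Finset.sum_comm]
      simp only [hN, Finset.sum_const_zero])
    exact ⟨ψ, fun v m => LinearMap.congr_fun hψ (tmul A v m)⟩
  have hF1 := hF.finite 1
  have hF2 := hF.projective 1
  obtain ⟨l, f, ξ, hf⟩ := exists_right_dual_basis A (F.X 1)
  refine ⟨l, fun i j => op (ξ j ((F.d 0 1).hom (e'.symm (Pi.single i 1)))),
    fun j => (ψ ∘ₗ inc B M (f j) : M →ₗ[Bᵐᵒᵖ] B), fun i => LinearMap.ext fun m => ?_,
    fun k j => ?_⟩
  · have h1 : x i m = φ (tmul A (e'.symm (Pi.single i 1)) m) := by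
      rw [hφ, e'.apply_symm_apply, Finset.sum_eq_single i]
      · simp
      · intro j _ hj
        rw [Pi.single_eq_of_ne hj, zero_smul]
        exact map_zero (show M →ₗ[Bᵐᵒᵖ] B from x j)
      · simp
    have h2 : φ (tmul A (e'.symm (Pi.single i 1)) m) =
        ψ (tmul A ((F.d 0 1).hom (e'.symm (Pi.single i 1))) m) := by
      rw [hψ]
    change x i m = _
    rw [h1, h2]
    conv_lhs => rw [← hf ((F.d 0 1).hom (e'.symm (Pi.single i 1))), BalancedTensor.sum_tmul,
      map_sum]
    refine Eq.trans ?_ (LinearMap.sum_apply Finset.univ _ m).symm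
    exact Finset.sum_congr rfl fun j _ => by rw [BalancedTensor.smul_tmul]; rfl
  · have h0 : (F.d 0 1).hom ((F.d (-1) 0).hom (e.symm (Pi.single k 1))) = 0 :=
      LinearMap.congr_fun (congrArg ModuleCat.Hom.hom (F.d_comp_d (-1) 0 1)) _
    rw [hd, map_sum] at h0
    have := congrArg (fun z => op (ξ j z)) h0
    simp only [map_sum, map_smul, map_zero, op_zero, Finset.op_sum] at this
    exact this

end TensorInducesKatoEquivalence

end

/-! ## The right adjoint of the tensor functor -/

/-- `Hom_B(M, Y)` for right `B`-modules `M` and `Y`. If `M` is an `A`-`B`-bimodule, this is a right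
`A`-module. -/
def HomRight (B M Y : Type*) [Ring B] [AddCommGroup M] [Module Bᵐᵒᵖ M] [AddCommGroup Y]
    [Module Bᵐᵒᵖ Y] : Type _ :=
  M →ₗ[Bᵐᵒᵖ] Y

namespace HomRight

section

variable {A B M Y Y' Y'' : Type*} [Ring A] [Ring B] [AddCommGroup M] [Module Bᵐᵒᵖ M]
  [AddCommGroup Y] [Module Bᵐᵒᵖ Y] [AddCommGroup Y'] [Module Bᵐᵒᵖ Y'] [AddCommGroup Y'']
  [Module Bᵐᵒᵖ Y'']

instance : AddCommGroup (HomRight B M Y) := inferInstanceAs (AddCommGroup (M →ₗ[Bᵐᵒᵖ] Y))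

instance : FunLike (HomRight B M Y) M Y := inferInstanceAs (FunLike (M →ₗ[Bᵐᵒᵖ] Y) M Y)

/-- Linear maps as elements of `HomRight`. -/
def of : (M →ₗ[Bᵐᵒᵖ] Y) ≃+ HomRight B M Y := AddEquiv.refl _

theorem add_apply (f g : HomRight B M Y) (m : M) : (f + g) m = f m + g m := rfl

theorem zero_apply (m : M) : (0 : HomRight B M Y) m = 0 := rfl

theorem apply_add (f : HomRight B M Y) (m m' : M) : f (m + m') = f m + f m' :=
  map_add (of.symm f) m m'

theorem apply_smul (f : HomRight B M Y) (b : Bᵐᵒᵖ) (m : M) : f (b • m) = b • f m :=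
  map_smul (of.symm f) b m

theorem apply_sum (f : HomRight B M Y) {ι : Type*} (s : Finset ι) (m : ι → M) :
    f (∑ i ∈ s, m i) = ∑ i ∈ s, f (m i) :=
  map_sum (of.symm f) m s

theorem ext {f g : HomRight B M Y} (h : ∀ m, f m = g m) : f = g :=
  LinearMap.ext (f := of.symm f) (g := of.symm g) h

variable [Module A M] [SMulCommClass A Bᵐᵒᵖ M]

/-- The right action of `A`, given by `(f a)(m) = f (a m)`. -/
instance : Module Aᵐᵒᵖ (HomRight B M Y) where
  smul a f := of ((of.symm f).comp (Module.toModuleEnd Bᵐᵒᵖ (S := A) M a.unop))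
  one_smul f := ext fun m => congrArg f (one_smul A m)
  mul_smul a a' f := ext fun m => congrArg f (mul_smul a'.unop a.unop m)
  smul_zero _ := rfl
  smul_add _ _ _ := rfl
  add_smul a a' f := ext fun m =>
    (congrArg f (add_smul a.unop a'.unop m)).trans (apply_add f _ _)
  zero_smul f := ext fun m => (congrArg f (zero_smul A m)).trans (map_zero (of.symm f))

variable (A M) in
/-- Functoriality of `Hom_B(M, -)`. -/
def map (f : Y →ₗ[Bᵐᵒᵖ] Y') : HomRight B M Y →ₗ[Aᵐᵒᵖ] HomRight B M Y' where
  toFun g := of (f ∘ₗ of.symm g)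
  map_add' _ _ := ext fun _ => map_add f _ _
  map_smul' _ _ := rfl

theorem map_comp (f : Y →ₗ[Bᵐᵒᵖ] Y') (g : Y' →ₗ[Bᵐᵒᵖ] Y'') :
    map A M (g ∘ₗ f) = map A M g ∘ₗ map A M f := rfl

theorem map_id : map A M (LinearMap.id : Y →ₗ[Bᵐᵒᵖ] Y) = LinearMap.id := rfl

theorem map_sub (f g : Y →ₗ[Bᵐᵒᵖ] Y') : map A M (f - g) = map A M f - map A M g := rfl

theorem map_surjective [Module.Projective Bᵐᵒᵖ M] {f : Y →ₗ[Bᵐᵒᵖ] Y'}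
    (hf : Function.Surjective f) : Function.Surjective (map A M f) := fun g => by
  obtain ⟨h, hh⟩ := Module.projective_lifting_property f (of.symm g) hf
  exact ⟨of h, hh⟩

/-- `Hom_B(M, B^n)` is a power of the dual bimodule. -/
def piEquiv (n : ℕ) :
    HomRight B M (Fin n → Bᵐᵒᵖ) ≃ₗ[Aᵐᵒᵖ] (Fin n → DualBimodule B M) where
  toFun f j := ((opUnopLinearEquiv B).toLinearMap ∘ₗ LinearMap.proj j ∘ₗ of.symm f :
    M →ₗ[Bᵐᵒᵖ] B)
  map_add' _ _ := rfl
  map_smul' _ _ := rfl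
  invFun f := of (LinearMap.pi fun j =>
    (opUnopLinearEquiv B).symm.toLinearMap ∘ₗ (show M →ₗ[Bᵐᵒᵖ] B from f j))
  left_inv _ := rfl
  right_inv _ := rfl

theorem projective_pi [Module.Projective Aᵐᵒᵖ (DualBimodule B M)] (n : ℕ) :
    Module.Projective Aᵐᵒᵖ (HomRight B M (Fin n → Bᵐᵒᵖ)) :=
  Module.Projective.of_equiv (piEquiv n).symm

theorem finite_pi [Module.Finite Aᵐᵒᵖ (DualBimodule B M)] (n : ℕ) :
    Module.Finite Aᵐᵒᵖ (HomRight B M (Fin n → Bᵐᵒᵖ)) :=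
  Module.Finite.equiv (piEquiv n).symm

variable (A M) in
theorem _root_.FactorsThroughFree.homRight_map [Module.Projective Aᵐᵒᵖ (DualBimodule B M)]
    [Module.Finite Aᵐᵒᵖ (DualBimodule B M)] {f : Y →ₗ[Bᵐᵒᵖ] Y'} (hf : FactorsThroughFree f) :
    FactorsThroughFree (map A M f) := by
  obtain ⟨n, i, p, rfl⟩ := hf
  have := projective_pi (A := A) (B := B) (M := M) n
  have := finite_pi (A := A) (B := B) (M := M) n
  exact FactorsThroughFree.of_projective_of_finite (map A M i) (map A M p)

theorem finite [Module.Finite Aᵐᵒᵖ (DualBimodule B M)] [Module.Projective Bᵐᵒᵖ M]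
    [Module.Finite Bᵐᵒᵖ Y] :
    Module.Finite Aᵐᵒᵖ (HomRight B M Y) := by
  obtain ⟨n, f, hf⟩ := Module.Finite.exists_fin' Bᵐᵒᵖ Y
  have := finite_pi (A := A) (B := B) (M := M) n
  exact Module.Finite.of_surjective (map A M f) (map_surjective hf)

end

section

open BalancedTensor

variable {A B M X X' Y Y' : Type*} [Ring A] [Ring B] [AddCommGroup M] [Module Bᵐᵒᵖ M]
  [Module A M] [SMulCommClass A Bᵐᵒᵖ M] [AddCommGroup X] [Module Aᵐᵒᵖ X] [AddCommGroup X']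
  [Module Aᵐᵒᵖ X'] [AddCommGroup Y] [Module Bᵐᵒᵖ Y] [AddCommGroup Y'] [Module Bᵐᵒᵖ Y']

variable (A B M X) in
/-- The unit `X → Hom_B(M, X ⊗_A M)`. -/
def unit : X →ₗ[Aᵐᵒᵖ] HomRight B M (BalancedTensor A X M) where
  toFun x := of (inc B M x)
  map_add' x y := ext fun m => BalancedTensor.add_tmul x y m
  map_smul' a x := ext fun m => BalancedTensor.smul_tmul a.unop x m

@[simp]
theorem unit_apply (x : X) (m : M) : unit A B M X x m = BalancedTensor.tmul A x m := rfl

variable (A B M Y) in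
/-- The counit `Hom_B(M, Y) ⊗_A M → Y`. -/
def counit : BalancedTensor A (HomRight B M Y) M →ₗ[Bᵐᵒᵖ] Y :=
  liftRight (AddMonoidHom.mk' (fun f => (of.symm f).toAddMonoidHom) fun _ _ => rfl)
    (fun _ _ _ => rfl) (fun f b m => apply_smul f b m)

@[simp]
theorem counit_tmul (f : HomRight B M Y) (m : M) :
    counit A B M Y (BalancedTensor.tmul A f m) = f m := rfl

theorem counit_comp_unit :
    counit A B M (BalancedTensor A X M) ∘ₗ mapRight B M (unit A B M X) = LinearMap.id :=
  linearMap_ext fun _ _ => rfl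

theorem map_counit_comp_unit :
    map A M (counit A B M Y) ∘ₗ unit A B M (HomRight B M Y) = LinearMap.id := rfl

theorem counit_natural (f : Y →ₗ[Bᵐᵒᵖ] Y') :
    counit A B M Y' ∘ₗ mapRight B M (map A M f) = f ∘ₗ counit A B M Y :=
  linearMap_ext fun _ _ => rfl

theorem unit_natural (f : X →ₗ[Aᵐᵒᵖ] X') :
    map A M (mapRight B M f) ∘ₗ unit A B M X = unit A B M X' ∘ₗ f := rfl

end

end HomRight

theorem FactorsThroughFree.mapRight {A B M X X' : Type*} [Ring A] [Ring B] [AddCommGroup M]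
    [Module Bᵐᵒᵖ M] [Module A M] [SMulCommClass A Bᵐᵒᵖ M] [AddCommGroup X] [Module Aᵐᵒᵖ X]
    [AddCommGroup X'] [Module Aᵐᵒᵖ X'] [Module.Projective Bᵐᵒᵖ M] [Module.Finite Bᵐᵒᵖ M]
    {f : X →ₗ[Aᵐᵒᵖ] X'} (hf : FactorsThroughFree f) :
    FactorsThroughFree (BalancedTensor.mapRight B M f) := by
  obtain ⟨n, i, p, rfl⟩ := hf
  have := BalancedTensor.projective_right (R := A) (S := B) (X := Fin n → Aᵐᵒᵖ) (M := M)
  have := BalancedTensor.finite_right (R := A) (S := B) (X := Fin n → Aᵐᵒᵖ) (M := M)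
  rw [BalancedTensor.mapRight_comp]
  exact of_projective_of_finite _ _

/-! ## The stable equivalence -/

namespace TensorInducesKatoEquivalence

open BalancedTensor HomRight

variable {A B M : Type u} [Ring A] [Ring B] [AddCommGroup M] [Module A M] [Module Bᵐᵒᵖ M]
  [SMulCommClass A Bᵐᵒᵖ M] [IsNoetherianRing A] [IsNoetherianRing Aᵐᵒᵖ] [Module.Finite Bᵐᵒᵖ M]

/-- A finitely generated module is projective exactly when its identity is stably zero, and stable
faithfulness reflects this. -/
theorem projective_of_tensor (hM : TensorInducesKatoEquivalence A B M) (X : Type u)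
    [AddCommGroup X] [Module Aᵐᵒᵖ X] [Module.Finite Aᵐᵒᵖ X]
    (h : Module.Projective Bᵐᵒᵖ (BalancedTensor A X M)) : Module.Projective Aᵐᵒᵖ X := by
  have := finite_right (R := A) (S := B) (X := X) (M := M)
  refine (hM.stable_faithful LinearMap.id ?_).projective
  rw [mapRight_id]
  exact FactorsThroughFree.id_of_projective

variable [Module.Projective Bᵐᵒᵖ M] [Module.Finite Aᵐᵒᵖ (DualBimodule B M)]
  [Module.Projective Aᵐᵒᵖ (DualBimodule B M)]

/-- The unit is a stable isomorphism. -/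
theorem unit_stable (hM : TensorInducesKatoEquivalence A B M) (X : Type u) [AddCommGroup X]
    [Module Aᵐᵒᵖ X] [Module.Finite Aᵐᵒᵖ X] :
    ∃ g : HomRight B M (BalancedTensor A X M) →ₗ[Aᵐᵒᵖ] X,
      FactorsThroughFree (mapRight B M g - counit A B M (BalancedTensor A X M)) ∧
      FactorsThroughFree (g ∘ₗ unit A B M X - LinearMap.id) ∧
      FactorsThroughFree (unit A B M X ∘ₗ g - LinearMap.id) := by
  have := finite_right (R := A) (S := B) (X := X) (M := M)
  have := HomRight.finite (A := A) (B := B) (M := M) (Y := BalancedTensor A X M)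
  -- The stable inverse of the unit is a stable preimage of the counit at X ⊗_A M. The two triangle
  -- identities turn the single relation g ⊗ M ≡ counit into both inverse relations, one after
  -- precomposing with unit ⊗ M, the other after applying Hom_B(M, −).
  obtain ⟨g, hg⟩ := hM.stable_full (counit A B M (BalancedTensor A X M))
  refine ⟨g, hg, hM.stable_faithful _ ?_, ?_⟩
  · have := hg.comp_right (mapRight B M (unit A B M X))
    rwa [LinearMap.sub_comp, counit_comp_unit, ← mapRight_comp, ← mapRight_id,
      ← mapRight_sub] at this
  · have := (hg.homRight_map A M).comp_right (unit A B M _)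
    rwa [HomRight.map_sub, LinearMap.sub_comp, unit_natural, map_counit_comp_unit] at this

/-- The counit is a stable isomorphism. -/
theorem counit_stable [IsNoetherianRing B] [IsNoetherianRing Bᵐᵒᵖ]
    (hM : TensorInducesKatoEquivalence A B M) (Y : Type u) [AddCommGroup Y]
    [Module Bᵐᵒᵖ Y] [Module.Finite Bᵐᵒᵖ Y] :
    ∃ h : Y →ₗ[Bᵐᵒᵖ] BalancedTensor A (HomRight B M Y) M,
      FactorsThroughFree (counit A B M Y ∘ₗ h - LinearMap.id) ∧
      FactorsThroughFree (h ∘ₗ counit A B M Y - LinearMap.id) := by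
  obtain ⟨X, _, _, _, v, w, hvw, -⟩ := hM.stable_essSurj Y
  obtain ⟨g, hg, -, hug⟩ := hM.unit_stable X
  refine ⟨mapRight B M (HomRight.map A M v) ∘ₗ mapRight B M (unit A B M X) ∘ₗ w, ?_, ?_⟩
  · rwa [← LinearMap.comp_assoc, counit_natural, LinearMap.comp_assoc, ← LinearMap.comp_assoc w,
      counit_comp_unit, LinearMap.id_comp]
  -- At X ⊗_A M the stable inverse of the counit is unit ⊗ M. This is carried to Y by the stable
  -- isomorphisms v and w and naturality.
  · have h1 : FactorsThroughFree
        (mapRight B M (unit A B M X) ∘ₗ counit A B M (BalancedTensor A X M) - LinearMap.id) := by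
      have := (hug.mapRight (B := B) (M := M)).sub (hg.comp_left (mapRight B M (unit A B M X)))
      rwa [mapRight_sub, mapRight_id, LinearMap.comp_sub, mapRight_comp, sub_sub_sub_comm,
        sub_self, zero_sub, neg_sub] at this
    have h2 := (h1.comp_left (mapRight B M (HomRight.map A M v))).comp_right
      (mapRight B M (HomRight.map A M w))
    have h3 := (hvw.homRight_map A M).mapRight (B := B) (M := M)
    have h4 := h2.add h3
    rw [HomRight.map_sub, HomRight.map_id, HomRight.map_comp, mapRight_sub, mapRight_id,
      mapRight_comp, LinearMap.comp_sub, LinearMap.sub_comp, LinearMap.comp_id,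
      sub_add_sub_cancel] at h4
    convert h4 using 2
    rw [LinearMap.comp_assoc, LinearMap.comp_assoc, LinearMap.comp_assoc, LinearMap.comp_assoc,
      counit_natural]

/-- If Hom_B(M, Y) is projective, so is its tensor product with M, through which the identity of Y
passes stably by way of the counit. -/
theorem projective_of_homRight [IsNoetherianRing B] [IsNoetherianRing Bᵐᵒᵖ]
    (hM : TensorInducesKatoEquivalence A B M) (Y : Type u) [AddCommGroup Y]
    [Module Bᵐᵒᵖ Y] [Module.Finite Bᵐᵒᵖ Y] (h : Module.Projective Aᵐᵒᵖ (HomRight B M Y)) :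
    Module.Projective Bᵐᵒᵖ Y := by
  have := HomRight.finite (A := A) (B := B) (M := M) (Y := Y)
  have := BalancedTensor.projective_right (R := A) (S := B) (X := HomRight B M Y) (M := M)
  obtain ⟨g, hg, -⟩ := hM.counit_stable Y
  have h1 := (FactorsThroughFree.of_projective g (counit A B M Y)).sub hg
  rw [sub_sub_cancel] at h1
  exact h1.projective

end TensorInducesKatoEquivalence

/-! ## Rings without regular blocks -/

/-- A von Neumann regular left artinian ring is semisimple. -/
theorem isSemisimpleRing_of_regular (R : Type*) [Ring R] [IsArtinianRing R]
    (h : ∀ x : R, ∃ y, x = x * y * x) : IsSemisimpleRing R := by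
  rw [IsArtinianRing.isSemisimpleRing_iff_jacobson, ← Ideal.jacobson_bot, eq_bot_iff]
  intro x hx
  obtain ⟨y, hy⟩ := h x
  obtain ⟨z, hz⟩ := Ideal.mem_jacobson_iff.1 hx (-y)
  -- For x in the Jacobson radical, 1 − yx is an idempotent with a left inverse, so it equals 1 and
  -- x = xyx = 0.
  have h1 : z * (1 - y * x) = 1 := by
    rw [← sub_eq_zero, ← (Ideal.mem_bot).1 hz]
    noncomm_ring
  have h2 : (1 - y * x) * (1 - y * x) = 1 - y * x := by
    have : y * x * (y * x) = y * x := by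
      rw [mul_assoc, ← mul_assoc x, ← hy]
    rw [mul_sub, sub_mul, sub_mul, this]
    simp
  have h3 : 1 - y * x = 1 := by
    calc 1 - y * x = z * (1 - y * x) * (1 - y * x) := by rw [h1, one_mul]
      _ = 1 := by rw [mul_assoc, h2, h1]
  have h4 : y * x = 0 := by simpa using h3
  rw [Ideal.mem_bot, hy, mul_assoc, h4, mul_zero]

/-- The two-sided ideal of elements annihilated by a central element. -/
def annihilatorIdeal {R : Type*} [Ring R] (e : R) (he : ∀ x, e * x = x * e) : Ideal R where
  carrier := {x | e * x = 0}
  add_mem' {x y} hx hy := by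
    simp only [Set.mem_ofPred_eq] at *
    rw [mul_add, hx, hy, add_zero]
  zero_mem' := mul_zero e
  smul_mem' r x hx := by
    simp only [Set.mem_ofPred_eq, smul_eq_mul] at *
    rw [← mul_assoc, he, mul_assoc, hx, mul_zero]

theorem mem_annihilatorIdeal {R : Type*} [Ring R] {e : R} (he : ∀ x, e * x = x * e) {x : R} :
    x ∈ annihilatorIdeal e he ↔ e * x = 0 := Iff.rfl

instance {R : Type*} [Ring R] (e : R) (he : ∀ x, e * x = x * e) :
    (annihilatorIdeal e he).IsTwoSided where
  mul_mem_of_left {a} b ha := by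
    rw [mem_annihilatorIdeal] at *
    rw [← mul_assoc, ha, zero_mul]

/-- A ring has no regular block if no block is a nonzero von Neumann regular ring. -/
def NoRegularBlock (R : Type*) [Ring R] : Prop :=
  ∀ e : R, e * e = e → (∀ x, e * x = x * e) → (∀ x, ∃ y, e * x = e * x * y * (e * x)) → e = 0

/-- A central idempotent e splits R into R/ann(e) and R/ann(1 − e). The first factor is a copy of
the block eR, which is semisimple when it is regular and artinian. -/
theorem NoSemisimpleSummand.noRegularBlock {R : Type u} [Ring R] [IsArtinianRing R]
    (h : NoSemisimpleSummand R) : NoRegularBlock R := by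
  intro e he hc hr
  have hc' : ∀ x, (1 - e) * x = x * (1 - e) := fun x => by rw [sub_mul, mul_sub, hc]; simp
  let I := annihilatorIdeal e hc
  let J := annihilatorIdeal (1 - e) hc'
  have : IsSemisimpleRing (R ⧸ I) := isSemisimpleRing_of_regular _ fun x => by
    obtain ⟨x, rfl⟩ := Ideal.Quotient.mk_surjective x
    obtain ⟨y, hy⟩ := hr x
    refine ⟨Ideal.Quotient.mk I (y * e), ?_⟩
    rw [← map_mul, ← map_mul, Ideal.Quotient.eq]
    change e * (x - x * (y * e) * x) = 0
    rw [mul_sub, sub_eq_zero]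
    conv_lhs => rw [hy]
    noncomm_ring
  let f : R →+* (R ⧸ I) × (R ⧸ J) := (Ideal.Quotient.mk I).prod (Ideal.Quotient.mk J)
  have hf : Function.Bijective f := by
    constructor
    · rw [injective_iff_map_eq_zero]
      intro x hx
      have h1 : e * x = 0 := Ideal.Quotient.eq_zero_iff_mem.1 (congrArg Prod.fst hx)
      have h2 : (1 - e) * x = 0 := Ideal.Quotient.eq_zero_iff_mem.1 (congrArg Prod.snd hx)
      calc x = e * x + (1 - e) * x := by noncomm_ring
        _ = 0 := by rw [h1, h2, add_zero]
    · rintro ⟨x, y⟩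
      obtain ⟨x, rfl⟩ := Ideal.Quotient.mk_surjective x
      obtain ⟨y, rfl⟩ := Ideal.Quotient.mk_surjective y
      refine ⟨e * x + (1 - e) * y, Prod.ext ?_ ?_⟩
      · refine Ideal.Quotient.eq.2 ?_
        change e * (e * x + (1 - e) * y - x) = 0
        have : e * (e * x + (1 - e) * y - x) = (e * e - e) * x + (e - e * e) * y := by noncomm_ring
        rw [this, he]
        simp
      · refine Ideal.Quotient.eq.2 ?_
        change (1 - e) * (e * x + (1 - e) * y - y) = 0
        have : (1 - e) * (e * x + (1 - e) * y - y) =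
          (e - e * e) * x + (e * e - e) * y := by noncomm_ring
        rw [this, he]
        simp
  have := h (R ⧸ I) (R ⧸ J) (RingEquiv.ofBijective f hf)
  have h1 : (Ideal.Quotient.mk I) 1 = 0 := Subsingleton.elim _ _
  simpa [I, mem_annihilatorIdeal] using Ideal.Quotient.eq_zero_iff_mem.1 h1

theorem NoRegularBlock.mulOpposite {R : Type*} [Ring R] (h : NoRegularBlock R) :
    NoRegularBlock Rᵐᵒᵖ := by
  intro e he hc hr
  refine unop_injective (h e.unop (congrArg unop he) (fun x => (congrArg unop (hc (op x))).symm)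
    fun x => ?_)
  obtain ⟨y, hy⟩ := hr (op x)
  refine ⟨y.unop, ?_⟩
  have h1 := congrArg unop hy
  have h2 : x * e.unop = e.unop * x := congrArg unop (hc (op x))
  simp only [unop_mul] at h1
  rw [show unop (op x) * e.unop = e.unop * x from h2] at h1
  rw [mul_assoc]
  exact h1

/-- If a right ideal of a ring without regular blocks is generated by an idempotent as soon as it
annihilates `L` or fixes `L`, then a two-sided ideal fixing `L` is the whole ring. -/
theorem NoRegularBlock.one_mem {R L : Type*} [Ring R] (h : NoRegularBlock R) [AddCommGroup L]
    [Module R L]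
    (H : ∀ I : AddSubgroup R, (∀ x ∈ I, ∀ y, x * y ∈ I) →
      ((∀ x ∈ I, ∀ l : L, x • l = 0) ∨ AddSubgroup.closure {v : L | ∃ x ∈ I, ∃ l, v = x • l} = ⊤) →
      ∃ f ∈ I, ∀ x ∈ I, f * x = x)
    (J : AddSubgroup R) (hr : ∀ x ∈ J, ∀ y, x * y ∈ J) (hl : ∀ x ∈ J, ∀ y, y * x ∈ J)
    (hJ : AddSubgroup.closure {v : L | ∃ x ∈ J, ∃ l, v = x • l} = ⊤) : 1 ∈ J := by
  -- The left annihilator l of J kills L = JL, so the first alternative of H applies to every right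
  -- ideal inside l.
  let l : AddSubgroup R :=
    { carrier := {x | ∀ j ∈ J, x * j = 0}
      add_mem' := fun {x y} hx hy j hj => by rw [add_mul, hx j hj, hy j hj, add_zero]
      zero_mem' := fun j _ => zero_mul j
      neg_mem' := fun {x} hx j hj => by rw [neg_mul, hx j hj, neg_zero] }
  have lr : ∀ x ∈ l, ∀ y, x * y ∈ l := fun x hx y j hj => by
    rw [mul_assoc, hx _ (hl j hj y)]
  have ll : ∀ x ∈ l, ∀ y, y * x ∈ l := fun x hx y j hj => by
    rw [mul_assoc, hx _ hj, mul_zero]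
  have lL : ∀ x ∈ l, ∀ v : L, x • v = 0 := fun x hx v => by
    have hv : v ∈ AddSubgroup.closure {v : L | ∃ x ∈ J, ∃ l, v = x • l} :=
      hJ ▸ AddSubgroup.mem_top v
    induction hv using AddSubgroup.closure_induction with
    | mem v hv =>
      obtain ⟨j, hj, w, rfl⟩ := hv
      rw [← mul_smul, hx j hj, zero_smul]
    | zero => exact smul_zero x
    | add v w _ _ hv hw => rw [smul_add, hv, hw, add_zero]
    | neg v _ hv => rw [smul_neg, hv, neg_zero]
  have reg : ∀ x ∈ l, ∃ y, x = x * y * x := fun x hx => by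
    obtain ⟨_, ⟨y, rfl⟩, hf⟩ := H (AddMonoidHom.mulLeft x).range
      (by rintro _ ⟨y, rfl⟩ z; exact ⟨y * z, (mul_assoc x y z).symm⟩)
      (Or.inl (by rintro _ ⟨y, rfl⟩ v; exact lL _ (lr x hx y) v))
    exact ⟨y, (hf x ⟨1, mul_one x⟩).symm⟩
  obtain ⟨f, hf, hfl⟩ := H l lr (Or.inl lL)
  have hff := hfl f hf
  have key : ∀ w, (1 - f) * w * f = 0 := fun w => by
    rw [mul_assoc, sub_mul, one_mul, hfl _ (ll f hf w), sub_self]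
  -- The element z = f w (1 − f) lies in l, so z = z y z for some y, and z y z contains (1 − f) y f
  -- = 0. Together with `key` this makes f central, so fR is a regular block and f = 0.
  have key' : ∀ w, f * w * (1 - f) = 0 := fun w => by
    obtain ⟨y, hy⟩ := reg _ (lr f hf (w * (1 - f)))
    rw [mul_assoc, hy]
    calc f * (w * (1 - f)) * y * (f * (w * (1 - f)))
        = f * w * ((1 - f) * y * f) * (w * (1 - f)) := by noncomm_ring
      _ = 0 := by rw [key]; simp
  have f0 : f = 0 := h f hff (fun x => by
      have h1 := key x
      have h2 := key' x
      rw [sub_mul, sub_mul, one_mul, sub_eq_zero] at h1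
      rw [mul_sub, mul_one, sub_eq_zero] at h2
      rw [h2, h1]) fun x => reg _ (lr f hf x)
  -- Since l = fR = 0, the left identity g of J, for which 1 − g lies in l, must be 1.
  obtain ⟨g, hg, hgJ⟩ := H J hr (Or.inr hJ)
  have h1 : 1 - g ∈ l := fun j hj => by rw [sub_mul, one_mul, hgJ j hj, sub_self]
  have h2 := hfl _ h1
  rw [f0, zero_mul, eq_comm, sub_eq_zero] at h2
  rwa [h2]

/-- A section s of R → R/I yields f = 1 − s(1), because s(1) x = s(x) = 0 for x in I. -/
theorem exists_right_identity {R : Type*} [Ring R] (I : Submodule Rᵐᵒᵖ R)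
    [Module.Projective Rᵐᵒᵖ (R ⧸ I)] : ∃ f ∈ I, ∀ x ∈ I, f * x = x := by
  obtain ⟨s, hs⟩ := Module.projective_lifting_property I.mkQ LinearMap.id I.mkQ_surjective
  refine ⟨1 - s (I.mkQ 1), ?_, fun x hx => ?_⟩
  · rw [← Submodule.Quotient.mk_eq_zero]
    have := LinearMap.congr_fun hs (I.mkQ 1)
    simp only [LinearMap.comp_apply, LinearMap.id_apply] at this
    change I.mkQ (1 - s (I.mkQ 1)) = 0
    rw [map_sub, this, sub_self]
  · have : s (I.mkQ 1) * x = 0 := by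
      have h1 : op x • I.mkQ 1 = 0 := by
        rw [← map_smul]
        simpa using hx
      have h2 : s (op x • I.mkQ 1) = s (I.mkQ 1) * x := map_smul s (op x) _
      rw [← h2, h1, map_zero]
    rw [sub_mul, this, one_mul, sub_zero]

/-! ## Trace ideals -/

theorem AddMonoidHom.exists_sum_of_mem_closure {P Q G : Type*} [AddCommGroup P] [AddCommGroup Q]
    [AddCommGroup G] (f : P →+ Q →+ G) {x : G}
    (hx : x ∈ AddSubgroup.closure {v | ∃ p q, v = f p q}) :
    ∃ (n : ℕ) (p : Fin n → P) (q : Fin n → Q), x = ∑ j, f (p j) (q j) := by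
  induction hx using AddSubgroup.closure_induction with
  | mem v hv =>
    obtain ⟨p, q, rfl⟩ := hv
    exact ⟨1, fun _ => p, fun _ => q, by simp⟩
  | zero => exact ⟨0, Fin.elim0, Fin.elim0, by simp⟩
  | add v w _ _ hv hw =>
    obtain ⟨n, p, q, rfl⟩ := hv
    obtain ⟨n', p', q', rfl⟩ := hw
    exact ⟨n + n', Fin.append p p', Fin.append q q', by simp [Fin.sum_univ_add]⟩
  | neg v _ hv =>
    obtain ⟨n, p, q, rfl⟩ := hv
    exact ⟨n, fun j => - p j, q, by simp⟩

namespace TensorInducesKatoEquivalence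

open BalancedTensor HomRight

variable {A B M : Type u} [Ring A] [Ring B] [AddCommGroup M] [Module A M] [Module Bᵐᵒᵖ M]
  [SMulCommClass A Bᵐᵒᵖ M] [IsNoetherianRing A] [IsNoetherianRing Aᵐᵒᵖ] [Module.Finite Bᵐᵒᵖ M]
  [Module.Projective Bᵐᵒᵖ M]

/-- `M` is a generator of left `A`-modules. -/
theorem exists_left_trace (hM : TensorInducesKatoEquivalence A B M) (hA : NoRegularBlock A)
    [Module.Finite A M] [Module.Projective A M] :
    ∃ (n : ℕ) (m : Fin n → M) (φ : Fin n → M →ₗ[A] A), ∑ j, φ j (m j) = 1 := by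
  let ev : (M →ₗ[A] A) →+ M →+ A :=
    AddMonoidHom.mk' LinearMap.toAddMonoidHom fun _ _ => rfl
  suffices h1 : (1 : A) ∈ AddSubgroup.closure {v | ∃ p q, v = ev p q} by
    obtain ⟨n, φ, m, h⟩ := ev.exists_sum_of_mem_closure h1
    exact ⟨n, m, φ, h.symm⟩
  refine hA.one_mem (L := M) (fun I hI hIL => ?_) _ (fun x hx y => ?_) (fun x hx y => ?_)
    (eq_top_iff.2 fun v _ => ?_)
  · let I' : Submodule Aᵐᵒᵖ A := { I with smul_mem' := fun r x hx => hI x hx r.unop }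
    have hI' : ∀ x, I'.mkQ x = 0 ↔ x ∈ I := fun x => by simp [I']
    -- This tensor product is M/IM, which is M in the first case and 0 in the second.
    have hp : Module.Projective Bᵐᵒᵖ (BalancedTensor A (A ⧸ I') M) := by
      rcases hIL with h0 | h1
      · let i : BalancedTensor A (A ⧸ I') M →ₗ[Bᵐᵒᵖ] M := liftRight
          (QuotientAddGroup.lift I'.toAddSubgroup
            (AddMonoidHom.mk' (fun a => DistribSMul.toAddMonoidHom M a)
              fun a b => AddMonoidHom.ext fun m => add_smul a b m)
            fun x hx => AddMonoidHom.ext fun m => h0 x hx m)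
          (fun x r m => by
            obtain ⟨x, rfl⟩ := I'.mkQ_surjective x
            exact mul_smul x r m)
          (fun x b m => by
            obtain ⟨x, rfl⟩ := I'.mkQ_surjective x
            exact smul_comm x b m)
        refine Module.Projective.of_split i (inc B M (I'.mkQ 1)) (linearMap_ext fun x m => ?_)
        obtain ⟨x, rfl⟩ := I'.mkQ_surjective x
        change tmul A (I'.mkQ 1) (x • m) = tmul A (I'.mkQ x) m
        rw [← BalancedTensor.smul_tmul, ← map_smul]
        simp
      · have h2 : ∀ m : M, tmul A (I'.mkQ 1) m = 0 := fun m => by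
          have hm := h1 ▸ AddSubgroup.mem_top m
          induction hm using AddSubgroup.closure_induction with
          | mem v hv =>
            obtain ⟨x, hx, l, rfl⟩ := hv
            rw [← BalancedTensor.smul_tmul, ← map_smul]
            have : I'.mkQ (op x • 1) = 0 := (hI' _).2 (by simpa using hx)
            rw [this, BalancedTensor.zero_tmul]
          | zero => exact BalancedTensor.tmul_zero _
          | add v w _ _ hv hw => rw [BalancedTensor.tmul_add, hv, hw, add_zero]
          | neg v _ hv => exact (map_neg (mk A _ M (I'.mkQ 1)) v).trans (neg_eq_zero.2 hv)
        have : Subsingleton (BalancedTensor A (A ⧸ I') M) := subsingleton_of_forall_eq 0 fun t => by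
          induction t using BalancedTensor.induction_on with
          | zero => rfl
          | tmul x m =>
            obtain ⟨x, rfl⟩ := I'.mkQ_surjective x
            have h3 : I'.mkQ x = op x • I'.mkQ 1 := by rw [← map_smul]; simp
            rw [h3, BalancedTensor.smul_tmul, h2]
          | add a b ha hb => rw [ha, hb, add_zero]
        infer_instance
    have := hM.projective_of_tensor (A ⧸ I') hp
    exact exists_right_identity I'
  · induction hx using AddSubgroup.closure_induction with
    | mem v hv =>
      obtain ⟨φ, m, rfl⟩ := hv
      exact AddSubgroup.subset_closure ⟨LinearMap.toSpanSingleton A A y ∘ₗ φ, m, rfl⟩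
    | zero => rw [zero_mul]; exact zero_mem _
    | add v w _ _ hv hw => rw [add_mul]; exact add_mem hv hw
    | neg v _ hv => rw [neg_mul]; exact neg_mem hv
  · induction hx using AddSubgroup.closure_induction with
    | mem v hv =>
      obtain ⟨φ, m, rfl⟩ := hv
      exact AddSubgroup.subset_closure ⟨φ, y • m, (map_smul φ y m).symm⟩
    | zero => rw [mul_zero]; exact zero_mem _
    | add v w _ _ hv hw => rw [mul_add]; exact add_mem hv hw
    | neg v _ hv => rw [mul_neg]; exact neg_mem hv
  · obtain ⟨n, m, φ, h⟩ := exists_dual_basis A M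
    rw [← h v]
    exact sum_mem fun j _ => AddSubgroup.subset_closure
      ⟨_, AddSubgroup.subset_closure ⟨φ j, v, rfl⟩, _, rfl⟩

/-- The evaluation map `N ⊗_A M → B` is surjective. -/
theorem exists_evaluation [IsNoetherianRing B] [IsNoetherianRing Bᵐᵒᵖ]
    [Module.Finite Aᵐᵒᵖ (DualBimodule B M)] [Module.Projective Aᵐᵒᵖ (DualBimodule B M)]
    (hM : TensorInducesKatoEquivalence A B M) (hB : NoRegularBlock B) :
    ∃ (n : ℕ) (m : Fin n → M) (ν : Fin n → DualBimodule B M), ∑ j, ν j (m j) = 1 := by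
  let ev : DualBimodule B M →+ M →+ B :=
    AddMonoidHom.mk' LinearMap.toAddMonoidHom fun _ _ => rfl
  obtain ⟨n, m, ξ, hξ⟩ := exists_right_dual_basis B M
  have hξ' : ∀ f : DualBimodule B M, f = ∑ j, f (m j) • (show DualBimodule B M from ξ j) :=
    fun f => LinearMap.ext (f := f) fun v => by
      conv_lhs => rw [← hξ v]
      refine (map_sum (show M →ₗ[Bᵐᵒᵖ] B from f) _ _).trans ?_
      refine Eq.trans ?_ (LinearMap.sum_apply Finset.univ (fun j => f (m j) • ξ j) v).symm
      exact Finset.sum_congr rfl fun j _ =>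
        map_smul (show M →ₗ[Bᵐᵒᵖ] B from f) (op (ξ j v)) (m j)
  suffices h1 : (1 : B) ∈ AddSubgroup.closure {v | ∃ p q, v = ev p q} by
    obtain ⟨n, φ, m, h⟩ := ev.exists_sum_of_mem_closure h1
    exact ⟨n, m, φ, h.symm⟩
  refine hB.one_mem (L := DualBimodule B M) (fun I hI hIL => ?_) _ (fun x hx y => ?_)
    (fun x hx y => ?_) (eq_top_iff.2 fun v _ => ?_)
  · let I' : Submodule Bᵐᵒᵖ B := { I with smul_mem' := fun r x hx => hI x hx r.unop }
    have hI' : ∀ x, I'.mkQ x = 0 ↔ x ∈ I := fun x => by simp [I']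
    have hs : Function.Surjective (HomRight.map A M I'.mkQ) := map_surjective I'.mkQ_surjective
    -- Since Hom_B(M, I) = IN, the module Hom_B(M, B/I) is N if IN = 0, and 0 if IN = N.
    have hp : Module.Projective Aᵐᵒᵖ (HomRight B M (B ⧸ I')) := by
      rcases hIL with h0 | h1
      · have hP : Module.Projective Aᵐᵒᵖ (HomRight B M B) :=
          inferInstanceAs (Module.Projective Aᵐᵒᵖ (DualBimodule B M))
        refine Module.Projective.of_equiv (LinearEquiv.ofBijective (HomRight.map A M I'.mkQ)
          ⟨(injective_iff_map_eq_zero _).2 fun f hf => ?_, hs⟩)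
        have hf' : ∀ v, f v ∈ I := fun v => (hI' _).1 (DFunLike.congr_fun hf v)
        refine (hξ' f).trans (Finset.sum_eq_zero fun j _ => h0 _ (hf' (m j)) _)
      · have h2 : ∀ (f : DualBimodule B M) (v : M), f v ∈ I := fun f v => by
          have hm := h1 ▸ AddSubgroup.mem_top f
          induction hm using AddSubgroup.closure_induction with
          | mem f hf =>
            obtain ⟨x, hx, l, rfl⟩ := hf
            exact hI x hx (l v)
          | zero => exact zero_mem I
          | add f g _ _ hf hg => exact add_mem hf hg
          | neg f _ hf => exact neg_mem hf
        have : Subsingleton (HomRight B M (B ⧸ I')) := subsingleton_of_forall_eq 0 fun f => by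
          obtain ⟨f, rfl⟩ := hs f
          exact HomRight.ext fun v => (hI' _).2 (h2 f v)
        infer_instance
    have := hM.projective_of_homRight (B ⧸ I') hp
    exact exists_right_identity I'
  · induction hx using AddSubgroup.closure_induction with
    | mem v hv =>
      obtain ⟨f, m, rfl⟩ := hv
      exact AddSubgroup.subset_closure ⟨f, op y • m,
        (map_smul (show M →ₗ[Bᵐᵒᵖ] B from f) (op y) m).symm⟩
    | zero => rw [zero_mul]; exact zero_mem _
    | add v w _ _ hv hw => rw [add_mul]; exact add_mem hv hw
    | neg v _ hv => rw [neg_mul]; exact neg_mem hv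
  · induction hx using AddSubgroup.closure_induction with
    | mem v hv =>
      obtain ⟨f, m, rfl⟩ := hv
      exact AddSubgroup.subset_closure ⟨y • f, m, rfl⟩
    | zero => rw [mul_zero]; exact zero_mem _
    | add v w _ _ hv hw => rw [mul_add]; exact add_mem hv hw
    | neg v _ hv => rw [mul_neg]; exact neg_mem hv
  · rw [hξ' v]
    exact sum_mem fun j _ => AddSubgroup.subset_closure
      ⟨_, AddSubgroup.subset_closure ⟨v, m j, rfl⟩, _, rfl⟩

end TensorInducesKatoEquivalence

/-- Multiplication by a column of elements of `R`, as a map of right modules. -/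
def mulColumn {R : Type*} [Ring R] {n : ℕ} (a : Fin n → R) : R →ₗ[Rᵐᵒᵖ] (Fin n → R) where
  toFun x j := a j * x
  map_add' _ _ := funext fun _ => mul_add _ _ _
  map_smul' r x := funext fun j => (mul_assoc (a j) x r.unop).symm

/-- If the cokernel of a column is projective then its entries have a common right identity. -/
theorem exists_mul_eq_of_projective_coker {R : Type*} [Ring R] {n : ℕ} (a : Fin n → R)
    [Module.Projective Rᵐᵒᵖ ((Fin n → R) ⧸ LinearMap.range (mulColumn a))] :
    ∃ b : Fin n → R, ∀ i, a i * ∑ j, b j * a j = a i := by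
  let I := LinearMap.range (mulColumn a)
  obtain ⟨s, hs⟩ := Module.projective_lifting_property I.mkQ LinearMap.id I.mkQ_surjective
  have h1 : ∀ v, v - s (I.mkQ v) ∈ I := fun v => by
    rw [← Submodule.Quotient.mk_eq_zero]
    change I.mkQ (v - s (I.mkQ v)) = 0
    have : I.mkQ (s (I.mkQ v)) = I.mkQ v := LinearMap.congr_fun hs (I.mkQ v)
    rw [map_sub, this, sub_self]
  -- The projection v ↦ v − s(v) onto the range of the column sends the j-th basis vector to a bⱼ.
  -- It fixes a, which lies in the range; expanding a in the basis gives a = ∑ a bⱼ aⱼ.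
  choose b hb using fun j => h1 (Pi.single j 1)
  have h2 : a = ∑ j, op (a j) • (Pi.single j 1 : Fin n → R) := by
    ext i
    simp [Finset.sum_apply, Pi.single_apply]
  have h3 : I.mkQ a = 0 := by
    refine (Submodule.Quotient.mk_eq_zero _).2 ⟨1, ?_⟩
    ext j; simp [mulColumn]
  have h4 : a = ∑ j, op (a j) • mulColumn a (b j) := by
    simp_rw [hb, smul_sub, Finset.sum_sub_distrib, ← map_smul, ← map_sum]
    rw [← h2, h3, map_zero, sub_zero]
  refine ⟨b, fun i => ?_⟩
  conv_rhs => rw [h4]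
  rw [Finset.mul_sum, Finset.sum_apply]
  exact Finset.sum_congr rfl fun j _ => (mul_assoc _ _ _).symm

/-! ### The trace ideal of the dual bimodule over A -/

namespace TensorInducesKatoEquivalence

open BalancedTensor HomRight

variable {A B M : Type u} [Ring A] [Ring B] [AddCommGroup M] [Module A M] [Module Bᵐᵒᵖ M]
  [SMulCommClass A Bᵐᵒᵖ M] [Module.Projective Bᵐᵒᵖ M]

/-- Viewing a as the map M → Mⁿ, the hypothesis reads a ρ a = a. Hence aρ is an idempotent with the
same image as a, and the cokernel of a is the image of 1 − aρ, a summand of Mⁿ. -/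
theorem _root_.BalancedTensor.projective_coker_mulColumn {n : ℕ} (a : Fin n → A)
    (ρ : (Fin n → M) →ₗ[Bᵐᵒᵖ] M) (h : ∀ m j, a j • ρ (fun l => a l • m) = a j • m) :
    Module.Projective Bᵐᵒᵖ
      (BalancedTensor A ((Fin n → A) ⧸ LinearMap.range (mulColumn a)) M) := by
  let I := LinearMap.range (mulColumn a)
  let i0 : (Fin n → M) →ₗ[Bᵐᵒᵖ] (Fin n → M) :=
    LinearMap.id - LinearMap.pi (fun j => (Module.toModuleEnd Bᵐᵒᵖ (S := A) M (a j)) ∘ₗ ρ)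
  have hi0 : ∀ v j, i0 v j = v j - a j • ρ v := fun v j => rfl
  let i : BalancedTensor A ((Fin n → A) ⧸ I) M →ₗ[Bᵐᵒᵖ] (Fin n → M) := liftRight
    (QuotientAddGroup.lift I.toAddSubgroup
      (AddMonoidHom.mk' (fun v => i0.toAddMonoidHom.comp
          (AddMonoidHom.mk' (fun m j => v j • m) fun m m' => funext fun j => smul_add _ _ _))
        fun v w => AddMonoidHom.ext fun m => by
          refine Eq.trans ?_ (map_add i0 (fun j => v j • m) (fun j => w j • m))
          exact congrArg i0 (funext fun j => add_smul _ _ _))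
      (by
        rintro _ ⟨x, rfl⟩
        refine AddMonoidHom.ext fun m => funext fun j => ?_
        change i0 (fun l => (a l * x) • m) j = 0
        simp_rw [hi0, mul_smul, h, sub_self]))
    (fun x r m => by
      obtain ⟨x, rfl⟩ := I.mkQ_surjective x
      exact congrArg i0 (funext fun j => mul_smul (x j) r m))
    (fun x b m => by
      obtain ⟨x, rfl⟩ := I.mkQ_surjective x
      refine Eq.trans ?_ (map_smul i0 b (fun j => x j • m))
      exact congrArg i0 (funext fun j => smul_comm (x j) b m))
  let p : (Fin n → M) →ₗ[Bᵐᵒᵖ] BalancedTensor A ((Fin n → A) ⧸ I) M :=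
    ∑ j, inc B M (I.mkQ (Pi.single j 1)) ∘ₗ LinearMap.proj j
  have hp : ∀ (x : Fin n → A) (m : M), p (fun j => x j • m) = tmul A (I.mkQ x) m := fun x m => by
    have : x = ∑ j, op (x j) • (Pi.single j 1 : Fin n → A) := by
      ext i
      simp [Finset.sum_apply, Pi.single_apply]
    conv_rhs => rw [this, map_sum, BalancedTensor.sum_tmul]
    rw [LinearMap.sum_apply]
    refine Finset.sum_congr rfl fun j _ => ?_
    rw [map_smul]
    exact (BalancedTensor.smul_tmul _ _ _).symm
  refine Module.Projective.of_split i p (linearMap_ext fun x m => ?_)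
  obtain ⟨x, rfl⟩ := I.mkQ_surjective x
  change p (i0 fun j => x j • m) = tmul A (I.mkQ x) m
  have h0 : I.mkQ a = 0 := by
    refine (Submodule.Quotient.mk_eq_zero _).2 ⟨1, ?_⟩
    ext j; simp [mulColumn]
  have h1 : i0 (fun j => x j • m) = (fun j => x j • m) - fun j => a j • ρ (fun j => x j • m) := rfl
  rw [h1, _root_.map_sub, hp, hp, h0, BalancedTensor.zero_tmul, sub_zero]

/-- `N` is a generator of right `A`-modules. -/
theorem exists_right_trace [IsNoetherianRing A] [IsNoetherianRing Aᵐᵒᵖ] [Module.Finite Bᵐᵒᵖ M]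
    [Module.Finite Aᵐᵒᵖ (DualBimodule B M)] [Module.Projective Aᵐᵒᵖ (DualBimodule B M)]
    (hM : TensorInducesKatoEquivalence A B M) (hA : NoRegularBlock A) :
    ∃ (n : ℕ) (ν : Fin n → DualBimodule B M) (ψ : Fin n → DualBimodule B M →ₗ[Aᵐᵒᵖ] A),
      ∑ j, ψ j (ν j) = 1 := by
  let ev : (DualBimodule B M →ₗ[Aᵐᵒᵖ] A) →+ DualBimodule B M →+ Aᵐᵒᵖ :=
    AddMonoidHom.mk' (fun ψ => opAddEquiv.toAddMonoidHom.comp ψ.toAddMonoidHom) fun _ _ => rfl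
  suffices h1 : (1 : Aᵐᵒᵖ) ∈ AddSubgroup.closure {v | ∃ p q, v = ev p q} by
    obtain ⟨n, φ, m, h⟩ := ev.exists_sum_of_mem_closure h1
    refine ⟨n, m, φ, op_injective ?_⟩
    rw [Finset.op_sum]
    exact h.symm
  obtain ⟨n, m, ξ, hξ⟩ := exists_right_dual_basis B M
  refine hA.mulOpposite.one_mem (L := DualBimodule B M) (fun I hI hIL => ?_) _ (fun x hx y => ?_)
    (fun x hx y => ?_) (eq_top_iff.2 fun v _ => ?_)
  -- A right ideal of Aᵐᵒᵖ is a left ideal of A, whereas the stable functor is defined on right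
  -- modules. The ideal therefore enters through the column a of its generators, whose cokernel
  -- Aᵏ/aA is a right module.
  · let I' : Submodule A A :=
      { carrier := {a | op a ∈ I}
        add_mem' := fun ha hb => add_mem (S := AddSubgroup Aᵐᵒᵖ) ha hb
        zero_mem' := zero_mem I
        smul_mem' := fun r x hx => hI (op x) hx (op r) }
    obtain ⟨k, a, ha⟩ := Submodule.fg_iff_exists_fin_generating_family.1
      (IsNoetherian.noetherian I')
    have haI : ∀ j, op (a j) ∈ I := fun j => by
      have : a j ∈ I' := ha ▸ Submodule.subset_span ⟨j, rfl⟩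
      exact this
    -- If NI = 0 then each aⱼ kills M, since linear forms separate its points, and ρ = 0 works. If
    -- NI = N then every coordinate form of M is a combination of forms v ↦ ν(aₗ v), so v can be
    -- recovered linearly from the tuple of all aₗ v.
    have hρ : ∃ ρ : (Fin k → M) →ₗ[Bᵐᵒᵖ] M, ∀ m j, a j • ρ (fun l => a l • m) = a j • m := by
      rcases hIL with h0 | h1
      · refine ⟨0, fun v j => ?_⟩
        have h2 : ∀ f : M →ₗ[Bᵐᵒᵖ] B, f (a j • v) = 0 := fun f =>
          DFunLike.congr_fun (h0 (op (a j)) (haI j) (show DualBimodule B M from f)) v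
        rw [← hξ (a j • v)]
        simp [h2]
      · have h2 : ∀ f : DualBimodule B M, ∃ ν : Fin k → DualBimodule B M,
            f = ∑ j, op (a j) • ν j := fun f => by
          have hm := h1 ▸ AddSubgroup.mem_top f
          induction hm using AddSubgroup.closure_induction with
          | mem f hf =>
            obtain ⟨x, hx, l, rfl⟩ := hf
            have hx' : x.unop ∈ Submodule.span A (Set.range a) := ha ▸ hx
            obtain ⟨c, hc⟩ := (Submodule.mem_span_range_iff_exists_fun _).1 hx'
            refine ⟨fun j => op (c j) • l, ?_⟩
            simp_rw [← mul_smul, ← Finset.sum_smul, ← op_mul]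
            rw [← Finset.op_sum]
            simp_rw [smul_eq_mul] at hc
            rw [hc, op_unop]
          | zero => exact ⟨0, by simp⟩
          | add f g _ _ hf hg =>
            obtain ⟨ν, rfl⟩ := hf
            obtain ⟨ν', rfl⟩ := hg
            exact ⟨ν + ν', by simp [Finset.sum_add_distrib]⟩
          | neg f _ hf =>
            obtain ⟨ν, rfl⟩ := hf
            exact ⟨-ν, by simp⟩
        choose ν hν using fun i => h2 (show DualBimodule B M from ξ i)
        let r : Fin n → (Fin k → M) →ₗ[Bᵐᵒᵖ] B := fun i =>
          ∑ l, (show M →ₗ[Bᵐᵒᵖ] B from ν i l) ∘ₗ LinearMap.proj l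
        refine ⟨∑ i, { toFun := fun y => op (r i y) • m i
                       map_add' := fun y z => by rw [map_add, MulOpposite.op_add, add_smul]
                       map_smul' := fun b y => by
                         rw [map_smul, RingHom.id_apply, ← mul_smul]
                         rfl }, fun v j => congrArg _ ?_⟩
        conv_rhs => rw [← hξ v]
        rw [LinearMap.sum_apply]
        refine Finset.sum_congr rfl fun i _ => ?_
        change op (r i fun l => a l • v) • m i = _
        refine congrArg (fun b : B => op b • m i) (Eq.trans (b := r i fun l => a l • v) rfl ?_)
        rw [LinearMap.sum_apply]
        refine Eq.trans ?_ (DFunLike.congr_fun (hν i) v).symm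
        exact (LinearMap.sum_apply Finset.univ
          (fun l => (show M →ₗ[Bᵐᵒᵖ] B from op (a l) • ν i l)) v).symm
    obtain ⟨ρ, hρ⟩ := hρ
    have := projective_coker_mulColumn a ρ hρ
    have := hM.projective_of_tensor ((Fin k → A) ⧸ LinearMap.range (mulColumn a)) this
    obtain ⟨b, hb⟩ := exists_mul_eq_of_projective_coker a
    refine ⟨op (∑ j, b j * a j), ?_, fun x hx => ?_⟩
    · rw [Finset.op_sum]
      exact sum_mem fun j _ => hI _ (haI j) (op (b j))
    · have hx' : x.unop ∈ Submodule.span A (Set.range a) := ha ▸ hx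
      refine unop_injective ?_
      change x.unop * _ = _
      generalize x.unop = y at hx'
      induction hx' using Submodule.span_induction with
      | mem y hy => obtain ⟨i, rfl⟩ := hy; exact hb i
      | zero => simp
      | add y z _ _ hy hz => rw [add_mul, hy, hz]
      | smul c y _ hy => rw [smul_eq_mul, mul_assoc, hy]
  · induction hx using AddSubgroup.closure_induction with
    | mem v hv =>
      obtain ⟨φ, m, rfl⟩ := hv
      exact AddSubgroup.subset_closure ⟨y.unop • φ, m, rfl⟩
    | zero => rw [zero_mul]; exact zero_mem _
    | add v w _ _ hv hw => rw [add_mul]; exact add_mem hv hw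
    | neg v _ hv => rw [neg_mul]; exact neg_mem hv
  · induction hx using AddSubgroup.closure_induction with
    | mem v hv =>
      obtain ⟨φ, m, rfl⟩ := hv
      exact AddSubgroup.subset_closure ⟨φ, y • m, congrArg op (map_smul φ y m).symm⟩
    | zero => rw [mul_zero]; exact zero_mem _
    | add v w _ _ hv hw => rw [mul_add]; exact add_mem hv hw
    | neg v _ hv => rw [mul_neg]; exact neg_mem hv
  · obtain ⟨n, x, ξ, h⟩ := exists_right_dual_basis A (DualBimodule B M)
    rw [← h v]
    exact sum_mem fun j _ => AddSubgroup.subset_closure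
      ⟨_, AddSubgroup.subset_closure ⟨ξ j, v, rfl⟩, _, rfl⟩

end TensorInducesKatoEquivalence

/-! ## Projectivity from projectivity modulo a nilpotent ideal -/

section

variable {Λ R : Type*} [Ring Λ] [Ring R] [Module Λ R]
  {C F : Type*} [AddCommGroup C] [Module R C] [Module Λ C] [IsScalarTower Λ R C]
  [AddCommGroup F] [Module R F] [Module Λ F] [IsScalarTower Λ R F]

variable (R) in
/-- An ideal `I` of `Λ` is normal in `R` if `R I ⊆ I R`. -/
def Ideal.IsNormalIn (I : Ideal Λ) : Prop :=
  ∀ x : R, ∀ j ∈ I, x * (j • (1 : R)) ∈ I • (⊤ : Submodule Λ R)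

/-- The submodule `I C` of an `R`-module `C`. -/
def Ideal.IsNormalIn.smulTop {I : Ideal Λ} (hI : I.IsNormalIn R) (C : Type*) [AddCommGroup C]
    [Module R C] [Module Λ C] [IsScalarTower Λ R C] : Submodule R C :=
  { (I • (⊤ : Submodule Λ C)).toAddSubmonoid with
    smul_mem' := fun x c hc => by
      change x • c ∈ I • (⊤ : Submodule Λ C)
      replace hc : c ∈ I • (⊤ : Submodule Λ C) := hc
      refine Submodule.smul_induction_on hc (fun j hj c _ => ?_) fun c d hc hd => ?_
      · have h1 : x • j • c = ((LinearMap.toSpanSingleton R C c).restrictScalars Λ)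
            (x * (j • (1 : R))) := by
          simp [mul_smul]
        rw [h1]
        have := Submodule.mem_map_of_mem
          (f := (LinearMap.toSpanSingleton R C c).restrictScalars Λ) (hI x j hj)
        rw [Submodule.map_smul''] at this
        exact Submodule.smul_mono le_rfl le_top this
      · rw [smul_add]; exact add_mem hc hd }

theorem Ideal.IsNormalIn.mem_smulTop {I : Ideal Λ} (hI : I.IsNormalIn R) {c : C} :
    c ∈ hI.smulTop C ↔ c ∈ I • (⊤ : Submodule Λ C) := Iff.rfl

theorem Submodule.map_mem_smul_top (I : Ideal Λ) (f : C →ₗ[Λ] F) {c : C}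
    (hc : c ∈ I • (⊤ : Submodule Λ C)) : f c ∈ I • (⊤ : Submodule Λ F) := by
  have := Submodule.mem_map_of_mem (f := f) hc
  rw [Submodule.map_smul''] at this
  exact Submodule.smul_mono le_rfl le_top this

theorem Ideal.IsNormalIn.smulTop_le_comap {I : Ideal Λ} (hI : I.IsNormalIn R) (f : C →ₗ[R] F) :
    hI.smulTop C ≤ (hI.smulTop F).comap f := fun _ hc =>
  Submodule.map_mem_smul_top I (f.restrictScalars Λ) hc

/-- Reduction modulo `I` of a linear map. -/
def Ideal.IsNormalIn.mapQ {I : Ideal Λ} (hI : I.IsNormalIn R) (f : C →ₗ[R] F) :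
    (C ⧸ hI.smulTop C) →ₗ[R] (F ⧸ hI.smulTop F) :=
  (hI.smulTop C).mapQ (hI.smulTop F) f (hI.smulTop_le_comap f)

/-- Reduction modulo `I` of an endomorphism. -/
def Ideal.IsNormalIn.endHom {I : Ideal Λ} (hI : I.IsNormalIn R) :
    Module.End R F →+* Module.End R (F ⧸ hI.smulTop F) where
  toFun f := hI.mapQ f
  map_one' := LinearMap.ext fun x => by
    obtain ⟨x, rfl⟩ := Submodule.Quotient.mk_surjective _ x; rfl
  map_mul' f g := LinearMap.ext fun x => by
    obtain ⟨x, rfl⟩ := Submodule.Quotient.mk_surjective _ x; rfl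
  map_zero' := LinearMap.ext fun x => by
    obtain ⟨x, rfl⟩ := Submodule.Quotient.mk_surjective _ x; rfl
  map_add' f g := LinearMap.ext fun x => by
    obtain ⟨x, rfl⟩ := Submodule.Quotient.mk_surjective _ x; rfl

/-- Nakayama's lemma; as I is nilpotent, iterating the approximation suffices and C need not be
finitely generated. -/
theorem Submodule.eq_top_of_sup_smul_top {I : Ideal Λ} (hnil : IsNilpotent I) (X : Submodule Λ C)
    (h : ∀ c, ∃ x ∈ X, c - x ∈ I • (⊤ : Submodule Λ C)) : X = ⊤ := by
  obtain ⟨m, hm⟩ := hnil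
  have key : ∀ m c, ∃ x ∈ X, c - x ∈ (I ^ m) • (⊤ : Submodule Λ C) := by
    intro m
    induction m with
    | zero => intro c; exact ⟨0, zero_mem _, by
      rw [Submodule.pow_zero, Submodule.one_smul]; trivial⟩
    | succ m ih =>
      have h1 : ∀ d ∈ (I ^ m) • (⊤ : Submodule Λ C),
          ∃ x ∈ X, d - x ∈ (I ^ (m + 1)) • (⊤ : Submodule Λ C) := by
        intro d hd
        refine Submodule.smul_induction_on hd (fun j hj c _ => ?_) fun c d hc hd => ?_
        · obtain ⟨x, hx, hcx⟩ := h c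
          refine ⟨j • x, X.smul_mem j hx, ?_⟩
          rw [← smul_sub, Submodule.pow_succ, Submodule.mul_smul]
          exact Submodule.smul_mem_smul hj hcx
        · obtain ⟨x, hx, hc⟩ := hc
          obtain ⟨y, hy, hd⟩ := hd
          exact ⟨x + y, add_mem hx hy, by rw [add_sub_add_comm]; exact add_mem hc hd⟩
      intro c
      obtain ⟨x, hx, hc⟩ := ih c
      obtain ⟨y, hy, hd⟩ := h1 _ hc
      exact ⟨x + y, add_mem hx hy, by rwa [← sub_sub]⟩
  refine eq_top_iff.2 fun c _ => ?_
  obtain ⟨x, hx, hc⟩ := key m c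
  rw [hm, Submodule.zero_eq_bot, Submodule.bot_smul, Submodule.mem_bot, sub_eq_zero] at hc
  rwa [hc]

/-- Let `C` be a finitely generated `R`-module that is projective over `Λ`. If every presentation of
`C` splits modulo a nilpotent ideal of `Λ` then `C` is projective. -/
theorem Ideal.IsNormalIn.projective [IsScalarTower Λ R R] {I : Ideal Λ} (hI : I.IsNormalIn R)
    (hnil : IsNilpotent I)
    [Module.Finite R C] [Module.Projective Λ C]
    (hs : ∀ (n : ℕ) (π : (Fin n → R) →ₗ[R] C), Function.Surjective π →
      ∃ s, hI.mapQ π ∘ₗ s = LinearMap.id) : Module.Projective R C := by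
  obtain ⟨n, π, hπ⟩ := Module.Finite.exists_fin' R C
  obtain ⟨s, hsec⟩ := hs n π hπ
  have hsec' : ∀ c, hI.mapQ π (s c) = c := LinearMap.congr_fun hsec
  let F := Fin n → R
  let q := (hI.smulTop F).mkQ
  -- The section s gives an idempotent of F/IF. It lifts to an endomorphism because F is free, and
  -- then to an idempotent e because endomorphisms that reduce to zero are nilpotent.
  obtain ⟨e1, he1⟩ := Module.projective_lifting_property q (s ∘ₗ hI.mapQ π ∘ₗ q)
    (Submodule.mkQ_surjective _)
  have hnil' : ∀ f ∈ RingHom.ker (hI.endHom (F := F)), IsNilpotent f := by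
    intro f hf
    have hf' : ∀ x, f x ∈ I • (⊤ : Submodule Λ F) := fun x =>
      (Submodule.Quotient.mk_eq_zero _).1 (LinearMap.congr_fun hf (q x))
    have key : ∀ m x, (f ^ m) x ∈ (I ^ m) • (⊤ : Submodule Λ F) := by
      intro m
      induction m with
      | zero => intro x; rw [Submodule.pow_zero, Submodule.one_smul]; trivial
      | succ m ih =>
        intro x
        rw [pow_succ']
        have h1 := Submodule.mem_map_of_mem (f := f.restrictScalars Λ) (ih x)
        rw [Submodule.map_smul''] at h1
        rw [Submodule.pow_succ, Submodule.mul_smul]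
        refine Submodule.smul_mono le_rfl ?_ h1
        rintro _ ⟨y, -, rfl⟩
        exact hf' y
    obtain ⟨m, hm⟩ := hnil
    refine ⟨m, LinearMap.ext fun x => ?_⟩
    have := key m x
    rwa [hm, Submodule.zero_eq_bot, Submodule.bot_smul, Submodule.mem_bot] at this
  obtain ⟨e, he, hee⟩ := exists_isIdempotentElem_eq_of_ker_isNilpotent (hI.endHom (F := F)) hnil'
    (s ∘ₗ hI.mapQ π) ⟨e1, LinearMap.ext fun x => by
      obtain ⟨x, rfl⟩ := Submodule.Quotient.mk_surjective _ x
      exact LinearMap.congr_fun he1 x⟩ (LinearMap.ext fun x => congrArg s (hsec' _))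
  have he' : ∀ x, e (e x) = e x := LinearMap.congr_fun he
  have hred : ∀ x, q (e x) = s (hI.mapQ π (q x)) := fun x => LinearMap.congr_fun hee (q x)
  let P := LinearMap.range e
  have : Module.Projective R P := Module.Projective.of_split P.subtype e.rangeRestrict
    (LinearMap.ext fun ⟨x, y, hy⟩ => Subtype.ext (by
      change e x = x
      rw [← hy, he']))
  let θ : P →ₗ[R] C := π ∘ₗ P.subtype
  have hθ : Function.Surjective θ := by
    rw [← LinearMap.range_eq_top, ← Submodule.restrictScalars_eq_top_iff Λ]
    refine Submodule.eq_top_of_sup_smul_top hnil _ fun c => ?_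
    obtain ⟨x, rfl⟩ := hπ c
    refine ⟨π (e x), ⟨⟨e x, x, rfl⟩, rfl⟩, ?_⟩
    rw [← hI.mem_smulTop, ← Submodule.Quotient.mk_eq_zero, Submodule.Quotient.mk_sub, sub_eq_zero]
    change hI.mapQ π (q x) = hI.mapQ π (q (e x))
    rw [hred, hsec']
  -- Projectivity over Λ makes ker θ a Λ-direct summand of P. Since ker θ lies in IP, it lies in I ·
  -- ker θ, and hence vanishes by nilpotence.
  obtain ⟨j, hj⟩ := Module.projective_lifting_property (θ.restrictScalars Λ) LinearMap.id hθ
  have hj' : ∀ c, θ (j c) = c := LinearMap.congr_fun hj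
  have hinj : Function.Injective θ := by
    rw [injective_iff_map_eq_zero]
    let u : P →ₗ[Λ] P := LinearMap.id - j ∘ₗ θ.restrictScalars Λ
    have hu : ∀ x, θ (u x) = 0 := fun x => by
      change θ (x - j (θ x)) = 0
      rw [map_sub, hj', sub_self]
    have hu' : ∀ x, θ x = 0 → u x = x := fun x hx => by
      change x - j (θ x) = x
      rw [hx, map_zero, sub_zero]
    have h1 : ∀ x : P, θ x = 0 → x ∈ I • (⊤ : Submodule Λ P) := by
      rintro ⟨_, x, rfl⟩ hx
      have hx' : π (e x) = 0 := hx
      have h0 : q (e x) = 0 := by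
        rw [← he', hred]
        have : hI.mapQ π (q (e x)) = 0 := by
          change (Submodule.Quotient.mk (π (e x)) : C ⧸ hI.smulTop C) = 0
          rw [hx', Submodule.Quotient.mk_zero]
        rw [this, map_zero]
      have h2 : e x ∈ I • (⊤ : Submodule Λ F) := (Submodule.Quotient.mk_eq_zero _).1 h0
      have h3 := Submodule.map_mem_smul_top I (e.rangeRestrict.restrictScalars Λ) h2
      have h4 : e.rangeRestrict (e x) = ⟨e x, x, rfl⟩ := Subtype.ext (he' x)
      rw [← h4]
      exact h3
    have key : ∀ m, ∀ x : P, θ x = 0 → x ∈ (I ^ m) • (⊤ : Submodule Λ P) := by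
      intro m
      induction m with
      | zero => intro x _; rw [Submodule.pow_zero, Submodule.one_smul]; trivial
      | succ m ih =>
        intro x hx
        have h2 := Submodule.mem_map_of_mem (f := u) (ih x hx)
        rw [Submodule.map_smul'', hu' x hx] at h2
        rw [Submodule.pow_succ, Submodule.mul_smul]
        refine Submodule.smul_mono le_rfl ?_ h2
        rintro _ ⟨y, -, rfl⟩
        exact h1 _ (hu y)
    intro x hx
    obtain ⟨m, hm⟩ := hnil
    have := key m x hx
    rwa [hm, Submodule.zero_eq_bot, Submodule.bot_smul, Submodule.mem_bot] at this
  exact Module.Projective.of_equiv (LinearEquiv.ofBijective θ ⟨hinj, hθ⟩)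

end

/-! ## Projective bimodules over algebras with separable semisimple quotient -/

/-- The ring `R` is generated by commuting copies of `Λ` and `Λᵐᵒᵖ` inducing the same `k`-algebra
structure, like the enveloping algebra `Λ ⊗[k] Λᵐᵒᵖ`. -/
structure IsEnveloping (k : Type*) {Λ R : Type*} [Field k] [Ring Λ] [Algebra k Λ] [Ring R]
    [Module Λ R] (ι : Λᵐᵒᵖ →+* R) : Prop where
  comm : ∀ (a : Λ) (b : Λᵐᵒᵖ), ι b * (a • (1 : R)) = a • ι b
  central : ∀ r : k, algebraMap k Λ r • (1 : R) = ι (algebraMap k Λᵐᵒᵖ r)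
  generate : ∀ x : R, x ∈ AddSubgroup.closure {y | ∃ (a : Λ) (b : Λᵐᵒᵖ), y = a • ι b}

namespace IsEnveloping

variable {k Λ R : Type*} [Field k] [Ring Λ] [Algebra k Λ] [Ring R] [Module Λ R]
  {ι : Λᵐᵒᵖ →+* R}
  {C F : Type*} [AddCommGroup C] [Module R C] [Module Λ C] [IsScalarTower Λ R C]
  [AddCommGroup F] [Module R F] [Module Λ F] [IsScalarTower Λ R F]

/-- The two copies commute, so moving j past a ⊗ b gives aj ⊗ b, and aj lies in the left ideal I. -/
theorem isNormalIn [IsScalarTower Λ R R] (h : IsEnveloping k ι) (I : Ideal Λ) :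
    I.IsNormalIn R := by
  intro x j hj
  induction h.generate x using AddSubgroup.closure_induction with
  | mem x hx =>
    obtain ⟨a, b, rfl⟩ := hx
    rw [smul_mul_assoc, h.comm, ← mul_smul]
    exact Submodule.smul_mem_smul (I.mul_mem_left a hj) trivial
  | zero => rw [zero_mul]; exact zero_mem _
  | add x y _ _ hx hy => rw [add_mul]; exact add_mem hx hy
  | neg x _ hx => rw [neg_mul]; exact neg_mem hx

theorem smul_comm (h : IsEnveloping k ι) (a : Λ) (b : Λᵐᵒᵖ) (c : C) :
    a • ι b • c = ι b • a • c := by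
  rw [← smul_assoc, ← h.comm, mul_smul, smul_assoc, one_smul]

theorem central_smul (h : IsEnveloping k ι) (r : k) (c : C) :
    algebraMap k Λ r • c = ι (algebraMap k Λᵐᵒᵖ r) • c := by
  rw [← h.central, smul_assoc, one_smul]

/-- An additive map that is linear on both sides is linear. -/
def linearMap (h : IsEnveloping k ι) (f : C →+ F) (hl : ∀ (a : Λ) c, f (a • c) = a • f c)
    (hr : ∀ (b : Λᵐᵒᵖ) c, f (ι b • c) = ι b • f c) : C →ₗ[R] F where
  toFun := f
  map_add' := map_add f
  map_smul' x c := by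
    induction h.generate x using AddSubgroup.closure_induction with
    | mem x hx =>
      obtain ⟨a, b, rfl⟩ := hx
      rw [smul_assoc, hl, hr, RingHom.id_apply, smul_assoc]
    | zero => rw [RingHom.id_apply, zero_smul, zero_smul, map_zero]
    | add x y _ _ hx hy => rw [RingHom.id_apply, add_smul, map_add, hx, hy, ← add_smul]; rfl
    | neg x _ hx => rw [RingHom.id_apply, neg_smul, map_neg, hx, ← neg_smul]; rfl

/-- Right linear surjections from bimodules to projective right modules split. -/
theorem _root_.exists_right_section {Γ R D F : Type*} [Ring Γ] [Ring R] (ι : Γ →+* R)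
    [AddCommGroup F] [Module R F] [AddCommGroup D] [Module Γ D]
    [Module.Projective Γ D] (q : F →+ D) (hq : Function.Surjective q)
    (hqr : ∀ b c, q (ι b • c) = b • q c) :
    ∃ t : D →+ F, (∀ d, q (t d) = d) ∧ ∀ b d, t (b • d) = ι b • t d := by
  let : Module Γ F := Module.compHom F ι
  let p : F →ₗ[Γ] D := { q with map_smul' := hqr }
  obtain ⟨t, ht⟩ := Module.projective_lifting_property p LinearMap.id hq
  exact ⟨t.toAddMonoidHom, LinearMap.congr_fun ht, map_smul t⟩

/-- The action of `Λ ⧸ I` on a module annihilated by `I`. -/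
def _root_.Ideal.quotientAction (I : Ideal Λ) [I.IsTwoSided] (h : ∀ j ∈ I, ∀ c : F, j • c = 0) :
    Λ ⧸ I →+* AddMonoid.End F :=
  Ideal.Quotient.lift I (Module.toAddMonoidEnd Λ F) fun j hj => AddMonoidHom.ext (h j hj)

theorem _root_.Ideal.quotientAction_mk (I : Ideal Λ) [I.IsTwoSided]
    (h : ∀ j ∈ I, ∀ c : F, j • c = 0) (a : Λ) (c : F) :
    I.quotientAction h (Ideal.Quotient.mk I a) c = a • c := rfl

/-- Averaging with a separability idempotent: a right linear section of a map of bimodules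
annihilated by `I` gives a section of bimodules if `Λ ⧸ I` is separable. -/
theorem exists_section_of_separable (h : IsEnveloping k ι) {I : Ideal Λ} [I.IsTwoSided]
    {V W : Type*} [AddCommGroup V] [Module R V] [Module Λ V] [IsScalarTower Λ R V]
    [AddCommGroup W] [Module R W] [Module Λ W] [IsScalarTower Λ R W]
    (hsep : IsSeparableAlgebra k (Λ ⧸ I)) (hV : ∀ j ∈ I, ∀ c : V, j • c = 0)
    (hW : ∀ j ∈ I, ∀ c : W, j • c = 0) (ϖ : W →ₗ[R] V) (τ : V →+ W) (hτ : ∀ c, ϖ (τ c) = c)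
    (hτr : ∀ b c, τ (ι b • c) = ι b • τ c) :
    ∃ s, ϖ ∘ₗ s = LinearMap.id := by
  have hmk : ∀ s : Λ ⧸ I, ∃ a, Ideal.Quotient.mk I a = s := Ideal.Quotient.mk_surjective
  -- The map Φ c sends x ⊗ y to x τ(y c). It is k-balanced since scalars also act from the right,
  -- where τ is linear. Its value at the separability idempotent is the average of τ, which is
  -- linear on both sides.
  let Φ : V → (Λ ⧸ I) ⊗[k] (Λ ⧸ I) →+ W := fun c =>
    TensorProduct.liftAddHom
      (AddMonoidHom.mk' (fun x => AddMonoidHom.mk' (fun y => I.quotientAction hW x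
          (τ (I.quotientAction hV y c)))
          fun y y' => by rw [map_add]; exact (congrArg _ (map_add τ _ _)).trans (map_add _ _ _))
        fun x x' => AddMonoidHom.ext fun y => by rw [AddMonoidHom.mk'_apply, map_add]; rfl)
      (fun r x y => by
        obtain ⟨x, rfl⟩ := hmk x
        obtain ⟨y, rfl⟩ := hmk y
        have h1 : r • Ideal.Quotient.mk I x = Ideal.Quotient.mk I (x * algebraMap k Λ r) := by
          rw [← Algebra.commutes, ← Algebra.smul_def]; rfl
        have h2 : r • Ideal.Quotient.mk I y = Ideal.Quotient.mk I (algebraMap k Λ r * y) := by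
          rw [← Algebra.smul_def]; rfl
        rw [h1, h2]
        change (x * algebraMap k Λ r) • τ (y • c) = x • τ ((algebraMap k Λ r * y) • c)
        rw [mul_smul, mul_smul, h.central_smul, h.central_smul, hτr])
  have hΦ : ∀ c x y, Φ c (x ⊗ₜ y) = I.quotientAction hW x (τ (I.quotientAction hV y c)) :=
    fun c x y => rfl
  have hΦadd : ∀ c d z, Φ (c + d) z = Φ c z + Φ d z := fun c d z => by
    induction z using TensorProduct.induction_on with
    | zero => simp
    | tmul x y => simp only [hΦ, map_add]
    | add z w hz hw => rw [map_add, hz, hw, map_add, map_add, add_add_add_comm]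
  have hΦl : ∀ c s z, Φ c ((s ⊗ₜ 1) * z) = I.quotientAction hW s (Φ c z) := fun c s z => by
    induction z using TensorProduct.induction_on with
    | zero => simp
    | tmul x y =>
      rw [Algebra.TensorProduct.tmul_mul_tmul, hΦ, hΦ, one_mul, map_mul]
      rfl
    | add z w hz hw => rw [mul_add, map_add, hz, hw, map_add, map_add]
  have hΦl' : ∀ c s z, Φ c (z * (1 ⊗ₜ s)) = Φ (I.quotientAction hV s c) z := fun c s z => by
    induction z using TensorProduct.induction_on with
    | zero => simp
    | tmul x y =>
      rw [Algebra.TensorProduct.tmul_mul_tmul, hΦ, hΦ, mul_one, map_mul]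
      rfl
    | add z w hz hw => rw [add_mul, map_add, hz, hw, map_add]
  have hΦr : ∀ c b z, Φ (ι b • c) z = ι b • Φ c z := fun c b z => by
    induction z using TensorProduct.induction_on with
    | zero => simp
    | tmul x y =>
      obtain ⟨x, rfl⟩ := hmk x
      obtain ⟨y, rfl⟩ := hmk y
      rw [hΦ, hΦ]
      simp only [Ideal.quotientAction_mk]
      rw [h.smul_comm, hτr, h.smul_comm]
    | add z w hz hw => rw [map_add, hz, hw, map_add, smul_add]
  have hϖ : ∀ (a : Λ) w, ϖ (a • w) = a • ϖ w := map_smul (ϖ.restrictScalars Λ)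
  have hΦm : ∀ c z, ϖ (Φ c z) = I.quotientAction hV (LinearMap.mul' k _ z) c := fun c z => by
    induction z using TensorProduct.induction_on with
    | zero => simp
    | tmul x y =>
      obtain ⟨x, rfl⟩ := hmk x
      rw [hΦ, Ideal.quotientAction_mk, hϖ, hτ, LinearMap.mul'_apply, map_mul]
      rfl
    | add z w hz hw => rw [map_add, map_add, hz, hw, map_add, map_add]; rfl
  obtain ⟨e, he1, he⟩ := hsep
  refine ⟨h.linearMap (AddMonoidHom.mk' (fun c => Φ c e) fun c d => hΦadd c d e)
    (fun a c => ?_) (fun b c => hΦr c b e), LinearMap.ext fun c => ?_⟩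
  · change Φ (a • c) e = a • Φ c e
    rw [← Ideal.quotientAction_mk I hV, ← Ideal.quotientAction_mk I hW, ← hΦl', ← hΦl, he]
  · change ϖ (Φ c e) = c
    rw [hΦm, he1, map_one]
    rfl

theorem smul_quotient_smulTop {I : Ideal Λ} (hI : I.IsNormalIn R) (j : Λ) (hj : j ∈ I)
    (c : C ⧸ hI.smulTop C) : j • c = 0 := by
  obtain ⟨c, rfl⟩ := Submodule.Quotient.mk_surjective _ c
  have h0 : j • c ∈ hI.smulTop C := hI.mem_smulTop.2 (Submodule.smul_mem_smul hj trivial)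
  exact (Submodule.Quotient.mk_eq_zero _).2 h0

/-- A bimodule `C` that is projective on the left and such that `C ⧸ I C ≅ D` is projective on the
right is a projective bimodule, if `I` is nilpotent and `Λ ⧸ I` is separable. -/
theorem projective [IsScalarTower Λ R R] (h : IsEnveloping k ι) (I : Ideal Λ) [I.IsTwoSided]
    (hnil : IsNilpotent I) (hsep : IsSeparableAlgebra k (Λ ⧸ I)) [Module.Finite R C]
    [Module.Projective Λ C] {D : Type*} [AddCommGroup D] [Module Λᵐᵒᵖ D]
    [Module.Projective Λᵐᵒᵖ D] (q : C →+ D) (hq : Function.Surjective q)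
    (hqr : ∀ b c, q (ι b • c) = b • q c)
    (hker : ∀ c, q c = 0 ↔ c ∈ I • (⊤ : Submodule Λ C)) :
    Module.Projective R C := by
  have hI := h.isNormalIn I
  refine hI.projective hnil fun n π hπ => ?_
  let F := Fin n → R
  -- As D is projective on the right, F → C → D has a right linear section. Because q identifies
  -- C/IC with D, this reduces to a right linear section modulo I, which can be averaged.
  obtain ⟨t, ht', htr⟩ := exists_right_section ι (F := F) (q.comp π.toAddMonoidHom)
    (hq.comp hπ) fun b x => (congrArg q (map_smul π (ι b) x)).trans (hqr b (π x))
  replace ht' : ∀ d, q (π (t d)) = d := ht'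
  let qb : (C ⧸ hI.smulTop C) →+ D :=
    QuotientAddGroup.lift (hI.smulTop C).toAddSubgroup q fun c hc => (hker c).2 hc
  let τ : (C ⧸ hI.smulTop C) →+ (F ⧸ hI.smulTop F) :=
    (hI.smulTop F).mkQ.toAddMonoidHom.comp (t.comp qb)
  refine h.exists_section_of_separable hsep (smul_quotient_smulTop hI)
    (smul_quotient_smulTop hI) (hI.mapQ π) τ (fun c => ?_) fun b c => ?_
  · obtain ⟨c, rfl⟩ := Submodule.Quotient.mk_surjective _ c
    change (hI.smulTop C).mkQ (π (t (q c))) = (hI.smulTop C).mkQ c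
    rw [← sub_eq_zero, ← map_sub]
    refine (Submodule.Quotient.mk_eq_zero _).2 ((hker _).1 ?_)
    rw [map_sub, ht', sub_self]
  · obtain ⟨c, rfl⟩ := Submodule.Quotient.mk_surjective _ c
    change (hI.smulTop F).mkQ (t (q (ι b • c))) = ι b • (hI.smulTop F).mkQ (t (q c))
    rw [hqr, htr, map_smul]

end IsEnveloping

/-! ## Bimodules as modules over the enveloping algebra -/

section

variable (k Λ : Type*) [Field k] [Ring Λ] [Algebra k Λ]

theorem smul_enveloping (a : Λ) (x : Λ ⊗[k] Λᵐᵒᵖ) : a • x = (a ⊗ₜ[k] 1) * x := by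
  induction x using TensorProduct.induction_on with
  | zero => rw [smul_zero, mul_zero]
  | tmul b c =>
    rw [TensorProduct.smul_tmul', Algebra.TensorProduct.tmul_mul_tmul, one_mul, smul_eq_mul]
  | add x y hx hy => rw [smul_add, mul_add, hx, hy]

instance isScalarTower_enveloping : IsScalarTower Λ (Λ ⊗[k] Λᵐᵒᵖ) (Λ ⊗[k] Λᵐᵒᵖ) where
  smul_assoc a x y := by
    rw [smul_eq_mul, smul_eq_mul, smul_enveloping, smul_enveloping, mul_assoc]

theorem isEnveloping : IsEnveloping k (R := Λ ⊗[k] Λᵐᵒᵖ)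
    (Algebra.TensorProduct.includeRight : Λᵐᵒᵖ →ₐ[k] Λ ⊗[k] Λᵐᵒᵖ).toRingHom where
  comm a b := by
    change (1 ⊗ₜ[k] b) * (a • 1) = a • (1 ⊗ₜ[k] b)
    rw [smul_enveloping, smul_enveloping, mul_one, Algebra.TensorProduct.tmul_mul_tmul,
      Algebra.TensorProduct.tmul_mul_tmul]
    simp
  central r := by
    change algebraMap k Λ r • (1 : Λ ⊗[k] Λᵐᵒᵖ) = 1 ⊗ₜ[k] algebraMap k Λᵐᵒᵖ r
    rw [smul_enveloping, mul_one, Algebra.algebraMap_eq_smul_one, Algebra.algebraMap_eq_smul_one,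
      TensorProduct.smul_tmul]
  generate x := by
    induction x using TensorProduct.induction_on with
    | zero => exact zero_mem _
    | tmul a b =>
      refine AddSubgroup.subset_closure ⟨a, b, ?_⟩
      change _ = a • (1 ⊗ₜ[k] b)
      rw [smul_enveloping, Algebra.TensorProduct.tmul_mul_tmul, mul_one, one_mul]
    | add x y hx hy => exact add_mem hx hy

end

section

variable (k : Type*) {Λ : Type*} (C : Type*) [Field k] [Ring Λ] [Algebra k Λ] [AddCommGroup C]
  [Module Λ C] [Module Λᵐᵒᵖ C] [SMulCommClass Λ Λᵐᵒᵖ C]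

/-- The module over the enveloping algebra given by a `k`-central bimodule. -/
abbrev envelopingModule (hc : ∀ (r : k) (c : C), algebraMap k Λ r • c = algebraMap k Λᵐᵒᵖ r • c) :
    Module (Λ ⊗[k] Λᵐᵒᵖ) C :=
  letI : Module k C := Module.compHom C (algebraMap k Λ)
  haveI : IsScalarTower k Λ C :=
    ⟨fun r a c => by rw [Algebra.smul_def, mul_smul]; rfl⟩
  haveI : IsScalarTower k Λᵐᵒᵖ C :=
    ⟨fun r b c => by rw [Algebra.smul_def, mul_smul, ← hc]; rfl⟩
  TensorProduct.Algebra.module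

theorem envelopingModule_smul
    (hc : ∀ (r : k) (c : C), algebraMap k Λ r • c = algebraMap k Λᵐᵒᵖ r • c)
    (a : Λ) (b : Λᵐᵒᵖ) (c : C) :
    letI := envelopingModule k C hc
    (a ⊗ₜ[k] b) • c = a • b • c := rfl

theorem envelopingModule_isScalarTower
    (hc : ∀ (r : k) (c : C), algebraMap k Λ r • c = algebraMap k Λᵐᵒᵖ r • c) :
    letI := envelopingModule k C hc
    IsScalarTower Λ (Λ ⊗[k] Λᵐᵒᵖ) C :=
  letI := envelopingModule k C hc
  ⟨fun a x c => by
    rw [smul_enveloping, mul_smul, envelopingModule_smul, one_smul]⟩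

end

section

variable {k Λ T : Type u} [Field k] [Ring Λ] [Algebra k Λ] [AddCommGroup T]
  [Module Λ T] [Module Λᵐᵒᵖ T] [SMulCommClass Λ Λᵐᵒᵖ T]

/-- A bimodule `T` with a central element `t₀` generating a copy of `Λ` with complement on the left
is the sum of `Λ` and a projective bimodule, if `T ⧸ Λ t₀` is projective on the right modulo the
radical. -/
theorem isRegularPlusProjective_of_unit (hsep : IsSeparableAlgebra k (Λ ⧸ Ring.jacobson Λ))
    (hnil : IsNilpotent (Ring.jacobson Λ))
    (hc : ∀ (r : k) (t : T), algebraMap k Λ r • t = algebraMap k Λᵐᵒᵖ r • t) [Module.Finite Λ T]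
    [Module.Projective Λ T] (t₀ : T) (ht₀ : ∀ a : Λ, a • t₀ = op a • t₀) (τ : T →ₗ[Λ] Λ)
    (hτ : τ t₀ = 1) {D : Type*} [AddCommGroup D] [Module Λᵐᵒᵖ D] [Module.Projective Λᵐᵒᵖ D]
    (q : T →+ D) (hq : Function.Surjective q) (hqr : ∀ (b : Λᵐᵒᵖ) t, q (b • t) = b • q t)
    (hker : ∀ t, q t = 0 ↔ ∃ a : Λ, t - a • t₀ ∈ Ring.jacobson Λ • (⊤ : Submodule Λ T)) :
    IsRegularPlusProjective k Λ T := by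
  let R := Λ ⊗[k] Λᵐᵒᵖ
  let := envelopingModule k T hc
  have hs : ∀ (a : Λ) (b : Λᵐᵒᵖ) (t : T), (a ⊗ₜ[k] b) • t = a • b • t :=
    envelopingModule_smul k T hc
  have := envelopingModule_isScalarTower k T hc
  have h := isEnveloping k Λ
  let S : Submodule R T :=
    { (LinearMap.toSpanSingleton Λ T t₀).toAddMonoidHom.range with
      smul_mem' := fun x t ht => by
        obtain ⟨c, rfl⟩ := ht
        change ∃ d : Λ, d • t₀ = x • c • t₀
        induction x using TensorProduct.induction_on with
        | zero => exact ⟨0, (zero_smul Λ t₀).trans (zero_smul R (c • t₀)).symm⟩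
        | tmul a b =>
          refine ⟨a * (c * b.unop), ?_⟩
          rw [hs, mul_smul, mul_smul, ht₀ b.unop, op_unop, smul_comm c b]
        | add x y hx hy =>
          obtain ⟨d, hd⟩ := hx
          obtain ⟨d', hd'⟩ := hy
          exact ⟨d + d', by rw [add_smul, hd, hd']; exact (add_smul x y _).symm⟩ }
  have hS : ∀ t, t ∈ S ↔ ∃ d : Λ, d • t₀ = t := fun t => Iff.rfl
  let C := T ⧸ S
  have : Module.Finite R T := Module.Finite.of_restrictScalars_finite Λ R T
  have : Module.Projective Λ C := by
    -- The map t ↦ t − τ(t) t₀ makes T/Λt₀ a left direct summand of T.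
    let i : C →ₗ[Λ] T := (S.restrictScalars Λ).liftQ
      (LinearMap.id - LinearMap.toSpanSingleton Λ T t₀ ∘ₗ τ) (by
        rintro _ ⟨d, rfl⟩
        change d • t₀ - τ (d • t₀) • t₀ = 0
        rw [map_smul, hτ, smul_eq_mul, mul_one, sub_self])
    refine Module.Projective.of_split i (S.mkQ.restrictScalars Λ) (LinearMap.ext fun c => ?_)
    obtain ⟨t, rfl⟩ := S.mkQ_surjective c
    change S.mkQ (t - τ t • t₀) = S.mkQ t
    rw [map_sub, sub_eq_self]
    exact (Submodule.Quotient.mk_eq_zero _).2 ⟨τ t, rfl⟩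
  let qC : C →+ D := QuotientAddGroup.lift S.toAddSubgroup q (by
    rintro _ ⟨d, rfl⟩
    exact (hker _).2 ⟨d, by change d • t₀ - d • t₀ ∈ _; rw [sub_self]; exact zero_mem _⟩)
  have hqC : ∀ t, qC (S.mkQ t) = q t := fun t => rfl
  have : Module.Projective R C := by
    refine h.projective (Ring.jacobson Λ) hnil hsep qC (fun d => ?_) (fun b c => ?_) fun c => ?_
    · obtain ⟨t, rfl⟩ := hq d
      exact ⟨S.mkQ t, rfl⟩
    · obtain ⟨t, rfl⟩ := S.mkQ_surjective c
      rw [← map_smul, hqC, hqC, ← hqr]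
      change q (((1 : Λ) ⊗ₜ[k] b) • t) = _
      rw [hs, one_smul]
    · obtain ⟨t, rfl⟩ := S.mkQ_surjective c
      rw [hqC, hker]
      constructor
      · rintro ⟨a, ha⟩
        have h1 := Submodule.map_mem_smul_top _ (S.mkQ.restrictScalars Λ) ha
        have h2 : S.mkQ (a • t₀) = 0 := (Submodule.Quotient.mk_eq_zero _).2 ⟨a, rfl⟩
        rwa [LinearMap.restrictScalars_apply, map_sub, h2, sub_zero] at h1
      · intro ht
        have h1 : Ring.jacobson Λ • (⊤ : Submodule Λ C) =
            (Ring.jacobson Λ • (⊤ : Submodule Λ T)).map (S.mkQ.restrictScalars Λ) := by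
          rw [Submodule.map_smul'', Submodule.map_top,
            (LinearMap.range_eq_top (f := S.mkQ.restrictScalars Λ)).2 S.mkQ_surjective]
        rw [h1] at ht
        obtain ⟨t', ht', heq⟩ := ht
        obtain ⟨a, ha⟩ : t - t' ∈ S := (Submodule.Quotient.eq S).1 heq.symm
        refine ⟨a, ?_⟩
        have ha' : a • t₀ = t - t' := ha
        rw [ha', sub_sub_cancel]
        exact ht'
  obtain ⟨s, hs'⟩ := Module.projective_lifting_property S.mkQ LinearMap.id S.mkQ_surjective
  have hs'' : ∀ c, S.mkQ (s c) = c := LinearMap.congr_fun hs'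
  let f : Λ × C →+ T :=
    (LinearMap.toSpanSingleton Λ T t₀).toAddMonoidHom.coprod s.toAddMonoidHom
  have hf : ∀ a c, f (a, c) = a • t₀ + s c := fun a c => rfl
  have hmk : ∀ a : Λ, S.mkQ (a • t₀) = 0 := fun a => (Submodule.Quotient.mk_eq_zero _).2 ⟨a, rfl⟩
  have hbij : Function.Bijective f := by
    constructor
    · rw [injective_iff_map_eq_zero]
      rintro ⟨a, c⟩ hac
      have h1 : c = 0 := by
        have := congrArg S.mkQ hac
        rwa [hf, map_add, hmk, hs'', map_zero, zero_add] at this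
      subst h1
      have h2 := congrArg τ hac
      rw [hf, map_zero, add_zero, map_smul, hτ, map_zero, smul_eq_mul, mul_one] at h2
      rw [h2]; rfl
    · intro t
      obtain ⟨a, ha⟩ : t - s (S.mkQ t) ∈ S := by
        rw [← Submodule.Quotient.mk_eq_zero]
        change S.mkQ _ = 0
        rw [map_sub, hs'', sub_self]
      refine ⟨(a, S.mkQ t), ?_⟩
      have ha' : a • t₀ = t - s (S.mkQ t) := ha
      rw [hf, ha', sub_add_cancel]
  refine ⟨C, inferInstance, inferInstance, inferInstance, inferInstance,
    (AddEquiv.ofBijective f hbij).symm, fun a a' t => ?_⟩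
  rw [AddEquiv.symm_apply_eq]
  obtain ⟨⟨b, c⟩, rfl⟩ := hbij.2 t
  have h1 : (AddEquiv.ofBijective f hbij).symm (f (b, c)) = (b, c) :=
    (AddEquiv.ofBijective f hbij).symm_apply_apply (b, c)
  rw [h1]
  change _ = f _
  rw [hf, hf, smul_add, smul_add, mul_smul, mul_smul, ht₀ a', smul_comm b (op a'), map_smul, hs]

/-- A bimodule `Z` with an epimorphism to `Λ` is the sum of `Λ` and a projective bimodule, if the
kernel is projective on the right modulo the radical and maps from the kernel to the enveloping
algebra extend to `Z`. -/
theorem isRegularPlusProjective_of_counit (hsep : IsSeparableAlgebra k (Λ ⧸ Ring.jacobson Λ))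
    (hnil : IsNilpotent (Ring.jacobson Λ))
    (hc : ∀ (r : k) (t : T), algebraMap k Λ r • t = algebraMap k Λᵐᵒᵖ r • t) [Module.Finite Λ T]
    [Module.Projective Λ T] (ε : T →ₗ[Λ] Λ) (hεr : ∀ (b : Λ) t, ε (op b • t) = ε t * b)
    (t₀ : T) (ht₀ : ε t₀ = 1)
    {D : Type*} [AddCommGroup D] [Module Λᵐᵒᵖ D] [Module.Projective Λᵐᵒᵖ D]
    (q : LinearMap.ker ε →+ D) (hq : Function.Surjective q)
    (hqr : ∀ (b : Λᵐᵒᵖ) (t t' : LinearMap.ker ε), (t' : T) = b • (t : T) → q t' = b • q t)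
    (hker : ∀ t, q t = 0 ↔ (t : T) ∈ Ring.jacobson Λ • (⊤ : Submodule Λ T))
    (hext : ∀ f : LinearMap.ker ε →+ Λ ⊗[k] Λᵐᵒᵖ,
      (∀ (a : Λ) t, f (a • t) = (a ⊗ₜ[k] (1 : Λᵐᵒᵖ)) * f t) →
      (∀ (b : Λᵐᵒᵖ) (t t' : LinearMap.ker ε), (t' : T) = b • (t : T) →
        f t' = ((1 : Λ) ⊗ₜ[k] b) * f t) →
      ∃ g : T →+ Λ ⊗[k] Λᵐᵒᵖ, (∀ t : LinearMap.ker ε, g t = f t) ∧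
        (∀ (a : Λ) t, g (a • t) = (a ⊗ₜ[k] (1 : Λᵐᵒᵖ)) * g t) ∧
        (∀ (b : Λᵐᵒᵖ) t, g (b • t) = ((1 : Λ) ⊗ₜ[k] b) * g t)) :
    IsRegularPlusProjective k Λ T := by
  let R := Λ ⊗[k] Λᵐᵒᵖ
  let := envelopingModule k T hc
  have hs : ∀ (a : Λ) (b : Λᵐᵒᵖ) (t : T), (a ⊗ₜ[k] b) • t = a • b • t :=
    envelopingModule_smul k T hc
  have hs1 : ∀ (b : Λᵐᵒᵖ) (t : T), ((1 : Λ) ⊗ₜ[k] b) • t = b • t := fun b t => by rw [hs, one_smul]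
  have := envelopingModule_isScalarTower k T hc
  have h := isEnveloping k Λ
  let K : Submodule R T :=
    { LinearMap.ker ε with
      smul_mem' := fun x t ht => by
        change ε _ = 0
        replace ht : ε t = 0 := ht
        induction x using TensorProduct.induction_on with
        | zero => rw [← map_zero ε]; exact congrArg ε (zero_smul R t)
        | tmul a b =>
          rw [hs, map_smul, ← op_unop b, hεr, ht, zero_mul, smul_zero]
        | add x y hx hy =>
          exact (congrArg ε (add_smul x y t)).trans (by rw [map_add, hx, hy, add_zero]) }
  -- The left linear projection of T onto ker ε along Λt₀.
  let ρ : T →ₗ[Λ] K := LinearMap.codRestrict (K.restrictScalars Λ)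
    (LinearMap.id - LinearMap.toSpanSingleton Λ T t₀ ∘ₗ ε) fun t => by
      change ε (t - ε t • t₀) = 0
      rw [map_sub, map_smul, ht₀, smul_eq_mul, mul_one, sub_self]
  have hρ : ∀ x : K, ρ x = x := fun x => Subtype.ext (by
    change (x : T) - ε x • t₀ = x
    rw [show ε x = 0 from x.2, zero_smul, sub_zero])
  have : Module.Finite Λ K := Module.Finite.of_surjective ρ fun x => ⟨x, hρ x⟩
  have : Module.Finite R K := Module.Finite.of_restrictScalars_finite Λ R K
  have : Module.Projective Λ K :=
    Module.Projective.of_split (K.subtype.restrictScalars Λ) ρ (LinearMap.ext hρ)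
  have : Module.Projective R K := by
    refine h.projective (Ring.jacobson Λ) hnil hsep (C := K) (q : K →+ D) hq
      (fun b c => ?_) fun c => ?_
    · exact hqr b c _ (hs1 b c)
    · refine (hker c).trans ⟨fun hc => ?_, fun hc => ?_⟩
      · have := Submodule.map_mem_smul_top _ ρ hc
        rwa [hρ] at this
      · exact Submodule.map_mem_smul_top _ (K.subtype.restrictScalars Λ) hc
  -- K is a summand of a free bimodule. Extending the coordinates of the inclusion i to T and
  -- composing with p yields a bimodule retraction of T onto K.
  obtain ⟨n, p, i, -, -, hpi⟩ := Module.Finite.exists_comp_eq_id_of_projective R K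
  have hpi' : ∀ x, p (i x) = x := LinearMap.congr_fun hpi
  have hl : ∀ (j : Fin n) (a : Λ) (x : K), i (a • x) j = (a ⊗ₜ[k] (1 : Λᵐᵒᵖ)) * i x j :=
    fun j a x => by
      have h1 : i (a • x) = a • i x := map_smul (i.restrictScalars Λ) a x
      rw [h1, Pi.smul_apply, smul_enveloping]
  choose g hg hgl hgr using fun j => hext ((AddMonoidHom.mk' (fun x : K => i x j)
      fun x y => by rw [map_add]; rfl)) (hl j) (fun b t t' htt => by
        let u : K := t
        have h1 : t' = ((1 : Λ) ⊗ₜ[k] b) • u := Subtype.ext (htt.trans (hs1 b t).symm)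
        change i t' j = _ * i t j
        rw [h1, map_smul]
        rfl)
  let G : T →ₗ[R] (Fin n → R) := LinearMap.pi fun j => h.linearMap (g j)
    (fun a t => by rw [hgl, smul_enveloping])
    (fun b t => by
      change g j (((1 : Λ) ⊗ₜ[k] b) • t) = _
      rw [hs1, hgr]; rfl)
  have hG : ∀ x : K, G x = i x := fun x => funext fun j => hg j x
  let π : T →ₗ[R] K := p ∘ₗ G
  have hπ : ∀ x : K, π x = x := fun x => by
    change p (G x) = x
    rw [hG, hpi']
  let f : T →+ Λ × K := ε.toAddMonoidHom.prod π.toAddMonoidHom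
  have hbij : Function.Bijective f := by
    constructor
    · rw [injective_iff_map_eq_zero]
      intro t ht
      have h1 : ε t = 0 := congrArg Prod.fst ht
      have h2 : π t = 0 := congrArg Prod.snd ht
      have h3 := hπ ⟨t, h1⟩
      rw [h2] at h3
      exact congrArg Subtype.val h3.symm
    · rintro ⟨a, x⟩
      refine ⟨a • t₀ + (x - π (a • t₀) : K), Prod.ext ?_ ?_⟩
      · change ε _ = a
        rw [map_add, map_smul, ht₀, show ε ((x - π (a • t₀) : K) : T) = 0 from
          (x - π (a • t₀) : K).2, smul_eq_mul, mul_one, add_zero]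
      · change π _ = x
        rw [map_add, hπ, add_sub_cancel]
  refine ⟨K, inferInstance, inferInstance, inferInstance, inferInstance,
    AddEquiv.ofBijective f hbij, fun a a' t => Prod.ext ?_ ?_⟩
  · change ε _ = a * ε t * a'
    rw [map_smul, hεr, smul_eq_mul, mul_assoc]
  · change π _ = _ • π t
    rw [← map_smul, hs]

end

/-! ## Splitting stable isomorphisms -/

section

variable {S X H E Y : Type*} [Ring S] [AddCommGroup X] [Module S X] [AddCommGroup H] [Module S H]
  [AddCommGroup E] [Module S E] [AddCommGroup Y] [Module S Y]

/-- The cokernel of a stable isomorphism along which maps to free modules extend is projective. -/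
theorem FactorsThroughFree.projective_coker {u : X →ₗ[S] H} {g : H →ₗ[S] X}
    (h1 : FactorsThroughFree (g ∘ₗ u - LinearMap.id))
    (h2 : FactorsThroughFree (u ∘ₗ g - LinearMap.id))
    (hext : ∀ i : X →ₗ[S] S, ∃ i' : H →ₗ[S] S, i' ∘ₗ u = i) :
    Module.Projective S (H ⧸ LinearMap.range u) := by
  obtain ⟨n, i, p, hpi⟩ := h1
  -- Extending i along u permits a correction of g by a map through a free module, after which g' u
  -- is exactly the identity.
  choose i' hi' using fun j => hext (LinearMap.proj j ∘ₗ i)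
  have hi : LinearMap.pi i' ∘ₗ u = i := LinearMap.ext fun x => funext fun j =>
    LinearMap.congr_fun (hi' j) x
  let g' := g - p ∘ₗ LinearMap.pi i'
  have hg' : g' ∘ₗ u = LinearMap.id := by
    rw [LinearMap.sub_comp, LinearMap.comp_assoc, hi, hpi, sub_sub_cancel]
  have h3 : FactorsThroughFree (u ∘ₗ g' - LinearMap.id) := by
    have h4 : FactorsThroughFree ((u ∘ₗ p) ∘ₗ LinearMap.pi i') := ⟨n, _, _, rfl⟩
    have := h2.sub h4
    rwa [sub_right_comm, LinearMap.comp_assoc, ← LinearMap.comp_sub] at this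
  let Q := LinearMap.range u
  let σ : (H ⧸ Q) →ₗ[S] H := Q.liftQ (LinearMap.id - u ∘ₗ g') (by
    rintro _ ⟨x, rfl⟩
    change u x - u (g' (u x)) = 0
    rw [show g' (u x) = x from LinearMap.congr_fun hg' x, sub_self])
  have hu : ∀ x, Q.mkQ (u x) = 0 := fun x => (Submodule.Quotient.mk_eq_zero _).2 ⟨x, rfl⟩
  -- On the cokernel u g' − id acts as −id, so the identity of the cokernel factors through a free
  -- module.
  have key : ((Q.mkQ ∘ₗ (u ∘ₗ g' - LinearMap.id)) ∘ₗ (-σ)) = LinearMap.id := by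
    refine LinearMap.ext fun x => ?_
    obtain ⟨x, rfl⟩ := Q.mkQ_surjective x
    change Q.mkQ (u (g' (-(x - u (g' x)))) - -(x - u (g' x))) = Q.mkQ x
    rw [map_sub, hu, map_neg, map_sub, hu, sub_zero, zero_sub, neg_neg]
  refine FactorsThroughFree.projective ?_
  rw [← key]
  exact (h3.comp_left _).comp_right _

/-- An epimorphism that is a stable isomorphism splits. -/
theorem FactorsThroughFree.exists_section {ε : E →ₗ[S] Y} {h : Y →ₗ[S] E}
    (hε : Function.Surjective ε) (h1 : FactorsThroughFree (ε ∘ₗ h - LinearMap.id))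
    (h2 : FactorsThroughFree (h ∘ₗ ε - LinearMap.id)) :
    ∃ s : Y →ₗ[S] E, ε ∘ₗ s = LinearMap.id ∧ FactorsThroughFree (s ∘ₗ ε - LinearMap.id) := by
  obtain ⟨n, i, p, hpi⟩ := h1
  -- The error of h as a section passes through a free module, so it lifts along ε and can be
  -- subtracted.
  obtain ⟨p', hp'⟩ := Module.projective_lifting_property ε p hε
  refine ⟨h - p' ∘ₗ i, ?_, ?_⟩
  · rw [LinearMap.comp_sub, ← LinearMap.comp_assoc, hp', hpi, sub_sub_cancel]
  · have h4 : FactorsThroughFree (p' ∘ₗ (i ∘ₗ ε)) := ⟨n, _, _, rfl⟩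
    have := h2.sub h4
    rwa [sub_right_comm, ← LinearMap.comp_assoc, ← LinearMap.sub_comp] at this

/-- The kernel of an epimorphism that is a stable isomorphism is projective. -/
theorem FactorsThroughFree.projective_ker {ε : E →ₗ[S] Y} {s : Y →ₗ[S] E}
    (hs : ε ∘ₗ s = LinearMap.id) (h : FactorsThroughFree (s ∘ₗ ε - LinearMap.id)) :
    Module.Projective S (LinearMap.ker ε) := by
  let π : E →ₗ[S] LinearMap.ker ε := LinearMap.codRestrict _ (LinearMap.id - s ∘ₗ ε) fun x => by
    change ε (x - s (ε x)) = 0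
    rw [map_sub, show ε (s (ε x)) = ε x from LinearMap.congr_fun hs _, sub_self]
  have hπ : ∀ x : E, (π x : E) = x - s (ε x) := fun x => rfl
  have key : ((-π) ∘ₗ (s ∘ₗ ε - LinearMap.id)) ∘ₗ (LinearMap.ker ε).subtype = LinearMap.id := by
    refine LinearMap.ext fun x => Subtype.ext ?_
    change ((-π (s (ε x) - x) : LinearMap.ker ε) : E) = x
    rw [show ε x = 0 from x.2, map_zero, zero_sub, map_neg, neg_neg, hπ,
      show ε x = 0 from x.2, map_zero, sub_zero]
  refine FactorsThroughFree.projective ?_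
  rw [← key]
  exact (h.comp_left _).comp_right _

end

/-! ## The dual bimodule as a left module -/

namespace DualBimodule

variable {A B M : Type*} [Ring A] [Ring B] [AddCommGroup M] [Module Bᵐᵒᵖ M] [Module A M]
  [SMulCommClass A Bᵐᵒᵖ M]

/-- Linear maps as elements of the dual. -/
def of : (M →ₗ[Bᵐᵒᵖ] B) ≃+ DualBimodule B M := AddEquiv.refl _

theorem ext {f g : DualBimodule B M} (h : ∀ m, f m = g m) : f = g :=
  LinearMap.ext (f := of.symm f) (g := of.symm g) h

theorem apply_add (f : DualBimodule B M) (m m' : M) : f (m + m') = f m + f m' :=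
  map_add (of.symm f) m m'

theorem apply_smul (f : DualBimodule B M) (b : B) (m : M) : f (op b • m) = f m * b :=
  map_smul (of.symm f) (op b) m

theorem apply_sum (f : DualBimodule B M) {ι : Type*} (s : Finset ι) (m : ι → M) :
    f (∑ i ∈ s, m i) = ∑ i ∈ s, f (m i) :=
  map_sum (of.symm f) m s

theorem sum_apply {ι : Type*} (s : Finset ι) (f : ι → DualBimodule B M) (m : M) :
    (∑ i ∈ s, f i) m = ∑ i ∈ s, f i m :=
  LinearMap.sum_apply s (fun i => of.symm (f i)) m

theorem exists_dual_basis [Module.Finite Bᵐᵒᵖ M] [Module.Projective Bᵐᵒᵖ M] :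
    ∃ (n : ℕ) (m : Fin n → M) (ξ : Fin n → DualBimodule B M),
      (∀ v, ∑ j, op (ξ j v) • m j = v) ∧ ∀ f : DualBimodule B M, ∑ j, f (m j) • ξ j = f := by
  obtain ⟨n, m, ξ, h⟩ := exists_right_dual_basis B M
  refine ⟨n, m, fun j => of (ξ j), h, fun f => ext fun v => ?_⟩
  conv_rhs => rw [← h v, apply_sum]
  rw [sum_apply]
  exact Finset.sum_congr rfl fun j _ => (apply_smul f (ξ j v) (m j)).symm

theorem projective_left [Module.Finite Bᵐᵒᵖ M] [Module.Projective Bᵐᵒᵖ M] :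
    Module.Projective B (DualBimodule B M) := by
  obtain ⟨n, m, ξ, -, h⟩ := exists_dual_basis (B := B) (M := M)
  let i : DualBimodule B M →ₗ[B] (Fin n → B) :=
    { toFun := fun f j => f (m j)
      map_add' := fun f g => rfl
      map_smul' := fun b f => rfl }
  exact Module.Projective.of_split i (Fintype.linearCombination B ξ) (LinearMap.ext h)

theorem finite_left [Module.Finite Bᵐᵒᵖ M] [Module.Projective Bᵐᵒᵖ M] :
    Module.Finite B (DualBimodule B M) := by
  obtain ⟨n, m, ξ, -, h⟩ := exists_dual_basis (B := B) (M := M)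
  exact Module.Finite.of_surjective (Fintype.linearCombination B ξ) fun f => ⟨fun j => f (m j), h f⟩

end DualBimodule

namespace BalancedTensor

variable {A B M Y : Type*} [Ring A] [Ring B] [AddCommGroup M] [Module Bᵐᵒᵖ M] [Module A M]
  [SMulCommClass A Bᵐᵒᵖ M] [AddCommGroup Y] [Module Bᵐᵒᵖ Y]

theorem finite_left {R S X M : Type*} [Ring R] [Ring S] [AddCommGroup X] [Module Rᵐᵒᵖ X]
    [Module S X] [SMulCommClass S Rᵐᵒᵖ X] [AddCommGroup M] [Module R M] [Module.Finite R M]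
    [Module.Finite S X] : Module.Finite S (BalancedTensor R X M) := by
  obtain ⟨n, m, hm⟩ := Module.Finite.exists_fin (R := R) (M := M)
  let p : (Fin n → X) →ₗ[S] BalancedTensor R X M :=
    ∑ j, { toFun := fun x => tmul R (x j) (m j)
           map_add' := fun _ _ => add_tmul _ _ _
           map_smul' := fun _ _ => rfl }
  refine Module.Finite.of_surjective p fun t => ?_
  induction t using induction_on with
  | zero => exact ⟨0, map_zero _⟩
  | tmul x v =>
    have hv : v ∈ Submodule.span R (Set.range m) := hm ▸ Submodule.mem_top
    obtain ⟨c, rfl⟩ := (Submodule.mem_span_range_iff_exists_fun _).1 hv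
    refine ⟨fun j => op (c j) • x, ?_⟩
    simp only [p, LinearMap.sum_apply, tmul_sum]
    exact Finset.sum_congr rfl fun j _ => smul_tmul (c j) _ _
  | add a b ha hb =>
    obtain ⟨a, rfl⟩ := ha
    obtain ⟨b, rfl⟩ := hb
    exact ⟨a + b, map_add _ _ _⟩

variable (A B M Y) in
/-- The map `Y ⊗_B Hom_B(M, B) → Hom_B(M, Y)`. -/
def toHomRight : BalancedTensor B Y (DualBimodule B M) →ₗ[Aᵐᵒᵖ] HomRight B M Y :=
  liftRight (AddMonoidHom.mk' (fun y => AddMonoidHom.mk' (fun f => HomRight.of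
      { toFun := fun m => op (f m) • y
        map_add' := fun m m' => by rw [DualBimodule.apply_add, MulOpposite.op_add, add_smul]
        map_smul' := fun b m => by
          rw [← op_unop b, DualBimodule.apply_smul, op_mul, mul_smul]; rfl })
      fun f g => HomRight.ext fun m => add_smul (op (f m)) (op (g m)) y)
      fun y z => AddMonoidHom.ext fun f => HomRight.ext fun m => smul_add (op (f m)) y z)
    (fun y b f => HomRight.ext fun m => (mul_smul (op (f m)) (op b) y).symm)
    (fun y a f => rfl)

@[simp]
theorem toHomRight_tmul (y : Y) (f : DualBimodule B M) (m : M) :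
    toHomRight A B M Y (tmul B y f) m = op (f m) • y := rfl

/-- A dual basis of M gives the explicit left inverse f ↦ ∑ f(mⱼ) ⊗ ξⱼ, so elements of Y ⊗_B N are
determined by their values on M. -/
theorem toHomRight_sum {n : ℕ} {m : Fin n → M} {ξ : Fin n → DualBimodule B M}
    (h : ∀ f : DualBimodule B M, ∑ j, f (m j) • ξ j = f)
    (t : BalancedTensor B Y (DualBimodule B M)) :
    ∑ j, tmul B (toHomRight A B M Y t (m j)) (ξ j) = t := by
  induction t using induction_on with
  | zero =>
    refine Finset.sum_eq_zero fun j _ => ?_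
    rw [_root_.map_zero, HomRight.zero_apply, zero_tmul]
  | tmul y f =>
    conv_rhs => rw [← h f, tmul_sum]
    exact Finset.sum_congr rfl fun j _ => smul_tmul _ _ _
  | add a b ha hb =>
    conv_rhs => rw [← ha, ← hb, ← Finset.sum_add_distrib]
    refine Finset.sum_congr rfl fun j _ => ?_
    rw [map_add, HomRight.add_apply, add_tmul]

theorem toHomRight_surjective [Module.Finite Bᵐᵒᵖ M] [Module.Projective Bᵐᵒᵖ M] :
    Function.Surjective (toHomRight A B M Y) := fun f => by
  obtain ⟨n, m, ξ, h, -⟩ := DualBimodule.exists_dual_basis (B := B) (M := M)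
  refine ⟨∑ j, tmul B (f (m j)) (ξ j), HomRight.ext fun v => ?_⟩
  have h1 : ∀ (s : Finset (Fin n)), toHomRight A B M Y (∑ j ∈ s, tmul B (f (m j)) (ξ j)) v =
      ∑ j ∈ s, op (ξ j v) • f (m j) := fun s => by
    classical
    induction s using Finset.induction_on with
    | empty => rw [Finset.sum_empty, Finset.sum_empty, map_zero, HomRight.zero_apply]
    | insert j s hj hs =>
      rw [Finset.sum_insert hj, Finset.sum_insert hj, map_add, HomRight.add_apply, hs,
        toHomRight_tmul]
  rw [h1]
  conv_rhs => rw [← h v, HomRight.apply_sum]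
  exact Finset.sum_congr rfl fun j _ => (HomRight.apply_smul f _ _).symm

theorem toHomRight_smul [Module A Y] [SMulCommClass A Bᵐᵒᵖ Y] (a : A)
    (t : BalancedTensor B Y (DualBimodule B M)) (m : M) :
    toHomRight A B M Y (a • t) m = a • toHomRight A B M Y t m := by
  induction t using induction_on with
  | zero => rw [smul_zero, map_zero, HomRight.zero_apply, smul_zero]
  | tmul y f => exact (smul_comm a (op (f m)) y).symm
  | add s t hs ht =>
    rw [smul_add, map_add, HomRight.add_apply, hs, ht, map_add, HomRight.add_apply, smul_add]

variable (A B M Y) in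
/-- `Y ⊗_B Hom_B(M, B) ≅ Hom_B(M, Y)` if `M` is finitely generated projective. -/
noncomputable def toHomRightEquiv [Module.Finite Bᵐᵒᵖ M] [Module.Projective Bᵐᵒᵖ M] :
    BalancedTensor B Y (DualBimodule B M) ≃ₗ[Aᵐᵒᵖ] HomRight B M Y :=
  LinearEquiv.ofBijective (toHomRight A B M Y) ⟨fun s t h => by
    obtain ⟨n, m, ξ, -, hξ⟩ := DualBimodule.exists_dual_basis (B := B) (M := M)
    rw [← toHomRight_sum (A := A) hξ s, h, toHomRight_sum hξ], toHomRight_surjective⟩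

end BalancedTensor

/-! ## The bimodule `M ⊗_B N` -/

/-- A two-sided ideal as a right ideal. -/
def Ideal.toRight {R : Type*} [Ring R] (I : Ideal R) [I.IsTwoSided] : Submodule Rᵐᵒᵖ R :=
  { I.toAddSubmonoid with smul_mem' := fun r _ hx => I.mul_mem_right r.unop hx }

theorem Ideal.mkQ_toRight_eq_zero {R : Type*} [Ring R] (I : Ideal R) [I.IsTwoSided] {x : R} :
    I.toRight.mkQ x = 0 ↔ x ∈ I := Submodule.Quotient.mk_eq_zero _

theorem Ideal.mkQ_toRight_one_smul {R : Type*} [Ring R] (I : Ideal R) [I.IsTwoSided] (x : R) :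
    op x • I.toRight.mkQ 1 = I.toRight.mkQ x := by
  rw [← map_smul, op_smul_eq_mul, one_mul]

namespace BalancedTensor

variable {R M : Type*} [Ring R] [AddCommGroup M] [Module R M] (I : Ideal R) [I.IsTwoSided]

/-- The map `R ⧸ I ⊗_R M → M ⧸ I M`. -/
def quotientTensor : BalancedTensor R (R ⧸ I.toRight) M →+ M ⧸ (I • (⊤ : Submodule R M)) :=
  lift (QuotientAddGroup.lift I.toRight.toAddSubgroup
    (AddMonoidHom.mk' (fun a => (I • (⊤ : Submodule R M)).mkQ.toAddMonoidHom.comp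
      (DistribSMul.toAddMonoidHom M a))
      fun a b => AddMonoidHom.ext fun m =>
        (congrArg _ (add_smul a b m)).trans (map_add (I • (⊤ : Submodule R M)).mkQ _ _))
    fun x hx => AddMonoidHom.ext fun m => (Submodule.Quotient.mk_eq_zero _).2
      (Submodule.smul_mem_smul (show x ∈ I from hx) trivial))
    fun x r m => by
      obtain ⟨x, rfl⟩ := I.toRight.mkQ_surjective x
      exact congrArg (I • (⊤ : Submodule R M)).mkQ (mul_smul x r m)

theorem tmul_mkQ_one_eq_zero {m : M} :
    tmul R (I.toRight.mkQ 1) m = 0 ↔ m ∈ I • (⊤ : Submodule R M) := by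
  constructor
  · intro h
    have h1 : quotientTensor I (tmul R (I.toRight.mkQ 1) m) = 0 := by rw [h, map_zero]
    have h2 : (I • (⊤ : Submodule R M)).mkQ ((1 : R) • m) = 0 := h1
    rw [one_smul] at h2
    exact (Submodule.Quotient.mk_eq_zero _).1 h2
  · intro h
    refine Submodule.smul_induction_on h (fun j hj m _ => ?_) fun m m' hm hm' => ?_
    · rw [← smul_tmul, I.mkQ_toRight_one_smul, I.mkQ_toRight_eq_zero.2 hj, zero_tmul]
    · rw [tmul_add, hm, hm', add_zero]

theorem inc_mkQ_one_surjective {S : Type*} [Ring S] [Module Sᵐᵒᵖ M] [SMulCommClass R Sᵐᵒᵖ M] :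
    Function.Surjective (inc (R := R) S M (I.toRight.mkQ 1)) := fun t => by
  induction t using induction_on with
  | zero => exact ⟨0, map_zero _⟩
  | tmul x m =>
    obtain ⟨x, rfl⟩ := I.toRight.mkQ_surjective x
    exact ⟨x • m, by rw [inc_apply, ← smul_tmul, I.mkQ_toRight_one_smul]⟩
  | add a b ha hb =>
    obtain ⟨a, rfl⟩ := ha
    obtain ⟨b, rfl⟩ := hb
    exact ⟨a + b, map_add _ _ _⟩

end BalancedTensor

namespace TensorInducesKatoEquivalence

open BalancedTensor HomRight

section

variable {A B M : Type u} [Ring A] [Ring B] [AddCommGroup M] [Module A M] [Module Bᵐᵒᵖ M]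
  [SMulCommClass A Bᵐᵒᵖ M] [IsNoetherianRing A] [IsNoetherianRing Aᵐᵒᵖ] [Module.Finite Bᵐᵒᵖ M]
  [Module.Projective Bᵐᵒᵖ M] [Module.Finite Aᵐᵒᵖ (DualBimodule B M)]
  [Module.Projective Aᵐᵒᵖ (DualBimodule B M)]

/-- The unit is injective up to a projective cokernel. -/
theorem projective_coker_unit (hM : TensorInducesKatoEquivalence A B M) (hA : NoRegularBlock A)
    (X : Type u) [AddCommGroup X] [Module Aᵐᵒᵖ X] [Module.Finite Aᵐᵒᵖ X] :
    Module.Projective Aᵐᵒᵖ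
      (HomRight B M (BalancedTensor A X M) ⧸ LinearMap.range (HomRight.unit A B M X)) := by
  obtain ⟨g, -, h1, h2⟩ := hM.unit_stable X
  obtain ⟨n, ν, ψ, hψ⟩ := hM.exists_right_trace hA
  refine h1.projective_coker h2 fun i => ?_
  let i₀ : X →ₗ[Aᵐᵒᵖ] A := (opUnopLinearEquiv A).toLinearMap ∘ₗ i
  -- The form i₀ contracts X ⊗_A M to M; following it by νₗ gives cₗ : Hom_B(M, X ⊗_A M) → N. On the
  -- image of x this is νₗ i₀(x), so the trace identity ∑ ψₗ(νₗ) = 1 recovers i₀.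
  let c : Fin n → HomRight B M (BalancedTensor A X M) →ₗ[Aᵐᵒᵖ] DualBimodule B M := fun l =>
    { toFun := fun f => DualBimodule.of
        (DualBimodule.of.symm (ν l) ∘ₗ contract (S := B) i₀ ∘ₗ HomRight.of.symm f)
      map_add' := fun f g => DualBimodule.ext fun m =>
        (congrArg (ν l) (map_add (contract (S := B) i₀) (f m) (g m))).trans
          (DualBimodule.apply_add _ _ _)
      map_smul' := fun a f => rfl }
  have hc : ∀ l x, c l (HomRight.unit A B M X x) = op (i₀ x) • ν l := fun l x => rfl
  refine ⟨(opUnopLinearEquiv A).symm.toLinearMap ∘ₗ ∑ l, ψ l ∘ₗ c l, LinearMap.ext fun x => ?_⟩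
  have h3 : (∑ l, ψ l ∘ₗ c l) (HomRight.unit A B M X x) = i₀ x := by
    rw [LinearMap.sum_apply]
    simp_rw [LinearMap.comp_apply, hc, map_smul, ← Finset.smul_sum]
    rw [hψ, op_smul_eq_mul, one_mul]
  exact (congrArg (opUnopLinearEquiv A).symm h3).trans ((opUnopLinearEquiv A).symm_apply_apply _)

end

variable {k A B M : Type u} [Field k] [Ring A] [Algebra k A] [Ring B] [Algebra k B]
  [AddCommGroup M] [Module A M] [Module Bᵐᵒᵖ M]
  [SMulCommClass A Bᵐᵒᵖ M] [IsNoetherianRing A] [IsNoetherianRing Aᵐᵒᵖ] [Module.Finite Bᵐᵒᵖ M]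
  [Module.Projective Bᵐᵒᵖ M] [Module.Finite Aᵐᵒᵖ (DualBimodule B M)]
  [Module.Projective Aᵐᵒᵖ (DualBimodule B M)] [Module.Finite A M] [Module.Projective A M]

/-- `M ⊗_B N` is the sum of `A` and a projective bimodule. -/
theorem isRegularPlusProjective_tensor_dual (hM : TensorInducesKatoEquivalence A B M)
    (hA : NoRegularBlock A) (hsep : IsSeparableAlgebra k (A ⧸ Ring.jacobson A))
    (hnil : IsNilpotent (Ring.jacobson A))
    (hk : ∀ (r : k) (m : M), algebraMap k A r • m = op (algebraMap k B r) • m) :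
    IsRegularPlusProjective k A (BalancedTensor B M (DualBimodule B M)) := by
  let r := Ring.jacobson A
  let T := BalancedTensor B M (DualBimodule B M)
  -- Through θ the bimodule T is End_B(M), and t₀ below is the identity of M.
  let θ := toHomRight A B M M
  obtain ⟨n, m, ξ, -, hξ⟩ := DualBimodule.exists_dual_basis (B := B) (M := M)
  have hθinj : ∀ s t : T, (∀ v, θ s v = θ t v) → s = t := fun s t h => by
    rw [← toHomRight_sum (A := A) hξ s, ← toHomRight_sum (A := A) hξ t]
    exact Finset.sum_congr rfl fun j _ => congrArg (fun v => tmul B v (ξ j)) (h _)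
  obtain ⟨t₀, ht₀⟩ := toHomRight_surjective (A := A) (HomRight.of (LinearMap.id : M →ₗ[Bᵐᵒᵖ] M))
  have ht₀' : ∀ v, θ t₀ v = v := fun v => DFunLike.congr_fun ht₀ v
  have hθl : ∀ (a : A) t v, θ (a • t) v = a • θ t v := toHomRight_smul
  have hθr : ∀ (a : A) t v, θ (op a • t) v = θ t (a • v) := fun a t v => by
    rw [map_smul]; rfl
  have hθt₀ : ∀ (a : A) v, θ (a • t₀) v = a • v := fun a v => by rw [hθl, ht₀']
  -- Here X ⊗_A M is M/rM and β is reduction End_B(M) → Hom_B(M, M/rM), with kernel rT. It carries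
  -- At₀ to the image of the unit at A/r, so T/(At₀ + rT) is the cokernel of that unit.
  let X := A ⧸ r.toRight
  let x₁ : X := r.toRight.mkQ 1
  let β : T →ₗ[Aᵐᵒᵖ] HomRight B M (BalancedTensor A X M) :=
    HomRight.map A M (inc B M x₁) ∘ₗ θ
  have hβ : ∀ t v, β t v = tmul A x₁ (θ t v) := fun t v => rfl
  have hβt₀ : ∀ a : A, β (a • t₀) = HomRight.unit A B M X (r.toRight.mkQ a) := fun a =>
    HomRight.ext fun v => by
      rw [hβ, hθt₀, ← BalancedTensor.smul_tmul, r.mkQ_toRight_one_smul, HomRight.unit_apply]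
  have hβs : Function.Surjective β :=
    (HomRight.map_surjective (A := A) (inc_mkQ_one_surjective (S := B) (M := M) r)).comp
      toHomRight_surjective
  obtain ⟨l, m', φ, hφ⟩ := hM.exists_left_trace hA
  -- The trace identity ∑ φⱼ(m'ⱼ) = 1 makes t ↦ ∑ φⱼ(t m'ⱼ) a left linear retraction with value 1 at
  -- the identity.
  let τ : T →ₗ[A] A :=
    ∑ j, φ j ∘ₗ
      { toFun := fun t => θ t (m' j)
        map_add' := fun s t => by rw [_root_.map_add, HomRight.add_apply]
        map_smul' := fun a t => hθl a t _ }
  have := DualBimodule.projective_left (B := B) (M := M)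
  have := DualBimodule.finite_left (B := B) (M := M)
  have : Module.Projective A T := BalancedTensor.projective_left
  have : Module.Finite A T := BalancedTensor.finite_left
  have := hM.projective_coker_unit hA X
  have hβ0 : ∀ t ∈ r • (⊤ : Submodule A T), β t = 0 := fun t ht => by
    refine Submodule.smul_induction_on ht (fun j hj t _ => HomRight.ext fun v => ?_)
      fun s t hs ht => by rw [_root_.map_add, hs, ht, add_zero]
    rw [hβ, hθl, HomRight.zero_apply]
    exact (tmul_mkQ_one_eq_zero r).2 (Submodule.smul_mem_smul hj trivial)
  refine isRegularPlusProjective_of_unit hsep hnil (fun c t => ?_) t₀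
    (fun a => hθinj _ _ fun v => by rw [hθt₀, hθr, ht₀']) τ ?_
    ((LinearMap.range (HomRight.unit A B M X)).mkQ ∘ₗ β).toAddMonoidHom
    ((Submodule.mkQ_surjective _).comp hβs)
    (fun b t => map_smul ((LinearMap.range (HomRight.unit A B M X)).mkQ ∘ₗ β) b t) fun t => ?_
  · refine hθinj _ _ fun v => ?_
    have h1 : θ (algebraMap k Aᵐᵒᵖ c • t) v = θ t (algebraMap k A c • v) := hθr _ t v
    rw [h1, hθl, hk, hk, HomRight.apply_smul]
  · simp only [τ, LinearMap.sum_apply]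
    rw [← hφ]
    exact Finset.sum_congr rfl fun j _ => congrArg (φ j) (ht₀' _)
  · refine (Submodule.Quotient.mk_eq_zero _).trans ⟨?_, ?_⟩
    · rintro ⟨x, hx⟩
      obtain ⟨a, rfl⟩ := r.toRight.mkQ_surjective x
      refine ⟨a, ?_⟩
      have h1 : β (t - a • t₀) = 0 := by
        rw [_root_.map_sub, hβt₀, sub_eq_zero]
        exact hx.symm
      have h2 : ∀ v, θ (t - a • t₀) v ∈ r • (⊤ : Submodule A M) := fun v =>
        (tmul_mkQ_one_eq_zero r).1 (DFunLike.congr_fun h1 v)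
      rw [← toHomRight_sum (A := A) hξ (t - a • t₀)]
      refine sum_mem fun j _ => ?_
      let ι : M →ₗ[A] T :=
        { toFun := fun v => tmul B v (ξ j)
          map_add' := fun v w => BalancedTensor.add_tmul v w _
          map_smul' := fun a v => rfl }
      exact Submodule.map_mem_smul_top r ι (h2 (m j))
    · rintro ⟨a, ha⟩
      refine ⟨r.toRight.mkQ a, ?_⟩
      rw [← hβt₀, ← sub_eq_zero, ← _root_.map_sub, ← neg_sub, map_neg, neg_eq_zero]
      exact hβ0 _ ha

end TensorInducesKatoEquivalence

/-! ## Extending bimodule maps to the enveloping algebra -/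

/-- The `k`-dual of a `k`-algebra, a right module. -/
def KDual (k B : Type*) [Field k] [Ring B] [Algebra k B] : Type _ := B →ₗ[k] k

namespace KDual

variable {k B : Type*} [Field k] [Ring B] [Algebra k B]

instance : AddCommGroup (KDual k B) := inferInstanceAs (AddCommGroup (B →ₗ[k] k))

instance : Module k (KDual k B) := inferInstanceAs (Module k (B →ₗ[k] k))

/-- Functionals as elements of `KDual`. -/
def of : (B →ₗ[k] k) ≃ₗ[k] KDual k B := LinearEquiv.refl _ _

theorem ext {v w : KDual k B} (h : ∀ x, of.symm v x = of.symm w x) : v = w :=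
  LinearMap.ext (f := of.symm v) (g := of.symm w) h

instance : Module Bᵐᵒᵖ (KDual k B) where
  smul b w := of (of.symm w ∘ₗ LinearMap.mulLeft k b.unop)
  one_smul w := ext fun x => congrArg (of.symm w) (one_mul x)
  mul_smul b c w := ext fun x => congrArg (of.symm w) (mul_assoc c.unop b.unop x)
  smul_zero _ := rfl
  smul_add _ _ _ := rfl
  add_smul b c w := ext fun x =>
    (congrArg (of.symm w) (add_mul b.unop c.unop x)).trans (map_add (of.symm w) _ _)
  zero_smul w := ext fun x => (congrArg (of.symm w) (zero_mul x)).trans (map_zero (of.symm w))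

theorem smul_apply (b : Bᵐᵒᵖ) (w : KDual k B) (x : B) :
    of.symm (b • w) x = of.symm w (b.unop * x) := rfl

theorem algebraMap_smul (c : k) (w : KDual k B) : op (algebraMap k B c) • w = c • w :=
  ext fun x => by
    rw [smul_apply, unop_op, ← Algebra.smul_def, map_smul, map_smul]
    rfl

instance : IsScalarTower k Bᵐᵒᵖ (KDual k B) where
  smul_assoc c b w := ext fun x => by
    rw [smul_apply, unop_smul, smul_mul_assoc, map_smul, map_smul]
    rfl

instance [Module.Finite k B] : Module.Finite Bᵐᵒᵖ (KDual k B) :=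
  haveI : Module.Finite k (KDual k B) := inferInstanceAs (Module.Finite k (Module.Dual k B))
  Module.Finite.of_restrictScalars_finite k Bᵐᵒᵖ (KDual k B)

/-- The pairing `⟨w, x ⊗ y⟩ = w(x) y`. -/
def pair (w : KDual k B) : B ⊗[k] Bᵐᵒᵖ →ₗ[k] B :=
  TensorProduct.lift (LinearMap.mk₂ k (fun x y => of.symm w x • y.unop)
    (fun x x' y => by rw [map_add, add_smul])
    (fun c x y => by rw [map_smul, smul_assoc])
    (fun x y y' => by rw [MulOpposite.unop_add, smul_add])
    (fun c x y => by rw [unop_smul, smul_comm]))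

@[simp]
theorem pair_tmul (w : KDual k B) (x : B) (y : Bᵐᵒᵖ) : pair w (x ⊗ₜ y) = of.symm w x • y.unop := rfl

theorem pair_add (v w : KDual k B) (u : B ⊗[k] Bᵐᵒᵖ) : pair (v + w) u = pair v u + pair w u := by
  induction u using TensorProduct.induction_on with
  | zero => simp
  | tmul x y => rw [pair_tmul, map_add, LinearMap.add_apply, add_smul]; rfl
  | add u u' h h' => rw [map_add, h, h', map_add, map_add, add_add_add_comm]

theorem pair_smul (w : KDual k B) (b : B) (u : B ⊗[k] Bᵐᵒᵖ) :
    pair (op b • w) u = pair w ((b ⊗ₜ[k] 1) * u) := by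
  induction u using TensorProduct.induction_on with
  | zero => rw [mul_zero, map_zero, map_zero]
  | tmul x y =>
    rw [Algebra.TensorProduct.tmul_mul_tmul, one_mul, pair_tmul, pair_tmul, smul_apply, unop_op]
  | add u u' h h' => rw [map_add, h, h', mul_add, map_add]

theorem pair_mul (w : KDual k B) (b : Bᵐᵒᵖ) (u : B ⊗[k] Bᵐᵒᵖ) :
    pair w (((1 : B) ⊗ₜ[k] b) * u) = pair w u * b.unop := by
  induction u using TensorProduct.induction_on with
  | zero => rw [mul_zero, map_zero, zero_mul]
  | tmul x y =>
    rw [Algebra.TensorProduct.tmul_mul_tmul, one_mul, pair_tmul, pair_tmul, unop_mul,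
      smul_mul_assoc]
  | add u u' h h' => rw [map_add, add_mul, mul_add, map_add, h, h']

/-- The pairing identifies B ⊗ Bᵐᵒᵖ with Hom_k(W, B) for the k-dual W of B; this is its inverse in
terms of a basis. -/
theorem sum_pair {ι : Type*} [Fintype ι] (β : Module.Basis ι k B) (u : B ⊗[k] Bᵐᵒᵖ) :
    ∑ i, β i ⊗ₜ[k] op (pair (of (β.coord i)) u) = u := by
  induction u using TensorProduct.induction_on with
  | zero => simp
  | tmul x y =>
    conv_rhs => rw [← β.sum_repr x, TensorProduct.sum_tmul]
    refine Finset.sum_congr rfl fun i _ => ?_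
    rw [pair_tmul, op_smul, TensorProduct.smul_tmul]
    rfl
  | add u u' h h' =>
    simp_rw [map_add, MulOpposite.op_add, TensorProduct.tmul_add, Finset.sum_add_distrib]
    rw [h, h']

end KDual

namespace BalancedTensor

section

variable {R X M M' : Type*} [Ring R] [AddCommGroup X] [Module Rᵐᵒᵖ X]
  [AddCommGroup M] [Module R M] [AddCommGroup M'] [Module R M']

variable (X) in
/-- Functoriality of the tensor product in the second variable. -/
def mapLeft (f : M →ₗ[R] M') : BalancedTensor R X M →+ BalancedTensor R X M' :=
  map LinearMap.id f

end

/-- If `W ⊗_B Z → W` splits for the `k`-dual `W` of `B`, then bimodule maps from the kernel of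
`ε : Z → B` to the enveloping algebra extend to `Z`. -/
theorem exists_extension {k B Z : Type*} [Field k] [Ring B] [Algebra k B] [Module.Finite k B]
    [AddCommGroup Z] [Module B Z] [Module Bᵐᵒᵖ Z] [SMulCommClass B Bᵐᵒᵖ Z]
    (hc : ∀ (c : k) (z : Z), algebraMap k B c • z = algebraMap k Bᵐᵒᵖ c • z)
    (ε : Z →ₗ[B] B) (hεr : ∀ (b : B) z, ε (op b • z) = ε z * b) (z₀ : Z) (hz₀ : ε z₀ = 1)
    (p : BalancedTensor B (KDual k B) Z →ₗ[Bᵐᵒᵖ] KDual k B)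
    (hp : ∀ w z, p (tmul B w z) = op (ε z) • w)
    (s : KDual k B →ₗ[Bᵐᵒᵖ] BalancedTensor B (KDual k B) Z) (hs : p ∘ₗ s = LinearMap.id)
    (f : LinearMap.ker ε →+ B ⊗[k] Bᵐᵒᵖ)
    (hfl : ∀ (b : B) z, f (b • z) = (b ⊗ₜ[k] (1 : Bᵐᵒᵖ)) * f z)
    (hfr : ∀ (b : Bᵐᵒᵖ) (z z' : LinearMap.ker ε), (z' : Z) = b • (z : Z) →
      f z' = ((1 : B) ⊗ₜ[k] b) * f z) :
    ∃ g : Z →+ B ⊗[k] Bᵐᵒᵖ, (∀ z : LinearMap.ker ε, g z = f z) ∧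
      (∀ (b : B) z, g (b • z) = (b ⊗ₜ[k] (1 : Bᵐᵒᵖ)) * g z) ∧
      (∀ (b : Bᵐᵒᵖ) z, g (b • z) = ((1 : B) ⊗ₜ[k] b) * g z) := by
  let W := KDual k B
  let K := LinearMap.ker ε
  let ρ : Z →ₗ[B] K := LinearMap.codRestrict K
    (LinearMap.id - LinearMap.toSpanSingleton B Z z₀ ∘ₗ ε) fun z => by
      change ε (z - ε z • z₀) = 0
      rw [map_sub, map_smul, hz₀, smul_eq_mul, mul_one, sub_self]
  have hρ : ∀ x : K, ρ x = x := fun x => Subtype.ext (by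
    change (x : Z) - ε x • z₀ = x
    rw [show ε x = 0 from x.2, zero_smul, sub_zero])
  have hρz : ∀ z, (ρ z : Z) = z - ε z • z₀ := fun z => rfl
  -- Under B ⊗ Bᵐᵒᵖ ≅ Hom_k(W, B), the bimodule map f corresponds to Θ : w ⊗ z ↦ ⟨w, f(z)⟩ on W ⊗_B
  -- K.
  let Θ : BalancedTensor B W K →+ B := lift (AddMonoidHom.mk' (fun w =>
      (KDual.pair w).toAddMonoidHom.comp f)
      fun v w => AddMonoidHom.ext fun z => KDual.pair_add v w _)
    fun w b z => by
      change KDual.pair (op b • w) (f z) = KDual.pair w (f (b • z))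
      rw [hfl, KDual.pair_smul]
  have hΘ : ∀ (w : W) (z : K), Θ (tmul B w z) = KDual.pair w (f z) := fun w z => rfl
  let inc : BalancedTensor B W K →+ BalancedTensor B W Z := mapLeft W K.subtype
  -- On the left Z = K ⊕ Bz₀, so each x is an element coming from W ⊗_B K plus p(x) ⊗ z₀. Hence ker
  -- p comes from W ⊗_B K.
  have hrange : ∀ x, ∃ w, x - inc (mapLeft W ρ x) = tmul B w z₀ ∧ w = p x := fun x => by
    induction x using induction_on with
    | zero => exact ⟨0, by simp [zero_tmul], by simp⟩
    | tmul w z =>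
      refine ⟨op (ε z) • w, ?_, (hp w z).symm⟩
      rw [smul_tmul]
      change tmul B w z - tmul B w (ρ z : Z) = _
      rw [hρz, sub_eq_iff_eq_add, ← tmul_add, add_sub_cancel]
    | add x y hx hy =>
      obtain ⟨v, hv, hv'⟩ := hx
      obtain ⟨w, hw, hw'⟩ := hy
      refine ⟨v + w, ?_, by rw [map_add, hv', hw']⟩
      rw [map_add, map_add, add_sub_add_comm, hv, hw, add_tmul]
  have hker : ∀ x, p x = 0 → inc (mapLeft W ρ x) = x := fun x hx => by
    obtain ⟨w, hw, hw'⟩ := hrange x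
    rw [hw', hx, zero_tmul, sub_eq_zero] at hw
    exact hw.symm
  -- `Θ` is right linear on the kernel of `p`
  have hΘr : ∀ (b : Bᵐᵒᵖ) x, p x = 0 → Θ (mapLeft W ρ (b • x)) = Θ (mapLeft W ρ x) * b.unop := by
    have h1 : ∀ (b : Bᵐᵒᵖ) y, Θ (mapLeft W ρ (b • inc y)) = Θ y * b.unop := fun b y => by
      induction y using induction_on with
      | zero => simp
      | tmul w z =>
        have h2 : ε (b • (z : Z)) = 0 := by
          rw [← op_unop b, hεr, show ε z = 0 from z.2, zero_mul]
        change Θ (tmul B w (ρ (b • (z : Z)))) = _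
        have h3 : ρ (b • (z : Z)) = ⟨b • (z : Z), h2⟩ := hρ ⟨_, h2⟩
        rw [h3, hΘ, hΘ, hfr b z ⟨_, h2⟩ rfl, KDual.pair_mul]
      | add x y hx hy => rw [map_add, smul_add, map_add, map_add, hx, hy, map_add, add_mul]
    intro b x hx
    conv_lhs => rw [← hker x hx]
    rw [h1]
  -- The projection 1 − sp onto ker p is right linear, unlike the one induced by ρ, so Θ' is a right
  -- linear extension of Θ.
  let Θ' : BalancedTensor B W Z →+ B :=
    Θ.comp ((mapLeft W ρ).comp (LinearMap.id - s ∘ₗ p).toAddMonoidHom)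
  have hΘ'x : ∀ x, Θ' x = Θ (mapLeft W ρ (x - s (p x))) := fun x => rfl
  have hpx : ∀ x, p (x - s (p x)) = 0 := fun x => by
    rw [map_sub, show p (s (p x)) = p x from LinearMap.congr_fun hs _, sub_self]
  have hΘ'r : ∀ (b : Bᵐᵒᵖ) x, Θ' (b • x) = Θ' x * b.unop := fun b x => by
    rw [hΘ'x, hΘ'x, map_smul, map_smul, ← smul_sub, hΘr _ _ (hpx x)]
  have hΘ'K : ∀ w (z : K), Θ' (tmul B w (z : Z)) = KDual.pair w (f z) := fun w z => by
    have h1 : p (tmul B w (z : Z)) = 0 := by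
      rw [hp, show ε z = 0 from z.2, op_zero, zero_smul]
    rw [hΘ'x, h1, map_zero, sub_zero, ← hΘ]
    exact congrArg Θ (congrArg (tmul B w) (hρ z))
  have hΘ'k : ∀ (c : k) w z, Θ' (tmul B (c • w) z) = c • Θ' (tmul B w z) := fun c w z => by
    rw [← KDual.algebraMap_smul, smul_tmul, hc]
    refine (hΘ'r (algebraMap k Bᵐᵒᵖ c) (tmul B w z)).trans ?_
    rw [Algebra.smul_def, Algebra.commutes]
    rfl
  let β := Module.finBasis k B
  let w : Fin (Module.finrank k B) → W := fun i => KDual.of (β.coord i)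
  let g : Z →+ B ⊗[k] Bᵐᵒᵖ := AddMonoidHom.mk' (fun z => ∑ i, β i ⊗ₜ[k] op (Θ' (tmul B (w i) z)))
    fun z z' => by
      simp_rw [tmul_add, map_add, MulOpposite.op_add, TensorProduct.tmul_add,
        Finset.sum_add_distrib]
  have hg : ∀ z, g z = ∑ i, β i ⊗ₜ[k] op (Θ' (tmul B (w i) z)) := fun z => rfl
  refine ⟨g, fun z => ?_, fun b z => ?_, fun b z => ?_⟩
  · rw [hg]
    simp_rw [hΘ'K]
    exact KDual.sum_pair β (f z)
  -- The right action of b on the dual basis has the matrix of left multiplication by b on the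
  -- basis; this turns balancedness of the tensors into left linearity of g.
  · have h1 : ∀ i, op b • w i = ∑ j, β.coord i (b * β j) • w j := fun i => by
      refine KDual.of.symm.injective (β.ext fun l => ?_)
      rw [map_sum, LinearMap.sum_apply]
      change β.coord i (b * β l) = ∑ j, β.coord i (b * β j) * β.coord j (β l)
      simp [Finsupp.single_apply]
    rw [hg, hg, Finset.mul_sum]
    simp_rw [← smul_tmul, h1, sum_tmul, map_sum, hΘ'k, Finset.op_sum, MulOpposite.op_smul,
      TensorProduct.tmul_sum]
    rw [Finset.sum_comm]
    refine Finset.sum_congr rfl fun j _ => ?_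
    rw [Algebra.TensorProduct.tmul_mul_tmul, one_mul]
    conv_rhs => rw [← β.sum_repr (b * β j), TensorProduct.sum_tmul]
    exact Finset.sum_congr rfl fun i _ => (TensorProduct.smul_tmul _ _ _).symm
  · rw [hg, hg, Finset.mul_sum]
    refine Finset.sum_congr rfl fun i _ => ?_
    rw [Algebra.TensorProduct.tmul_mul_tmul, one_mul, ← right_smul_tmul, hΘ'r]
    rfl

end BalancedTensor

/-! ## The bimodule `N ⊗_A M` -/

namespace DualBimodule

variable {A B M : Type*} [Ring A] [Ring B] [AddCommGroup M] [Module A M] [Module Bᵐᵒᵖ M]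
  [SMulCommClass A Bᵐᵒᵖ M]

variable (A B M) in
/-- The evaluation map `N ⊗_A M → B`. -/
def evaluation : BalancedTensor A (DualBimodule B M) M →ₗ[B] B :=
  BalancedTensor.liftLeft
    (AddMonoidHom.mk' (fun f => (of.symm f).toAddMonoidHom) fun _ _ => rfl)
    (fun _ _ _ => rfl) (fun _ _ _ => rfl)

theorem evaluation_op_smul (b : B) (z : BalancedTensor A (DualBimodule B M) M) :
    evaluation A B M (op b • z) = evaluation A B M z * b := by
  induction z using BalancedTensor.induction_on with
  | zero => rw [smul_zero, map_zero, zero_mul]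
  | tmul f m => exact apply_smul f b m
  | add x y hx hy => rw [smul_add, map_add, hx, hy, map_add, add_mul]

variable (A M) in
/-- The map `Hom_B(M, B) → Hom_B(M, Y)` induced by `B → Y`. -/
def mapHomRight {Y : Type*} [AddCommGroup Y] [Module Bᵐᵒᵖ Y] (g : B →ₗ[Bᵐᵒᵖ] Y) :
    DualBimodule B M →ₗ[Aᵐᵒᵖ] HomRight B M Y where
  toFun f := HomRight.of (g ∘ₗ of.symm f)
  map_add' _ _ := HomRight.ext fun _ => map_add g _ _
  map_smul' _ _ := rfl

theorem mapHomRight_surjective [Module.Projective Bᵐᵒᵖ M] {Y : Type*} [AddCommGroup Y]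
    [Module Bᵐᵒᵖ Y] {g : B →ₗ[Bᵐᵒᵖ] Y} (hg : Function.Surjective g) :
    Function.Surjective (mapHomRight A M g) := fun f => by
  obtain ⟨h, hh⟩ := Module.projective_lifting_property g (HomRight.of.symm f) hg
  exact ⟨of h, hh⟩

theorem counit_mapRight_mapHomRight {Y : Type*} [AddCommGroup Y] [Module Bᵐᵒᵖ Y]
    (g : B →ₗ[Bᵐᵒᵖ] Y) (z : BalancedTensor A (DualBimodule B M) M) :
    HomRight.counit A B M Y (BalancedTensor.mapRight B M (mapHomRight A M g) z) =
      g (evaluation A B M z) := by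
  induction z using BalancedTensor.induction_on with
  | zero => simp only [map_zero]
  | tmul f m => rfl
  | add x y hx hy => simp only [map_add, hx, hy]

/-- The kernel of `N ⊗_A M → Hom_B(M, B ⧸ I) ⊗_A M`. -/
theorem mapRight_mapHomRight_mkQ_eq_zero [Module.Finite Bᵐᵒᵖ M] [Module.Projective Bᵐᵒᵖ M]
    (I : Ideal B) [I.IsTwoSided] (z : BalancedTensor A (DualBimodule B M) M) :
    BalancedTensor.mapRight B M (mapHomRight A M I.toRight.mkQ) z = 0 ↔
      z ∈ I • (⊤ : Submodule B (BalancedTensor A (DualBimodule B M) M)) := by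
  let ν := mapHomRight A M I.toRight.mkQ
  have hν : ∀ f, ν f = 0 ↔ ∀ m, f m ∈ I := fun f =>
    ⟨fun h m => I.mkQ_toRight_eq_zero.1 (DFunLike.congr_fun h m),
      fun h => HomRight.ext fun m => I.mkQ_toRight_eq_zero.2 (h m)⟩
  constructor
  · intro hz
    -- By right exactness the kernel comes from Hom_B(M, I) ⊗_A M, and a dual basis of M shows
    -- Hom_B(M, I) = IN.
    obtain ⟨x, rfl⟩ := (BalancedTensor.mapRight_exact (S := B) (M := M)
      (f := (LinearMap.ker ν).subtype) (g := ν)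
      (LinearMap.exact_subtype_ker_map ν) (mapHomRight_surjective I.toRight.mkQ_surjective) z).1 hz
    obtain ⟨n, m, ξ, -, hξ⟩ := exists_dual_basis (B := B) (M := M)
    clear hz
    induction x using BalancedTensor.induction_on with
    | zero => rw [map_zero]; exact zero_mem _
    | tmul f v =>
      have hf := (hν f).1 f.2
      rw [BalancedTensor.mapRight_tmul, Submodule.subtype_apply, ← hξ f, BalancedTensor.sum_tmul]
      exact sum_mem fun j _ => Submodule.smul_mem_smul
        (n := BalancedTensor.tmul A (ξ j) v) (hf (m j)) trivial
    | add x y hx hy => rw [map_add]; exact add_mem hx hy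
  · intro h
    refine Submodule.smul_induction_on h (fun b hb t _ => ?_) fun s t hs ht => by
      rw [map_add, hs, ht, add_zero]
    induction t using BalancedTensor.induction_on with
    | zero => rw [smul_zero, map_zero]
    | tmul f m =>
      rw [BalancedTensor.left_smul_tmul, BalancedTensor.mapRight_tmul]
      rw [(hν (b • f)).2 fun m => I.mul_mem_right (f m) hb, BalancedTensor.zero_tmul]
    | add x y hx hy => rw [smul_add, map_add, hx trivial, hy trivial, add_zero]

end DualBimodule

namespace TensorInducesKatoEquivalence

open BalancedTensor HomRight

section

variable {A B M : Type u} [Ring A] [Ring B] [AddCommGroup M] [Module A M] [Module Bᵐᵒᵖ M]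
  [SMulCommClass A Bᵐᵒᵖ M] [IsNoetherianRing A] [IsNoetherianRing Aᵐᵒᵖ] [IsNoetherianRing B]
  [IsNoetherianRing Bᵐᵒᵖ] [Module.Finite Bᵐᵒᵖ M]
  [Module.Projective Bᵐᵒᵖ M] [Module.Finite Aᵐᵒᵖ (DualBimodule B M)]
  [Module.Projective Aᵐᵒᵖ (DualBimodule B M)]

/-- The counit is a split epimorphism and a stable isomorphism. -/
theorem exists_counit_section (hM : TensorInducesKatoEquivalence A B M) (hB : NoRegularBlock B)
    (Y : Type u) [AddCommGroup Y] [Module Bᵐᵒᵖ Y] [Module.Finite Bᵐᵒᵖ Y] :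
    ∃ s : Y →ₗ[Bᵐᵒᵖ] BalancedTensor A (HomRight B M Y) M, counit A B M Y ∘ₗ s = LinearMap.id ∧
      FactorsThroughFree (s ∘ₗ counit A B M Y - LinearMap.id) := by
  obtain ⟨n, m, ν, h⟩ := hM.exists_evaluation hB
  obtain ⟨g, h1, h2⟩ := hM.counit_stable Y
  refine FactorsThroughFree.exists_section (fun y => ?_) h1 h2
  refine ⟨∑ j, tmul A (toHomRight A B M Y (tmul B y (ν j))) (m j), ?_⟩
  simp only [map_sum, HomRight.counit_tmul, toHomRight_tmul]
  rw [← Finset.sum_smul, ← Finset.op_sum, h, op_one, one_smul]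

end

variable {k A B M : Type u} [Field k] [Ring A] [Algebra k A] [Ring B] [Algebra k B]
  [Module.Finite k B] [AddCommGroup M] [Module A M] [Module Bᵐᵒᵖ M]
  [SMulCommClass A Bᵐᵒᵖ M] [IsNoetherianRing A] [IsNoetherianRing Aᵐᵒᵖ] [IsNoetherianRing B]
  [IsNoetherianRing Bᵐᵒᵖ] [Module.Finite Bᵐᵒᵖ M]
  [Module.Projective Bᵐᵒᵖ M] [Module.Finite Aᵐᵒᵖ (DualBimodule B M)]
  [Module.Projective Aᵐᵒᵖ (DualBimodule B M)] [Module.Finite A M] [Module.Projective A M]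

/-- `N ⊗_A M` is the sum of `B` and a projective bimodule. -/
theorem isRegularPlusProjective_dual_tensor (hM : TensorInducesKatoEquivalence A B M)
    (hB : NoRegularBlock B) (hsep : IsSeparableAlgebra k (B ⧸ Ring.jacobson B))
    (hnil : IsNilpotent (Ring.jacobson B))
    (hk : ∀ (r : k) (m : M), algebraMap k A r • m = op (algebraMap k B r) • m) :
    IsRegularPlusProjective k B (BalancedTensor A (DualBimodule B M) M) := by
  let r := Ring.jacobson B
  let Z := BalancedTensor A (DualBimodule B M) M
  let Y := B ⧸ r.toRight
  let W := KDual k B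
  let ε := DualBimodule.evaluation A B M
  have hεr : ∀ (b : B) (z : Z), ε (op b • z) = ε z * b := DualBimodule.evaluation_op_smul
  obtain ⟨n, m, ν, hν⟩ := hM.exists_evaluation hB
  let z₀ : Z := ∑ j, tmul A (ν j) (m j)
  have hz₀ : ε z₀ = 1 := by rw [map_sum]; exact hν
  have := DualBimodule.projective_left (B := B) (M := M)
  have := DualBimodule.finite_left (B := B) (M := M)
  have : Module.Projective B Z := BalancedTensor.projective_left
  have : Module.Finite B Z := BalancedTensor.finite_left
  have hc : ∀ (c : k) (z : Z), algebraMap k B c • z = algebraMap k Bᵐᵒᵖ c • z := fun c z => by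
    induction z using BalancedTensor.induction_on with
    | zero => rw [smul_zero, smul_zero]
    | tmul f v =>
      have h1 : algebraMap k B c • f = op (algebraMap k A c) • f := DualBimodule.ext fun v => by
        rw [DualBimodule.left_smul_apply, DualBimodule.right_smul_apply, hk,
          DualBimodule.apply_smul, Algebra.commutes]
      rw [left_smul_tmul, h1, BalancedTensor.smul_tmul, hk]
      rfl
    | add x y hx hy => rw [smul_add, hx, hy, smul_add]
  -- The counit is used at two modules. At B/r its kernel is the reduction of ker ε and is
  -- projective on the right; at W its section provides the extension property.
  obtain ⟨s, hs, hs'⟩ := hM.exists_counit_section hB Y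
  have := FactorsThroughFree.projective_ker hs hs'
  let κ : Z →ₗ[Bᵐᵒᵖ] BalancedTensor A (HomRight B M Y) M :=
    mapRight B M (DualBimodule.mapHomRight A M r.toRight.mkQ)
  have hκε : ∀ z, counit A B M Y (κ z) = r.toRight.mkQ (ε z) :=
    DualBimodule.counit_mapRight_mapHomRight _
  have hκ : ∀ z, κ z = 0 ↔ z ∈ r • (⊤ : Submodule B Z) :=
    DualBimodule.mapRight_mapHomRight_mkQ_eq_zero r
  have hκs : Function.Surjective κ :=
    mapRight_surjective (DualBimodule.mapHomRight_surjective r.toRight.mkQ_surjective)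
  let q : LinearMap.ker ε →+ LinearMap.ker (counit A B M Y) := AddMonoidHom.mk'
    (fun z => ⟨κ z, by
      rw [LinearMap.mem_ker, hκε, show ε z = 0 from z.2, _root_.map_zero]⟩)
    fun z z' => Subtype.ext (_root_.map_add κ _ _)
  have hq : ∀ z, (q z : BalancedTensor A (HomRight B M Y) M) = κ z := fun z => rfl
  obtain ⟨σ, hσ, -⟩ := hM.exists_counit_section hB W
  let p : BalancedTensor B W Z →ₗ[Bᵐᵒᵖ] W :=
    liftRight (AddMonoidHom.mk' (fun w => AddMonoidHom.mk' (fun z => op (ε z) • w)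
        fun z z' => by rw [_root_.map_add, MulOpposite.op_add, add_smul])
        fun w w' => AddMonoidHom.ext fun z => smul_add _ w w')
      (fun w b z => by
        change op (ε z) • op b • w = op (ε (b • z)) • w
        rw [map_smul, smul_eq_mul, op_mul, mul_smul])
      (fun w b z => by
        change op (ε (b • z)) • w = b • op (ε z) • w
        rw [← op_unop b, hεr, op_mul, mul_smul])
  -- Since Hom_B(M, W) ≅ W ⊗_B N, associativity carries the counit at W to p, and the section σ to a
  -- section of p.
  let e : BalancedTensor A (HomRight B M W) M →ₗ[Bᵐᵒᵖ] BalancedTensor B W Z :=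
    assocInv W (DualBimodule B M) M ∘ₗ mapRight B M (toHomRightEquiv A B M W).symm.toLinearMap
  have hpe : p ∘ₗ e = counit A B M W := by
    have h1 : (p ∘ₗ e) ∘ₗ mapRight B M (toHomRightEquiv A B M W).toLinearMap =
        counit A B M W ∘ₗ mapRight B M (toHomRightEquiv A B M W).toLinearMap := by
      have h2 : p ∘ₗ assocInv W (DualBimodule B M) M =
          counit A B M W ∘ₗ mapRight B M (toHomRightEquiv A B M W).toLinearMap := by
        refine linearMap_ext fun t v => ?_
        induction t using BalancedTensor.induction_on with
        | zero => rw [BalancedTensor.zero_tmul, _root_.map_zero, _root_.map_zero]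
        | tmul w f => rfl
        | add x y hx hy => rw [BalancedTensor.add_tmul, _root_.map_add, hx, hy, _root_.map_add]
      rw [← h2, LinearMap.comp_assoc, LinearMap.comp_assoc, ← mapRight_comp,
        LinearEquiv.symm_comp, mapRight_id, LinearMap.comp_id]
    exact (LinearMap.cancel_right
      (mapRight_surjective (toHomRightEquiv A B M W).surjective)).1 h1
  refine isRegularPlusProjective_of_counit hsep hnil hc ε hεr z₀ hz₀ q (fun d => ?_)
    (fun b z z' h => Subtype.ext ?_) (fun z => ?_)
    (exists_extension hc ε hεr z₀ hz₀ p (fun w z => rfl) (e ∘ₗ σ)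
      (by rw [← LinearMap.comp_assoc, hpe, hσ]))
  · obtain ⟨z, hz⟩ := hκs d
    have h1 : ε z ∈ r := by
      rw [← r.mkQ_toRight_eq_zero, ← hκε, hz]
      exact d.2
    refine ⟨⟨z - ε z • z₀, ?_⟩, Subtype.ext ?_⟩
    · rw [LinearMap.mem_ker, _root_.map_sub, map_smul, hz₀, smul_eq_mul, mul_one, sub_self]
    · rw [hq, _root_.map_sub, hz, (hκ _).2 (Submodule.smul_mem_smul h1 trivial), sub_zero]
  · rw [hq, h, map_smul]
    rfl
  · rw [← hκ, ← hq, ZeroMemClass.coe_eq_zero]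

end TensorInducesKatoEquivalence

/-! ### The main theorem -/

theorem theorem4p5 (k A B M : Type u) [Field k]
    [Ring A] [Algebra k A] [Module.Finite k A]
    [Ring B] [Algebra k B] [Module.Finite k B]
    (hA : NoSemisimpleSummand A) (hB : NoSemisimpleSummand B)
    (hsepA : IsSeparableAlgebra k (A ⧸ Ring.jacobson A))
    (hsepB : IsSeparableAlgebra k (B ⧸ Ring.jacobson B))
    [AddCommGroup M] [Module k M] [Module.Finite k M]
    [Module A M] [Module Bᵐᵒᵖ M] [SMulCommClass A Bᵐᵒᵖ M]
    [IsScalarTower k A M] [IsScalarTower k Bᵐᵒᵖ M]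
    (hM : TensorInducesKatoEquivalence A B M) :
    IsStableEquivalenceOfMoritaType k A B M (DualBimodule B M) := by
  have hk : ∀ (r : k) (m : M), algebraMap k A r • m = op (algebraMap k B r) • m := fun r m =>
    (algebraMap_smul A r m).trans (algebraMap_smul Bᵐᵒᵖ r m).symm
  have : Module.Finite k Aᵐᵒᵖ := Module.Finite.equiv (opLinearEquiv k)
  have : Module.Finite k Bᵐᵒᵖ := Module.Finite.equiv (opLinearEquiv k)
  have : IsArtinianRing A := IsArtinianRing.of_finite k A
  have : IsArtinianRing B := IsArtinianRing.of_finite k B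
  have : IsNoetherianRing A := IsNoetherianRing.of_finite k A
  have : IsNoetherianRing Aᵐᵒᵖ := IsNoetherianRing.of_finite k Aᵐᵒᵖ
  have : IsNoetherianRing B := IsNoetherianRing.of_finite k B
  have : IsNoetherianRing Bᵐᵒᵖ := IsNoetherianRing.of_finite k Bᵐᵒᵖ
  have : Module.Finite A M := Module.Finite.of_restrictScalars_finite k A M
  have : Module.Finite Bᵐᵒᵖ M := Module.Finite.of_restrictScalars_finite k Bᵐᵒᵖ M
  have : Module.Projective Bᵐᵒᵖ M := hM.projective_right
  have : Module.Projective A M := hM.projective_left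
  have : Module.Projective B (DualBimodule B M) := DualBimodule.projective_left
  have : Module.Finite B (DualBimodule B M) := DualBimodule.finite_left
  -- The k-structure on N comes from B; as M is k-central it agrees with the one from A, so
  -- finiteness over k gives finiteness over Aᵐᵒᵖ.
  let : Module k (DualBimodule B M) := Module.compHom _ (algebraMap k B)
  have : IsScalarTower k B (DualBimodule B M) := ⟨fun r b f => by
    rw [Algebra.smul_def, mul_smul]; rfl⟩
  have : IsScalarTower k Aᵐᵒᵖ (DualBimodule B M) := ⟨fun r a f => DualBimodule.ext fun m => by
    rw [← op_unop a, ← op_smul, DualBimodule.right_smul_apply, Algebra.smul_def, mul_smul,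
      hk, DualBimodule.apply_smul, ← Algebra.commutes]
    rfl⟩
  have : Module.Finite k (DualBimodule B M) := Module.Finite.trans B _
  have : Module.Finite Aᵐᵒᵖ (DualBimodule B M) :=
    Module.Finite.of_restrictScalars_finite k Aᵐᵒᵖ _
  have : Module.Projective Aᵐᵒᵖ (DualBimodule B M) := hM.projective_dual
  exact
    { projective_left_M := inferInstance
      projective_right_M := inferInstance
      projective_left_N := inferInstance
      projective_right_N := inferInstance
      tensor_M_N := hM.isRegularPlusProjective_tensor_dual hA.noRegularBlock hsepA
        IsSemiprimaryRing.isNilpotent hk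
      tensor_N_M := hM.isRegularPlusProjective_dual_tensor hB.noRegularBlock hsepB
        IsSemiprimaryRing.isNilpotent hk }
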